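/- Let $n\ge 1$, let $\Omega=\prod_{i=1}^n(a_i,b_i)\subset\mathbb R^n$ be an open cuboid, and let $\Omega_1$ be a nonempty open set with $\overline{\Omega_1}\subset\Omega$ and with boundary of class $C^3$; put $\Omega_2=\Omega\setminus\overline{\Omega_1}$. Let $\alpha,\beta,\gamma>0$ be constants, $q,h\in L^2(\Omega)$ and $g\in H^1(\Omega)$. Let $r$ be the signed distance function to $\partial\Omega_1$, positive in $\Omega_1$ and negative outside $\overline{\Omega_1}$. Put $$D_0=\chi_{\Omega_1}+\alpha\chi_{\Omega_2},\qquad c_0=\gamma\chi_{\Omega_1}+\beta\chi_{\Omega_2},\qquad f_0=q\chi_{\Omega_1}+h\chi_{\Omega_2},$$ and, for $\varepsilon\in(0,1)$, $$\phi_\varepsilon=\tfrac12\bigl[1+\tanh(r/\varepsilon)\bigr],\quad D_\varepsilon=\alpha+(1-\alpha)\phi_\varepsilon,\quad c_\varepsilon=\beta+(\gamma-\beta)\phi_\varepsilon,\quad f_\varepsilon=h+(q-h)\phi_\varepsilon .$$ (1) There is a unique weak solution $u_0\in H^1(\Omega)$ of the two-sided problem (with $\kappa=0$) $$-\Delta u_1+\gamma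 u_1=q\ \text{in }\Omega_1,\qquad -\alpha\Delta u_2+\beta u_2=h\ \text{in }\Omega_2,$$ $$u_1=u_2\ \text{ and }\ -\nabla(u_1-\alpha u_2)\cdot\boldsymbol n_1=g\ \text{on }\partial\Omega_1,\qquad \alpha\nabla u_2\cdot\boldsymbol n_2=0\ \text{on }\partial\Omega,$$ where $u_i=u_0|_{\Omega_i}$ and $\boldsymbol n_1,\boldsymbol n_2$ are the outward unit normals of $\Omega_1$ and $\Omega$; that is, with $g,v$ on $\partial\Omega_1$ understood as traces and $dS$ the surface measure, $$\int_\Omega (D_0\nabla u_0\cdot\nabla v+c_0u_0v)\,dx+\int_{\partial\Omega_1}g v\,dS=\int_\Omega f_0v\,dx\qquad\text{for all }v\in H^1(\Omega).$$ (2) For each $\varepsilon\in(0,1)$ there is a unique weak solution $u_\varepsilon\in H^1(\Omega)$ of the diffuse domain problem (with $\kappa=0$) $$-\nabla\cdot(D_\varepsilon\nabla u_\varepsilon)+c_\varepsilon u_\varepsilon+g|\nabla\phi_\varepsilon|=f_\varepsilon\ \text{in }\Omega,\qquad D_\varepsilon\nabla u_\varepsilon\cdot\boldsymbol n_2=0\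 \text{on }\partial\Omega,$$ that is, $$\int_\Omega (D_\varepsilon\nabla u_\varepsilon\cdot\nabla v+c_\varepsilon u_\varepsilon v+g|\nabla\phi_\varepsilon|v)\,dx=\int_\Omega f_\varepsilon v\,dx\qquad\text{for all }v\in H^1(\Omega).$$ (3) For every sequence $(\varepsilon_k)\subset(0,1)$ with $\varepsilon_k\to0$ there is a subsequence $(\varepsilon_{k_j})$ such that $u_{\varepsilon_{k_j}}\to u_0$ strongly in $H^1(\Omega)$ as $j\to\infty$. -/

import Mathlib

open MeasureTheory Set Filter Topology
open scoped ContDiff RealInnerProductSpace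

noncomputable section

namespace DiffuseDomain

/-- `ℝⁿ` with the Euclidean norm. -/
abbrev Rn (n : ℕ) : Type := EuclideanSpace ℝ (Fin n)

/-- The open cuboid `∏ (aᵢ, bᵢ)`. -/
def cuboid {n : ℕ} (a b : Fin n → ℝ) : Set (Rn n) :=
  {x | ∀ i, a i < x i ∧ x i < b i}

/-- The set `U` has a boundary of class `C³`: near each boundary point, `U` is the sublevel set
`{ρ < 0}` of a `C³` function `ρ` whose differential does not vanish at the point (in particular `U`
lies locally on one side of its boundary). -/
def HasC3Boundary {n : ℕ} (U : Set (Rn n)) : Prop :=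
  ∀ x ∈ frontier U, ∃ (V : Set (Rn n)) (ρ : Rn n → ℝ),
    IsOpen V ∧ x ∈ V ∧ ContDiffOn ℝ 3 ρ V ∧ fderiv ℝ ρ x ≠ 0 ∧ U ∩ V = {y ∈ V | ρ y < 0}

/-! ### The spaces `L²(Ω)` and `H¹(Ω)` -/

/-- Real functions in `L²(Ω)`. -/
abbrev L2 {n : ℕ} (Ω : Set (Rn n)) : Type :=
  Lp ℝ 2 ((volume : Measure (Rn n)).restrict Ω)

/-- Vector fields in `L²(Ω; ℝⁿ)`. -/
abbrev L2Vec {n : ℕ} (Ω : Set (Rn n)) : Type :=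
  Lp (Rn n) 2 ((volume : Measure (Rn n)).restrict Ω)

/-- `G` is the weak gradient of `u` on `Ω`:
`∫_Ω u ∂ᵢψ = - ∫_Ω Gᵢ ψ` for all `i` and all `ψ ∈ C_c^∞(Ω)`. -/
def IsWeakGradient {n : ℕ} (Ω : Set (Rn n)) (u : Rn n → ℝ) (G : Rn n → Rn n) : Prop :=
  ∀ ψ : Rn n → ℝ, ContDiff ℝ ∞ ψ → HasCompactSupport ψ → tsupport ψ ⊆ Ω →
    ∀ i : Fin n,
      ∫ x in Ω, u x * fderiv ℝ ψ x (EuclideanSpace.single i 1) = -∫ x in Ω, G x i * ψ x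

theorem integrable_mul_of_continuous {n : ℕ} {Ω : Set (Rn n)} (u : L2 Ω) {ψ : Rn n → ℝ}
    (hc : Continuous ψ) (hs : HasCompactSupport ψ) :
    Integrable (fun x => u x * ψ x) (volume.restrict Ω) := by
  have hψ : MemLp ψ 2 (volume.restrict Ω) := hc.memLp_of_hasCompactSupport hs
  exact (Lp.memLp u).integrable_mul hψ

theorem integrable_coord_mul {n : ℕ} {Ω : Set (Rn n)} (G : L2Vec Ω) (i : Fin n) {ψ : Rn n → ℝ}
    (hc : Continuous ψ) (hs : HasCompactSupport ψ) :
    Integrable (fun x => G x i * ψ x) (volume.restrict Ω) := by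
  have hG : MemLp (fun x => G x i) 2 (volume.restrict Ω) :=
    (EuclideanSpace.proj i : Rn n →L[ℝ] ℝ).comp_memLp' (Lp.memLp G)
  have hψ : MemLp ψ 2 (volume.restrict Ω) := hc.memLp_of_hasCompactSupport hs
  exact hG.integrable_mul hψ

theorem continuous_partial {n : ℕ} {ψ : Rn n → ℝ} (hψ : ContDiff ℝ ∞ ψ) (e : Rn n) :
    Continuous fun x => fderiv ℝ ψ x e :=
  (hψ.continuous_fderiv (by simp)).clm_apply continuous_const

theorem hasCompactSupport_partial {n : ℕ} {ψ : Rn n → ℝ} (hs : HasCompactSupport ψ) (e : Rn n) :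
    HasCompactSupport fun x => fderiv ℝ ψ x e :=
  hs.fderiv_apply (𝕜 := ℝ) e

/-- The Sobolev space `H¹(Ω)`, realised as the space of pairs `(u, ∇u)` with `u ∈ L²(Ω)` and weak
gradient `∇u ∈ L²(Ω; ℝⁿ)`, with the norm `(‖u‖² + ‖∇u‖²)^{1/2}` inherited from the `ℓ²`-product. -/
def H1Submodule {n : ℕ} (Ω : Set (Rn n)) : Submodule ℝ (WithLp 2 (L2 Ω × L2Vec Ω)) where
  carrier := {w | IsWeakGradient Ω w.fst w.snd}
  zero_mem' := by
    intro ψ _ _ _ i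
    have h1 : ((0 : WithLp 2 (L2 Ω × L2Vec Ω)).fst : Rn n → ℝ) =ᵐ[volume.restrict Ω] 0 :=
      Lp.coeFn_zero _ _ _
    have h2 : ((0 : WithLp 2 (L2 Ω × L2Vec Ω)).snd : Rn n → Rn n) =ᵐ[volume.restrict Ω] 0 :=
      Lp.coeFn_zero _ _ _
    rw [integral_eq_zero_of_ae, integral_eq_zero_of_ae, neg_zero]
    · filter_upwards [h2] with x hx
      rw [hx]
      simp
    · filter_upwards [h1] with x hx
      rw [hx]
      simp
  add_mem' := by
    intro v w hv hw ψ hψ hs ht i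
    have h1 : ((v + w).fst : Rn n → ℝ) =ᵐ[volume.restrict Ω] v.fst + w.fst := Lp.coeFn_add _ _
    have h2 : ((v + w).snd : Rn n → Rn n) =ᵐ[volume.restrict Ω] v.snd + w.snd := Lp.coeFn_add _ _
    have hc := continuous_partial hψ (EuclideanSpace.single i 1)
    have hcs := hasCompactSupport_partial hs (EuclideanSpace.single i 1)
    have e1 : ∫ x in Ω, (v + w).fst x * fderiv ℝ ψ x (EuclideanSpace.single i 1) =
        ∫ x in Ω, (v.fst x * fderiv ℝ ψ x (EuclideanSpace.single i 1) +
          w.fst x * fderiv ℝ ψ x (EuclideanSpace.single i 1)) := by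
      refine integral_congr_ae ?_
      filter_upwards [h1] with x hx
      rw [hx, Pi.add_apply, add_mul]
    have e2 : ∫ x in Ω, (v + w).snd x i * ψ x =
        ∫ x in Ω, (v.snd x i * ψ x + w.snd x i * ψ x) := by
      refine integral_congr_ae ?_
      filter_upwards [h2] with x hx
      rw [hx, Pi.add_apply, PiLp.add_apply, add_mul]
    rw [e1, e2, integral_add (integrable_mul_of_continuous _ hc hcs)
      (integrable_mul_of_continuous _ hc hcs),
      integral_add (integrable_coord_mul _ i hψ.continuous hs)
      (integrable_coord_mul _ i hψ.continuous hs), hv ψ hψ hs ht i, hw ψ hψ hs ht i, neg_add]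
  smul_mem' := by
    intro c w hw ψ hψ hs ht i
    have h1 : ((c • w).fst : Rn n → ℝ) =ᵐ[volume.restrict Ω] c • ⇑w.fst := Lp.coeFn_smul _ _
    have h2 : ((c • w).snd : Rn n → Rn n) =ᵐ[volume.restrict Ω] c • ⇑w.snd := Lp.coeFn_smul _ _
    have e1 : ∫ x in Ω, (c • w).fst x * fderiv ℝ ψ x (EuclideanSpace.single i 1) =
        ∫ x in Ω, c * (w.fst x * fderiv ℝ ψ x (EuclideanSpace.single i 1)) := by
      refine integral_congr_ae ?_
      filter_upwards [h1] with x hx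
      rw [hx, Pi.smul_apply, smul_eq_mul, mul_assoc]
    have e2 : ∫ x in Ω, (c • w).snd x i * ψ x = ∫ x in Ω, c * (w.snd x i * ψ x) := by
      refine integral_congr_ae ?_
      filter_upwards [h2] with x hx
      rw [hx, Pi.smul_apply, PiLp.smul_apply, smul_eq_mul, mul_assoc]
    rw [e1, e2, integral_const_mul, integral_const_mul, hw ψ hψ hs ht i, mul_neg]

/-- The Hilbert space `H¹(Ω)`. -/
abbrev H1 {n : ℕ} (Ω : Set (Rn n)) : Type := H1Submodule Ω

/-- The function underlying an element of `H¹(Ω)`. -/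
def H1.fn {n : ℕ} {Ω : Set (Rn n)} (u : H1 Ω) : L2 Ω := u.1.fst

/-- The weak gradient of an element of `H¹(Ω)`. -/
def H1.grad {n : ℕ} {Ω : Set (Rn n)} (u : H1 Ω) : L2Vec Ω := u.1.snd

/-! ### Surface measure and trace on `∂Ω₁` -/

/-- The surface measure `dS` on `∂Ω₁`: the `(n-1)`-dimensional Hausdorff measure, normalised so
that it agrees with Lebesgue measure on `(n-1)`-dimensional planes, restricted to `∂Ω₁`. -/
def surfaceMeasure {n : ℕ} (Ω₁ : Set (Rn n)) : Measure (Rn n) :=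
  (Measure.euclideanHausdorffMeasure (n - 1)).restrict (frontier Ω₁)

/-- `τ ∈ L²(∂Ω₁)` is the trace of `u ∈ H¹(Ω)` on `∂Ω₁`: there are smooth functions on `ℝⁿ` that
converge to `u` in `H¹(Ω)` and whose restrictions to `∂Ω₁` converge to `τ` in `L²(∂Ω₁)`. -/
def IsTrace {n : ℕ} {Ω : Set (Rn n)} (Ω₁ : Set (Rn n)) (u : H1 Ω)
    (τ : Lp ℝ 2 (surfaceMeasure Ω₁)) : Prop :=
  ∃ ψ : ℕ → Rn n → ℝ, (∀ k, ContDiff ℝ ∞ (ψ k)) ∧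
    Tendsto (fun k => eLpNorm (fun x => ψ k x - u.fn x) 2 (volume.restrict Ω)) atTop (𝓝 0) ∧
    Tendsto (fun k => eLpNorm (fun x => gradient (ψ k) x - u.grad x) 2 (volume.restrict Ω))
      atTop (𝓝 0) ∧
    Tendsto (fun k => eLpNorm (fun x => ψ k x - τ x) 2 (surfaceMeasure Ω₁)) atTop (𝓝 0)

open Classical in
/-- The trace of `u ∈ H¹(Ω)` on `∂Ω₁` (the default `0` is never used when `∂Ω₁` is a `C³`
hypersurface inside the cuboid `Ω`, where the trace exists and is unique). -/
def trace {n : ℕ} {Ω : Set (Rn n)} (Ω₁ : Set (Rn n)) (u : H1 Ω) : Lp ℝ 2 (surfaceMeasure Ω₁) :=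
  if h : ∃ τ, IsTrace Ω₁ u τ then h.choose else 0

/-! ### The two-sided (sharp interface) problem with `κ = 0` -/

/-- `D₀ = χ_{Ω₁} + α χ_{Ω₂}`, `Ω₂ = Ω \ closure Ω₁`. -/
def D₀ {n : ℕ} (Ω Ω₁ : Set (Rn n)) (α : ℝ) (x : Rn n) : ℝ :=
  Ω₁.indicator (fun _ => 1) x + (Ω \ closure Ω₁).indicator (fun _ => α) x

/-- `c₀ = γ χ_{Ω₁} + β χ_{Ω₂}`. -/
def c₀ {n : ℕ} (Ω Ω₁ : Set (Rn n)) (β γ : ℝ) (x : Rn n) : ℝ :=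
  Ω₁.indicator (fun _ => γ) x + (Ω \ closure Ω₁).indicator (fun _ => β) x

/-- `f₀ = q χ_{Ω₁} + h χ_{Ω₂}`. -/
def f₀ {n : ℕ} (Ω Ω₁ : Set (Rn n)) (q h : Rn n → ℝ) (x : Rn n) : ℝ :=
  Ω₁.indicator q x + (Ω \ closure Ω₁).indicator h x

/-- `u ∈ H¹(Ω)` is a (weak) solution of the two-sided problem
`-Δu₁ + γu₁ = q` in `Ω₁`, `-αΔu₂ + βu₂ = h` in `Ω₂`, `u₁ = u₂` and `-∇(u₁ - αu₂)·n₁ = g` on `∂Ω₁`,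
`α∇u₂·n₂ = 0` on `∂Ω`. -/
def IsTwoSidedSolution {n : ℕ} (Ω Ω₁ : Set (Rn n)) (α β γ : ℝ) (q h : L2 Ω) (g u : H1 Ω) : Prop :=
  ∀ v : H1 Ω,
    (∫ x in Ω, (D₀ Ω Ω₁ α x * ⟪u.grad x, v.grad x⟫ + c₀ Ω Ω₁ β γ x * u.fn x * v.fn x)) +
      ∫ x, trace Ω₁ g x * trace Ω₁ v x ∂(surfaceMeasure Ω₁) =
    ∫ x in Ω, f₀ Ω Ω₁ q h x * v.fn x

/-! ### The diffuse domain problem with `κ = 0` -/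

open Classical in
/-- The signed distance to `∂Ω₁`, positive in `Ω₁` and negative outside `closure Ω₁`. -/
def signedDist {n : ℕ} (Ω₁ : Set (Rn n)) (x : Rn n) : ℝ :=
  if x ∈ Ω₁ then Metric.infDist x (frontier Ω₁) else -Metric.infDist x (frontier Ω₁)

/-- The phase field `φ_ε = ½ (1 + tanh (r / ε))`. -/
def phaseField {n : ℕ} (Ω₁ : Set (Rn n)) (ε : ℝ) (x : Rn n) : ℝ :=
  1 / 2 * (1 + Real.tanh (signedDist Ω₁ x / ε))

/-- `D_ε = α + (1 - α) φ_ε`. -/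
def Dε {n : ℕ} (Ω₁ : Set (Rn n)) (α ε : ℝ) (x : Rn n) : ℝ :=
  α + (1 - α) * phaseField Ω₁ ε x

/-- `c_ε = β + (γ - β) φ_ε`. -/
def cε {n : ℕ} (Ω₁ : Set (Rn n)) (β γ ε : ℝ) (x : Rn n) : ℝ :=
  β + (γ - β) * phaseField Ω₁ ε x

/-- `f_ε = h + (q - h) φ_ε`. -/
def fε {n : ℕ} (Ω₁ : Set (Rn n)) (q h : Rn n → ℝ) (ε : ℝ) (x : Rn n) : ℝ :=
  h x + (q x - h x) * phaseField Ω₁ ε x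

/-- `u ∈ H¹(Ω)` is a (weak) solution of the diffuse domain problem
`-∇·(D_ε ∇u) + c_ε u + g |∇φ_ε| = f_ε` in `Ω`, `D_ε ∇u·n₂ = 0` on `∂Ω`. The function `φ_ε` is
Lipschitz, so its classical gradient exists almost everywhere. -/
def IsDiffuseSolution {n : ℕ} (Ω Ω₁ : Set (Rn n)) (α β γ : ℝ) (q h : L2 Ω) (g : H1 Ω) (ε : ℝ)
    (u : H1 Ω) : Prop :=
  ∀ v : H1 Ω,
    ∫ x in Ω, (Dε Ω₁ α ε x * ⟪u.grad x, v.grad x⟫ + cε Ω₁ β γ ε x * u.fn x * v.fn x +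
      g.fn x * ‖gradient (phaseField Ω₁ ε) x‖ * v.fn x) =
    ∫ x in Ω, fε Ω₁ q h ε x * v.fn x

end DiffuseDomain

end

/-! The interface source and the diffuse source are two cases of one expression. Let X be a
compactly supported C¹ field in Ω that equals the inward unit normal on ∂Ω₁ (`exists_normal_field`).
The divergence theorem turns ∫_{∂Ω₁} g v dS into -∫_Ω φ div(g v X) with φ the indicator of Ω₁. For
the phase field, write |∇φ_ε| = ∇φ_ε·X + m_ε; integrating the first summand by parts gives -∫_Ω φ_ε
div(g v X). By the product rule ∫ φ div(g v X) is a bounded bilinear form in g, v ∈ H¹ (`fluxForm`),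
and φ enters it only as a bounded weight, never through a derivative. So both weak problems read
"energy = load" (`isTwoSidedSolution_iff`, `isDiffuseSolution_iff`), with φ or φ_ε in the
coefficients and in the load, and m_ε as the only extra term.

Existence and uniqueness are then Lax–Milgram. For the limit, φ_ε converges to the indicator off the
null set ∂Ω₁. Where the signed distance r is differentiable, ∇r(x) = X(y) for a nearest boundary
point y, so m_ε(x) = |∇φ_ε(x)| (1 - X(y)·X(x)), which is at most L s/(1+s²) with s = dist(x, ∂Ω₁)/ε
and L a Lipschitz constant of X. Thus m_ε is bounded uniformly in ε and tends to 0 almost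
everywhere, dominated convergence gives convergence of the loads in L² (`tendsto_load`), and
coercivity transfers it to strong convergence in H¹ (`tendsto_of_energy_eq`). No compactness is
used, and the whole sequence converges.

The divergence theorem for the Hausdorff measure is derived from Lipschitz bounds. Near a boundary
point with outer normal N the set is a subgraph over Nᗮ that is nearly flat; slicing along N gives
∫_U ∂_N w exactly as an integral over Nᗮ, and the Lipschitz constants of the graph map and of its
inverse, the orthogonal projection, compare this with the surface integral up to a factor near 1.
Monotonicity of U under translations in a cone around N controls the other derivatives. The relative
error η in small balls survives summation over a partition of unity and is then sent to 0
(`setIntegral_divergence_eq_neg_surface_of_nonneg`). Applied to squares of smooth functions the same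
identity bounds traces, so the trace exists and its products are computed by `fluxForm`
(`integral_trace_mul_trace`). -/

noncomputable section

namespace DiffuseDomain

/-! ### Flat charts, outer normals and monotonicity under translation -/

section

variable {n : ℕ}

/-- On the ball of radius `R` around the boundary point `y`, the set `U` is the sublevel set
`{σ < 0}` of a function `σ` that differs from the linear function `⟪N, ·⟫` by a function with
Lipschitz constant `θ`. -/
structure FlatChart (U : Set (Rn n)) (y N : Rn n) (θ R : ℝ) (σ : Rn n → ℝ) : Prop where
  pos : 0 < R
  approx : ∀ x ∈ Metric.ball y R, ∀ x' ∈ Metric.ball y R,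
    |σ x' - σ x - ⟪N, x' - x⟫| ≤ θ * ‖x' - x‖
  mem_iff : ∀ x ∈ Metric.ball y R, (x ∈ U ↔ σ x < 0)
  base : σ y = 0

/-- `N` is the outer unit normal of `U` at the boundary point `y`. -/
def IsNormal (U : Set (Rn n)) (y N : Rn n) : Prop :=
  ‖N‖ = 1 ∧ ∀ θ > 0, ∃ R σ, FlatChart U y N θ R σ

theorem FlatChart.mono {U : Set (Rn n)} {y N : Rn n} {θ R R' : ℝ} {σ : Rn n → ℝ}
    (h : FlatChart U y N θ R σ) (hR' : 0 < R') (hle : R' ≤ R) : FlatChart U y N θ R' σ where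
  pos := hR'
  approx x hx x' hx' :=
    h.approx x (Metric.ball_subset_ball hle hx) x' (Metric.ball_subset_ball hle hx')
  mem_iff x hx := h.mem_iff x (Metric.ball_subset_ball hle hx)
  base := h.base

theorem eq_zero_of_mem_frontier {U V : Set (Rn n)} {ρ : Rn n → ℝ} {y : Rn n} (hV : V ∈ 𝓝 y)
    (hρ : ContinuousAt ρ y) (hU : ∀ x ∈ V, (x ∈ U ↔ ρ x < 0)) (hy : y ∈ frontier U) :
    ρ y = 0 := by
  rcases lt_trichotomy (ρ y) 0 with h | h | h
  · exfalso
    apply hy.2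
    rw [mem_interior_iff_mem_nhds]
    filter_upwards [hV, hρ.eventually (gt_mem_nhds h)] with x hx hx'
    exact (hU x hx).2 hx'
  · exact h
  · exfalso
    obtain ⟨x, hxU, hxV, hx⟩ : ∃ x, x ∈ U ∧ x ∈ V ∧ 0 < ρ x := by
      have := mem_closure_iff_frequently.1 hy.1
      obtain ⟨x, hx⟩ := (this.and_eventually
        (Filter.Eventually.and hV (hρ.eventually (lt_mem_nhds h)))).exists
      exact ⟨x, hx.1, hx.2.1, hx.2.2⟩
    exact absurd ((hU x hxV).1 hxU) (not_lt.2 hx.le)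

/-- Dividing the defining function by |∇ρ(y)| makes its linear part at y a unit covector. Continuity
of the differential and the mean value inequality make the remainder θ-Lipschitz on a small ball,
for any prescribed θ. -/
theorem isNormal_of_chart {U V : Set (Rn n)} {ρ : Rn n → ℝ} {y : Rn n} (hV : IsOpen V)
    (hyV : y ∈ V) (hρ : ContDiffOn ℝ 1 ρ V) (hρ' : fderiv ℝ ρ y ≠ 0)
    (hU : ∀ x ∈ V, (x ∈ U ↔ ρ x < 0)) (hy : y ∈ frontier U) :
    IsNormal U y (‖gradient ρ y‖⁻¹ • gradient ρ y) := by
  have hg : gradient ρ y ≠ 0 := by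
    rw [gradient]; simpa using hρ'
  have hg' : 0 < ‖gradient ρ y‖ := norm_pos_iff.2 hg
  refine ⟨?_, fun θ hθ => ?_⟩
  · rw [norm_smul, norm_inv, norm_norm, inv_mul_cancel₀ hg'.ne']
  set κ := ‖gradient ρ y‖ with hκ
  have hcont : ContinuousAt (fderiv ℝ ρ) y :=
    (hρ.continuousOn_fderiv_of_isOpen hV (by simp)).continuousAt (hV.mem_nhds hyV)
  have hev : ∀ᶠ x in 𝓝 y, x ∈ V ∧ ‖fderiv ℝ ρ x - fderiv ℝ ρ y‖ ≤ θ * κ := by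
    refine Filter.Eventually.and (hV.mem_nhds hyV) ?_
    have := Metric.continuousAt_iff'.1 hcont (θ * κ) (by positivity)
    filter_upwards [this] with x hx
    rw [← dist_eq_norm]; exact hx.le
  obtain ⟨R, hR, hball⟩ := Metric.eventually_nhds_iff_ball.1 hev
  refine ⟨R, fun x => κ⁻¹ * ρ x, hR, ?_, ?_, ?_⟩
  · intro x hx x' hx'
    have := (convex_ball y R).norm_image_sub_le_of_norm_fderiv_le' (𝕜 := ℝ) (f := ρ)
      (C := θ * κ) (φ := fderiv ℝ ρ y)
      (fun z hz => (hρ.differentiableOn (by simp)).differentiableAt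
        (hV.mem_nhds (hball z hz).1)) (fun z hz => (hball z hz).2) hx hx'
    have e : fderiv ℝ ρ y (x' - x) = ⟪gradient ρ y, x' - x⟫ := by
      rw [gradient, InnerProductSpace.toDual_symm_apply]
    rw [e] at this
    rw [real_inner_smul_left, ← mul_sub, ← mul_sub, abs_mul, abs_of_pos (inv_pos.2 hg')]
    rw [Real.norm_eq_abs] at this
    calc κ⁻¹ * |ρ x' - ρ x - ⟪gradient ρ y, x' - x⟫| ≤ κ⁻¹ * (θ * κ * ‖x' - x‖) := by gcongr
      _ = θ * ‖x' - x‖ := by field_simp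
  · intro x hx
    rw [hU x (hball x hx).1]
    constructor
    · intro h; exact mul_neg_of_pos_of_neg (inv_pos.2 hg') h
    · intro h; exact neg_of_mul_neg_right h (inv_pos.2 hg').le
  · have : ρ y = 0 := eq_zero_of_mem_frontier (hV.mem_nhds hyV)
      ((hρ.continuousOn).continuousAt (hV.mem_nhds hyV)) hU hy
    simp [this]

theorem eventually_add_smul_mem_ball {y e : Rn n} {R : ℝ} (hR : 0 < R) :
    ∀ᶠ t : ℝ in 𝓝[>] 0, y + t • e ∈ Metric.ball y R := by
  have : Tendsto (fun t : ℝ => y + t • e) (𝓝[>] 0) (𝓝 (y + (0 : ℝ) • e)) :=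
    (Continuous.tendsto (by fun_prop) 0).mono_left nhdsWithin_le_nhds
  rw [zero_smul, add_zero] at this
  exact this (Metric.ball_mem_nhds y hR)

/-- With θ of about half the size |⟪N, e⟫| / ‖e‖, the linear term dominates the error along the ray,
so σ keeps the sign of ⟪N, e⟫. The summand 1 in the denominator of θ only keeps it nonzero. -/
theorem IsNormal.eventually_mem {U : Set (Rn n)} {y N e : Rn n} (h : IsNormal U y N)
    (he : ⟪N, e⟫ < 0) : ∀ᶠ t : ℝ in 𝓝[>] 0, y + t • e ∈ U := by
  have hθ : 0 < -⟪N, e⟫ / (2 * (‖e‖ + 1)) := by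
    have := norm_nonneg e
    apply div_pos <;> linarith
  obtain ⟨R, σ, hf⟩ := h.2 _ hθ
  filter_upwards [eventually_add_smul_mem_ball (y := y) (e := e) hf.pos, self_mem_nhdsWithin]
    with t ht ht0
  have ht0 : 0 < t := ht0
  rw [hf.mem_iff _ ht]
  have h1 := hf.approx y (Metric.mem_ball_self hf.pos) _ ht
  rw [hf.base, add_sub_cancel_left, inner_smul_right, norm_smul, Real.norm_of_nonneg ht0.le] at h1
  have h2 := (abs_le.1 h1).2
  have h3 : -⟪N, e⟫ / (2 * (‖e‖ + 1)) * (t * ‖e‖) ≤ t * (-⟪N, e⟫ / 2) := by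
    rw [div_mul_eq_mul_div, div_le_iff₀ (by positivity)]
    nlinarith [mul_pos ht0 (neg_pos.2 he)]
  nlinarith [mul_pos ht0 (neg_pos.2 he)]

theorem IsNormal.eventually_notMem {U : Set (Rn n)} {y N e : Rn n} (h : IsNormal U y N)
    (he : 0 < ⟪N, e⟫) : ∀ᶠ t : ℝ in 𝓝[>] 0, y + t • e ∉ U := by
  have hθ : 0 < ⟪N, e⟫ / (2 * (‖e‖ + 1)) := by
    have := norm_nonneg e
    apply div_pos <;> linarith
  obtain ⟨R, σ, hf⟩ := h.2 _ hθ
  filter_upwards [eventually_add_smul_mem_ball (y := y) (e := e) hf.pos, self_mem_nhdsWithin]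
    with t ht ht0
  have ht0 : 0 < t := ht0
  rw [hf.mem_iff _ ht]
  have h1 := hf.approx y (Metric.mem_ball_self hf.pos) _ ht
  rw [hf.base, add_sub_cancel_left, inner_smul_right, norm_smul, Real.norm_of_nonneg ht0.le] at h1
  have h2 := (abs_le.1 h1).1
  have h3 : ⟪N, e⟫ / (2 * (‖e‖ + 1)) * (t * ‖e‖) ≤ t * (⟪N, e⟫ / 2) := by
    rw [div_mul_eq_mul_div, div_le_iff₀ (by positivity)]
    nlinarith [mul_pos ht0 he]
  nlinarith [mul_pos ht0 he]

theorem inner_sub_pos_of_ne {p q : Rn n} (hp : ‖p‖ = 1) (hq : ‖q‖ = 1) (hne : p ≠ q) :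
    0 < ⟪p, p - q⟫ ∧ ⟪q, p - q⟫ < 0 := by
  have h1 : ⟪p, q⟫ < 1 := by
    refine lt_of_le_of_ne ?_ fun h => hne ((inner_eq_one_iff_of_norm_eq_one hp hq).1 h)
    have := real_inner_le_norm p q
    rwa [hp, hq, one_mul] at this
  rw [inner_sub_right, inner_sub_right, real_inner_self_eq_norm_sq, real_inner_self_eq_norm_sq,
    hp, hq, real_inner_comm p q]
  constructor <;> linarith

/-- Of two distinct unit normals, the direction N - N' points out of U according to the first and
into U according to the second. -/
theorem IsNormal.unique {U : Set (Rn n)} {y N N' : Rn n} (h : IsNormal U y N)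
    (h' : IsNormal U y N') : N = N' := by
  by_contra hne
  obtain ⟨h1, h2⟩ := inner_sub_pos_of_ne h.1 h'.1 hne
  obtain ⟨t, ht, ht'⟩ := ((h.eventually_notMem h1).and (h'.eventually_mem h2)).exists
  exact ht ht'

/-- Derivatives along a direction in the cone given by a flat chart have a nonnegative integral:
the boundary term of a nonnegative function is nonnegative. -/
theorem FlatChart.setIntegral_fderiv_nonneg {U : Set (Rn n)} {y N e : Rn n} {θ R : ℝ}
    {σ : Rn n → ℝ} (h : FlatChart U y N θ R σ) (hU : IsOpen U) (hUb : Bornology.IsBounded U)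
    (he : θ * ‖e‖ ≤ ⟪N, e⟫)
    {w : Rn n → ℝ} (hw : ContDiff ℝ 1 w) (hwc : HasCompactSupport w)
    (hws : tsupport w ⊆ Metric.ball y R) (hw0 : ∀ x, 0 ≤ w x) :
    0 ≤ ∫ x in U, fderiv ℝ w x e := by
  obtain ⟨C, hC⟩ := ContDiff.lipschitzWith_of_hasCompactSupport hwc hw one_ne_zero
  have hfin : volume U ≠ ⊤ := hUb.measure_lt_top.ne
  have hInt : Integrable (U.indicator fun _ => (1 : ℝ)) (volume : Measure (Rn n)) :=
    (integrable_indicator_iff hU.measurableSet).2 (integrableOn_const hfin)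
  -- The integral of the derivative is the limit of integrated difference quotients. Translating the
  -- shifted term moves the shift from w to the indicator of U, where geometry decides the sign.
  have hlim := hC.integral_inv_smul_sub_mul_tendsto_integral_lineDeriv_mul hInt e
  have heq : ∫ x in U, fderiv ℝ w x e =
      ∫ x, lineDeriv ℝ w x e * U.indicator (fun _ => (1 : ℝ)) x := by
    rw [← integral_indicator hU.measurableSet]
    congr 1 with x
    rw [(hw.differentiable one_ne_zero x).lineDeriv_eq_fderiv]
    by_cases hx : x ∈ U <;> simp [hx]
  rw [heq]
  refine ge_of_tendsto hlim ?_
  obtain ⟨δ, hδ, hδs⟩ : ∃ δ > 0, Metric.thickening δ (tsupport w) ⊆ Metric.ball y R :=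
    hwc.exists_thickening_subset_open Metric.isOpen_ball hws
  have hsmall : ∀ᶠ t : ℝ in 𝓝[>] 0, t * ‖e‖ < δ := by
    have : Tendsto (fun t : ℝ => t * ‖e‖) (𝓝[>] 0) (𝓝 (0 * ‖e‖)) :=
      (Continuous.tendsto (by fun_prop) 0).mono_left nhdsWithin_le_nhds
    rw [zero_mul] at this
    exact this.eventually (gt_mem_nhds hδ)
  filter_upwards [hsmall, self_mem_nhdsWithin] with t ht ht0
  have ht0 : 0 < t := ht0
  have i1 : Integrable (fun x => w (x + t • e) * U.indicator (fun _ => (1 : ℝ)) x) := by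
    refine hInt.bdd_mul (c := sSup (range fun x => |w x|)) (by
      have := hw.continuous; fun_prop) (Eventually.of_forall fun x => ?_)
    have hb : BddAbove (range fun x => |w x|) := by
      obtain ⟨B, hB⟩ := hwc.exists_bound_of_continuous hw.continuous
      exact ⟨B, by rintro _ ⟨x, rfl⟩; exact hB x⟩
    exact le_csSup hb ⟨x + t • e, rfl⟩
  have i2 : Integrable (fun x => w x * U.indicator (fun _ => (1 : ℝ)) x) := by
    have := (hw.continuous.integrable_of_hasCompactSupport hwc (μ := volume)).indicator
      hU.measurableSet
    refine this.congr (Eventually.of_forall fun x => ?_)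
    by_cases hx : x ∈ U <;> simp [hx]
  have i3 : Integrable (fun x => w x * U.indicator (fun _ => (1 : ℝ)) (x - t • e)) := by
    have := i1.comp_sub_right (t • e)
    simpa using this
  have e1 : ∫ x, w (x + t • e) * U.indicator (fun _ => (1 : ℝ)) x =
      ∫ x, w x * U.indicator (fun _ => (1 : ℝ)) (x - t • e) := by
    rw [← integral_sub_right_eq_self _ (t • e)]
    simp
  -- On the support of w, moving backwards along e cannot leave U: σ drops by at least t (⟪N, e⟫ -
  -- θ‖e‖) ≥ 0.
  have key : ∫ x, w x * U.indicator (fun _ => (1 : ℝ)) x ≤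
      ∫ x, w x * U.indicator (fun _ => (1 : ℝ)) (x - t • e) := by
    refine integral_mono i2 i3 fun x => ?_
    by_cases hx : x ∈ U
    swap
    · simp only [hx, not_false_eq_true, indicator_of_notMem, mul_zero]
      exact mul_nonneg (hw0 x) (indicator_nonneg (fun _ _ => zero_le_one) _)
    by_cases hxs : x ∈ tsupport w
    swap
    · simp [image_eq_zero_of_notMem_tsupport hxs]
    have hb : x - t • e ∈ Metric.ball y R := by
      apply hδs
      rw [Metric.mem_thickening_iff]
      refine ⟨x, hxs, ?_⟩
      rw [dist_eq_norm, sub_sub_cancel_left, norm_neg, norm_smul, Real.norm_of_nonneg ht0.le]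
      exact ht
    have hmem : x - t • e ∈ U := by
      rw [h.mem_iff _ hb]
      have h1 := h.approx x (hws hxs) _ hb
      rw [sub_sub_cancel_left, inner_neg_right, norm_neg, inner_smul_right, norm_smul,
        Real.norm_of_nonneg ht0.le] at h1
      have h2 := (abs_le.1 h1).2
      have h3 := (h.mem_iff x (hws hxs)).1 hx
      nlinarith [mul_le_mul_of_nonneg_left he ht0.le]
    simp [hx, hmem]
  have e2 : ∫ x, t⁻¹ • (w (x + t • e) - w x) * U.indicator (fun _ => (1 : ℝ)) x =
      t⁻¹ * ((∫ x, w (x + t • e) * U.indicator (fun _ => (1 : ℝ)) x) -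
        ∫ x, w x * U.indicator (fun _ => (1 : ℝ)) x) := by
    rw [← integral_sub i1 i2, ← integral_const_mul]
    congr 1 with x
    simp only [smul_eq_mul]; ring
  rw [e2, e1]
  exact mul_nonneg (inv_pos.2 ht0).le (sub_nonneg.2 key)

end

/-! ### Slicing along the normal and the boundary as a graph -/

section

variable {n : ℕ}

/-- Orthogonal splitting preserves Lebesgue measure, and t ↦ t N is an isometry onto the line
because N is a unit vector; the rest is Fubini. -/
theorem integral_eq_integral_orthogonal (y : Rn n) {N : Rn n} (hN : ‖N‖ = 1) {F : Rn n → ℝ}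
    (hF : Integrable F) :
    ∫ x, F x = ∫ z : (ℝ ∙ N)ᗮ, ∫ t : ℝ, F (y + z + t • N) := by
  have h1 := (ℝ ∙ N).measurePreserving_measurableEquivProd y
  rw [InnerProductSpace.euclideanHausdorffMeasure_eq_volume] at h1
  have h2 := (LinearIsometryEquiv.toSpanUnitSingleton (𝕜 := ℝ) N hN).measurePreserving
  have hΦ : (fun p : ℝ × (ℝ ∙ N)ᗮ => y + (p.2 : Rn n) + p.1 • N) =
      ((ℝ ∙ N).measurableEquivProd y).symm ∘
        Prod.map (LinearIsometryEquiv.toSpanUnitSingleton (𝕜 := ℝ) N hN) id := by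
    funext p
    rw [Function.comp_apply, Submodule.measurableEquivProd_symm_apply]
    simp only [Prod.map_fst, Prod.map_snd, id, vadd_eq_add,
      LinearIsometryEquiv.toSpanUnitSingleton_apply]
    abel
  have h3 : MeasurePreserving (fun p : ℝ × (ℝ ∙ N)ᗮ => y + (p.2 : Rn n) + p.1 • N)
      volume volume := by
    rw [hΦ]
    exact h1.symm.comp (h2.prod (MeasurePreserving.id (volume : Measure (ℝ ∙ N)ᗮ)))
  have h5 : MeasurableEmbedding (fun p : ℝ × (ℝ ∙ N)ᗮ => y + (p.2 : Rn n) + p.1 • N) := by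
    rw [hΦ]
    exact ((ℝ ∙ N).measurableEquivProd y).symm.measurableEmbedding.comp
      ((LinearIsometryEquiv.toSpanUnitSingleton (𝕜 := ℝ) N
        hN).toHomeomorph.toMeasurableEquiv.prodCongr
          (MeasurableEquiv.refl (ℝ ∙ N)ᗮ)).measurableEmbedding
  rw [← h3.integral_comp h5]
  have hi : Integrable (fun p : ℝ × (ℝ ∙ N)ᗮ => F (y + (p.2 : Rn n) + p.1 • N)) volume :=
    (h3.integrable_comp_emb h5).2 hF
  rw [Measure.volume_eq_prod] at hi ⊢
  rw [integral_prod_symm _ hi]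

end

section

variable {n : ℕ}

/-- The function with values `τ` on a ball of the hyperplane `Nᗮ` has the boundary of `U` near `y`
as its graph. -/
structure GraphChart (U : Set (Rn n)) (y N : Rn n) (θ r : ℝ) (τ : (ℝ ∙ N)ᗮ → ℝ) : Prop where
  pos : 0 < r
  mem_frontier : ∀ z : (ℝ ∙ N)ᗮ, ‖z‖ < r → y + z + τ z • N ∈ frontier U
  mem_iff : ∀ z : (ℝ ∙ N)ᗮ, ‖z‖ < r → ∀ t : ℝ, |t| ≤ r → (y + z + t • N ∈ U ↔ t < τ z)
  eq_of_mem_frontier : ∀ z : (ℝ ∙ N)ᗮ, ‖z‖ < r → ∀ t : ℝ, |t| ≤ r →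
    y + z + t • N ∈ frontier U → t = τ z
  lipschitz : ∀ z z' : (ℝ ∙ N)ᗮ, ‖z‖ < r → ‖z'‖ < r →
    dist (y + (z : Rn n) + τ z • N) (y + z' + τ z' • N) ≤ (1 - θ)⁻¹ * dist z z'

theorem inner_orthogonal_span_singleton {N : Rn n} (z : (ℝ ∙ N)ᗮ) : ⟪N, (z : Rn n)⟫ = 0 :=
  Submodule.mem_orthogonal_singleton_iff_inner_right.1 z.2

theorem FlatChart.continuousAt {U : Set (Rn n)} {y N : Rn n} {θ R : ℝ} {σ : Rn n → ℝ}
    (h : FlatChart U y N θ R σ) {x : Rn n} (hx : x ∈ Metric.ball y R) : ContinuousAt σ x := by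
  have h0 : Tendsto (fun x' => ⟪N, x' - x⟫ + θ * ‖x' - x‖) (𝓝 x) (𝓝 0) := by
    have : Continuous fun x' => ⟪N, x' - x⟫ + θ * ‖x' - x‖ := by fun_prop
    simpa using this.tendsto x
  have h1 : Tendsto (fun x' => ⟪N, x' - x⟫ - θ * ‖x' - x‖) (𝓝 x) (𝓝 0) := by
    have : Continuous fun x' => ⟪N, x' - x⟫ - θ * ‖x' - x‖ := by fun_prop
    simpa using this.tendsto x
  have h2 : Tendsto (fun x' => σ x' - σ x) (𝓝 x) (𝓝 0) := by
    refine tendsto_of_tendsto_of_tendsto_of_le_of_le' h1 h0 ?_ ?_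
    · filter_upwards [Metric.isOpen_ball.mem_nhds hx] with x' hx'
      linarith [(abs_le.1 (h.approx x hx x' hx')).1]
    · filter_upwards [Metric.isOpen_ball.mem_nhds hx] with x' hx'
      linarith [(abs_le.1 (h.approx x hx x' hx')).2]
  rw [ContinuousAt, ← tendsto_sub_nhds_zero_iff]
  exact h2

/-- On each line parallel to N, σ increases with slope at least 1 - θ, so it has at most one zero;
the zero exists by the intermediate value theorem and is the height of the graph. For two graph
points P, P' over z, z' one has |τ z - τ z'| ≤ θ ‖P - P'‖ since σ vanishes at both, hence (1 - θ) ‖P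
- P'‖ ≤ ‖z - z'‖. -/
theorem FlatChart.exists_graphChart {U : Set (Rn n)} {y N : Rn n} {θ R : ℝ} {σ : Rn n → ℝ}
    (h : FlatChart U y N θ R σ) (hU : IsOpen U) (hN : ‖N‖ = 1) (hθ0 : 0 ≤ θ) (hθ : θ ≤ 1 / 3) :
    ∃ τ, GraphChart U y N θ (R / 4) τ := by
  have hR := h.pos
  have hNN : ⟪N, N⟫ = 1 := by rw [real_inner_self_eq_norm_sq, hN, one_pow]
  have hball : ∀ z : (ℝ ∙ N)ᗮ, ‖z‖ < R / 4 → ∀ t : ℝ, |t| ≤ R / 2 →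
      y + z + t • N ∈ Metric.ball y R := by
    intro z hz t ht
    rw [mem_ball_iff_norm, add_assoc, add_sub_cancel_left]
    calc ‖(z : Rn n) + t • N‖ ≤ ‖(z : Rn n)‖ + ‖t • N‖ := norm_add_le _ _
      _ = ‖z‖ + |t| := by rw [norm_smul, hN, mul_one, Real.norm_eq_abs, Submodule.coe_norm]
      _ < R := by linarith
  have hmono : ∀ z : (ℝ ∙ N)ᗮ, ‖z‖ < R / 4 → ∀ t t' : ℝ, |t| ≤ R / 2 → |t'| ≤ R / 2 → t < t' →
      σ (y + z + t • N) < σ (y + z + t' • N) := by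
    intro z hz t t' ht ht' htt
    have h1 := (abs_le.1 (h.approx _ (hball z hz t ht) _ (hball z hz t' ht'))).1
    have e : y + (z : Rn n) + t' • N - (y + z + t • N) = (t' - t) • N := by
      rw [sub_smul]; abel
    rw [e, inner_smul_right, hNN, norm_smul, hN, Real.norm_of_nonneg (by linarith)] at h1
    nlinarith
  have hex : ∀ z : (ℝ ∙ N)ᗮ, ∃ t : ℝ, ‖z‖ < R / 4 → |t| < R / 2 ∧ σ (y + z + t • N) = 0 := by
    intro z
    by_cases hz : ‖z‖ < R / 4
    swap
    · exact ⟨0, fun h => absurd h hz⟩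
    have hval : ∀ t : ℝ, |t| ≤ R / 2 → |σ (y + z + t • N) - t| ≤ θ * (R / 4 + |t|) := by
      intro t ht
      have h1 := h.approx y (Metric.mem_ball_self hR) _ (hball z hz t ht)
      rw [h.base, sub_zero, add_assoc, add_sub_cancel_left, inner_add_right,
        inner_orthogonal_span_singleton, inner_smul_right, hNN, mul_one, zero_add] at h1
      rw [add_assoc]
      refine h1.trans (mul_le_mul_of_nonneg_left ?_ hθ0)
      calc ‖(z : Rn n) + t • N‖ ≤ ‖(z : Rn n)‖ + ‖t • N‖ := norm_add_le _ _
        _ = ‖z‖ + |t| := by rw [norm_smul, hN, mul_one, Real.norm_eq_abs, Submodule.coe_norm]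
        _ ≤ R / 4 + |t| := by linarith
    have ha : |R / 2| ≤ R / 2 := (abs_of_pos (by linarith)).le
    have ha' : |(-(R / 2))| ≤ R / 2 := by rw [abs_neg]; exact ha
    -- At height R/2 the error is at most θ (R/4 + R/2) ≤ R/4, because θ ≤ 1/3, so the sign is that
    -- of the height.
    have hp : 0 < σ (y + z + (R / 2) • N) := by
      have := (abs_le.1 (hval (R / 2) ha)).1
      rw [abs_of_pos (by linarith : 0 < R / 2)] at this
      nlinarith
    have hm : σ (y + z + (-(R / 2)) • N) < 0 := by
      have := (abs_le.1 (hval (-(R / 2)) ha')).2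
      rw [abs_neg, abs_of_pos (by linarith : 0 < R / 2)] at this
      nlinarith
    have hcont : ContinuousOn (fun t : ℝ => σ (y + z + t • N)) (Icc (-(R / 2)) (R / 2)) := by
      intro t ht
      have hc : ContinuousAt (fun t : ℝ => y + (z : Rn n) + t • N) t := by fun_prop
      exact (ContinuousAt.comp (f := fun t : ℝ => y + (z : Rn n) + t • N)
        (h.continuousAt (hball z hz t (abs_le.2 ht))) hc).continuousWithinAt
    obtain ⟨t, ht, ht0⟩ := intermediate_value_Ioo (by linarith) hcont ⟨hm, hp⟩
    exact ⟨t, fun _ => ⟨abs_lt.2 ht, ht0⟩⟩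
  choose τ hτ using hex
  have hmem : ∀ z : (ℝ ∙ N)ᗮ, ‖z‖ < R / 4 → ∀ t : ℝ, |t| ≤ R / 2 →
      (y + z + t • N ∈ U ↔ t < τ z) := by
    intro z hz t ht
    obtain ⟨h1, h2⟩ := hτ z hz
    rw [h.mem_iff _ (hball z hz t ht)]
    constructor
    · intro h3
      by_contra! h4
      rcases h4.eq_or_lt with h4 | h4
      · rw [← h4, h2] at h3; exact lt_irrefl _ h3
      · have := hmono z hz _ _ h1.le ht h4
        linarith
    · intro h3
      have := hmono z hz _ _ ht h1.le h3
      linarith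
  refine ⟨τ, by linarith, ?_, ?_, ?_, ?_⟩
  · intro z hz
    obtain ⟨h1, h2⟩ := hτ z hz
    rw [hU.frontier_eq]
    refine ⟨?_, fun h3 => ?_⟩
    · have hc : Tendsto (fun t : ℝ => y + (z : Rn n) + t • N) (𝓝[<] (τ z))
          (𝓝 (y + z + τ z • N)) :=
        (Continuous.tendsto (by fun_prop) _).mono_left nhdsWithin_le_nhds
      refine mem_closure_of_tendsto hc ?_
      have : ∀ᶠ t in 𝓝[<] (τ z), -(R / 2) < t :=
        nhdsWithin_le_nhds (lt_mem_nhds (abs_lt.1 h1).1)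
      filter_upwards [this, self_mem_nhdsWithin] with t ht ht'
      have ht' : t < τ z := ht'
      exact (hmem z hz t (abs_le.2 ⟨ht.le, by linarith [(abs_lt.1 h1).2]⟩)).2 ht'
    · exact lt_irrefl _ ((hmem z hz _ h1.le).1 h3)
  · intro z hz t ht
    exact hmem z hz t (by linarith)
  · intro z hz t ht hfr
    have hb := hball z hz t (by linarith)
    have h0 := eq_zero_of_mem_frontier (Metric.isOpen_ball.mem_nhds hb) (h.continuousAt hb)
      h.mem_iff hfr
    obtain ⟨h1, h2⟩ := hτ z hz
    rcases lt_trichotomy t (τ z) with h3 | h3 | h3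
    · linarith [hmono z hz _ _ (by linarith) h1.le h3]
    · exact h3
    · linarith [hmono z hz _ _ h1.le (by linarith) h3]
  · intro z z' hz hz'
    obtain ⟨h1, h2⟩ := hτ z hz
    obtain ⟨h1', h2'⟩ := hτ z' hz'
    have h3 := h.approx _ (hball z' hz' _ h1'.le) _ (hball z hz _ h1.le)
    have e : y + (z : Rn n) + τ z • N - (y + z' + τ z' • N) =
        ((z - z' : (ℝ ∙ N)ᗮ) : Rn n) + (τ z - τ z') • N := by
      rw [sub_smul, Submodule.coe_sub]; abel
    rw [h2, h2', sub_self, zero_sub, abs_neg] at h3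
    have e2 : ⟪N, y + (z : Rn n) + τ z • N - (y + z' + τ z' • N)⟫ = τ z - τ z' := by
      rw [e, inner_add_right, inner_orthogonal_span_singleton, inner_smul_right, hNN, zero_add,
        mul_one]
    rw [e2] at h3
    have h4 : ‖y + (z : Rn n) + τ z • N - (y + z' + τ z' • N)‖ ≤ ‖z - z'‖ + |τ z - τ z'| := by
      rw [e]
      refine (norm_add_le _ _).trans ?_
      rw [norm_smul, hN, mul_one, Real.norm_eq_abs, Submodule.coe_norm]
    rw [dist_eq_norm, dist_eq_norm, inv_mul_eq_div, le_div_iff₀ (by linarith)]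
    linarith

/-- Integrating the normal derivative over `U` gives the integral over the graph. -/
theorem GraphChart.setIntegral_fderiv_eq {U : Set (Rn n)} {y N : Rn n} {θ r : ℝ}
    {τ : (ℝ ∙ N)ᗮ → ℝ} (h : GraphChart U y N θ r τ) (hU : IsOpen U) (hN : ‖N‖ = 1)
    {w : Rn n → ℝ} (hw : ContDiff ℝ 1 w) (hwc : HasCompactSupport w)
    (hws : tsupport w ⊆ Metric.ball y r) :
    ∫ x in U, fderiv ℝ w x N = ∫ z in Metric.ball (0 : (ℝ ∙ N)ᗮ) r, w (y + z + τ z • N) := by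
  have hNN : ⟪N, N⟫ = 1 := by rw [real_inner_self_eq_norm_sq, hN, one_pow]
  have hdc : Continuous fun x => fderiv ℝ w x N :=
    (hw.continuous_fderiv one_ne_zero).clm_apply continuous_const
  have hInt : Integrable (U.indicator fun x => fderiv ℝ w x N) (volume : Measure (Rn n)) :=
    (hdc.integrable_of_hasCompactSupport (hwc.fderiv_apply (𝕜 := ℝ) N)).indicator
      hU.measurableSet
  have hnorm : ∀ (z : (ℝ ∙ N)ᗮ) (t : ℝ), ‖(z : Rn n) + t • N‖ ^ 2 = ‖z‖ ^ 2 + t ^ 2 := by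
    intro z t
    rw [norm_add_sq_real, inner_smul_right, real_inner_comm, inner_orthogonal_span_singleton,
      norm_smul, hN, Submodule.coe_norm, Real.norm_eq_abs, mul_one, sq_abs]
    ring
  have hout : ∀ (z : (ℝ ∙ N)ᗮ) (t : ℝ), r ≤ ‖z‖ ∨ r ≤ |t| → y + z + t • N ∉ tsupport w := by
    intro z t hzt hmem
    have h1 := hws hmem
    rw [mem_ball_iff_norm, add_assoc, add_sub_cancel_left] at h1
    have h2 := hnorm z t
    have h3 : ‖(z : Rn n) + t • N‖ ^ 2 < r ^ 2 := by gcongr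
    have := h.pos
    rcases hzt with h4 | h4
    · nlinarith [sq_nonneg t]
    · nlinarith [sq_nonneg ‖z‖, sq_abs t]
  have hdw : ∀ (z : (ℝ ∙ N)ᗮ) (t : ℝ),
      HasDerivAt (fun t : ℝ => w (y + z + t • N)) (fderiv ℝ w (y + z + t • N) N) t := by
    intro z t
    have h1 : HasDerivAt (fun t : ℝ => y + (z : Rn n) + t • N) N t := by
      simpa using ((hasDerivAt_id t).smul_const N).const_add (y + (z : Rn n))
    exact ((hw.differentiable one_ne_zero _).hasFDerivAt.comp_hasDerivAt t h1)
  have hzero : ∀ (z : (ℝ ∙ N)ᗮ) (t : ℝ), r ≤ ‖z‖ ∨ r ≤ |t| →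
      fderiv ℝ w (y + z + t • N) N = 0 := by
    intro z t hzt
    have : fderiv ℝ w (y + z + t • N) = 0 :=
      image_eq_zero_of_notMem_tsupport fun hmem =>
        hout z t hzt (tsupport_fderiv_subset ℝ hmem)
    simp [this]
  rw [← integral_indicator hU.measurableSet, integral_eq_integral_orthogonal y hN hInt,
    ← integral_indicator Metric.isOpen_ball.measurableSet]
  congr 1 with z
  by_cases hz : ‖z‖ < r
  swap
  · rw [indicator_of_notMem (by simpa using hz)]
    refine integral_eq_zero_of_ae (Eventually.of_forall fun t => ?_)
    simp only [indicator, hzero z t (Or.inl (not_lt.1 hz)), ite_self, Pi.zero_apply]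
  rw [indicator_of_mem (by simpa using hz)]
  -- The chart describes U on the line only for |t| ≤ r, but the derivative vanishes beyond that, so
  -- U may be replaced by the half-line below τ z. The fundamental theorem of calculus then leaves
  -- the value at τ z, the value at -∞ being 0.
  have e1 : (fun t : ℝ => U.indicator (fun x => fderiv ℝ w x N) (y + z + t • N)) =
      (Iio (τ z)).indicator fun t => fderiv ℝ w (y + z + t • N) N := by
    funext t
    by_cases ht : |t| ≤ r
    · have := h.mem_iff z hz t ht
      by_cases h1 : t < τ z
      · rw [indicator_of_mem (this.2 h1), indicator_of_mem (show t ∈ Iio (τ z) from h1)]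
      · rw [indicator_of_notMem (mt this.1 h1),
          indicator_of_notMem (show t ∉ Iio (τ z) from h1)]
    · simp only [indicator, hzero z t (Or.inr (not_le.1 ht).le), ite_self]
  rw [e1, integral_indicator measurableSet_Iio]
  have hcl : Continuous fun t : ℝ => y + (z : Rn n) + t • N := by fun_prop
  have hcs : HasCompactSupport fun t : ℝ => fderiv ℝ w (y + z + t • N) N := by
    refine HasCompactSupport.intro (isCompact_Icc (a := -r) (b := r)) fun t ht => ?_
    refine hzero z t (Or.inr ?_)
    by_contra! h1
    exact ht (abs_le.1 h1.le)
  have hdi : Integrable (fun t : ℝ => fderiv ℝ w (y + z + t • N) N) :=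
    (hdc.comp hcl).integrable_of_hasCompactSupport hcs
  have hlim : Tendsto (fun t : ℝ => w (y + z + t • N)) atBot (𝓝 0) := by
    refine tendsto_const_nhds.congr' ?_
    filter_upwards [eventually_le_atBot (-r)] with t ht
    refine (image_eq_zero_of_notMem_tsupport (hout z t (Or.inr ?_))).symm
    rw [le_abs]; right; linarith
  rw [← integral_Iic_eq_integral_Iio, integral_Iic_of_hasDerivAt_of_tendsto
    (hdw z (τ z)).continuousAt.continuousWithinAt (fun t _ => hdw z t) hdi.integrableOn hlim,
    sub_zero]

end

/-! ### Hausdorff measure of the boundary -/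

section

variable {n : ℕ}

theorem euclideanHausdorffMeasure_image_le {X Y : Type*} [EMetricSpace X] [MeasurableSpace X]
    [BorelSpace X] [EMetricSpace Y] [MeasurableSpace Y] [BorelSpace Y] {K : NNReal} {f : X → Y}
    {s : Set X} (h : LipschitzOnWith K f s) (d : ℕ) :
    Measure.euclideanHausdorffMeasure d (f '' s) ≤
      (K : ENNReal) ^ d * Measure.euclideanHausdorffMeasure d s := by
  have h1 := h.hausdorffMeasure_image_le (d := d) (Nat.cast_nonneg d)
  rw [ENNReal.rpow_natCast] at h1
  simp only [Measure.euclideanHausdorffMeasure_def, Measure.smul_apply, ENNReal.smul_def,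
    smul_eq_mul]
  rw [mul_left_comm]
  gcongr

/-- Nᗮ has dimension exactly n - 1, and the normalised Hausdorff measure of full dimension is
Lebesgue measure. -/
theorem euclideanHausdorffMeasure_orthogonal_eq_volume {N : Rn n} (hN : ‖N‖ = 1) :
    (Measure.euclideanHausdorffMeasure (n - 1) : Measure (ℝ ∙ N)ᗮ) = volume := by
  have h0 : N ≠ 0 := by rintro rfl; simp at hN
  have h1 := (ℝ ∙ N).finrank_add_finrank_orthogonal
  rw [finrank_span_singleton h0, finrank_euclideanSpace_fin] at h1
  rw [← InnerProductSpace.euclideanHausdorffMeasure_eq_volume]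
  congr 1
  omega

section GraphChart

variable {U : Set (Rn n)} {y N : Rn n} {θ r : ℝ} {τ : (ℝ ∙ N)ᗮ → ℝ}

theorem GraphChart.lipschitzOnWith (h : GraphChart U y N θ r τ) (hθ : θ < 1) :
    LipschitzOnWith (1 - θ)⁻¹.toNNReal (fun z : (ℝ ∙ N)ᗮ => y + (z : Rn n) + τ z • N)
      (Metric.ball 0 r) := by
  refine LipschitzOnWith.of_dist_le_mul fun z hz z' hz' => ?_
  rw [Real.coe_toNNReal _ (inv_nonneg.2 (by linarith))]
  exact h.lipschitz z z' (by simpa using hz) (by simpa using hz')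

theorem GraphChart.aemeasurable (h : GraphChart U y N θ r τ) (hθ : θ < 1) :
    AEMeasurable (fun z : (ℝ ∙ N)ᗮ => y + (z : Rn n) + τ z • N)
      (volume.restrict (Metric.ball 0 r)) :=
  (h.lipschitzOnWith hθ).continuousOn.aemeasurable Metric.isOpen_ball.measurableSet

/-- Orthogonal projection to Nᗮ recovers z from its graph point and is 1-Lipschitz, so it cannot
increase Hausdorff measure: the flat measure is at most the surface measure. -/
theorem GraphChart.map_le (h : GraphChart U y N θ r τ) (hN : ‖N‖ = 1) (hθ : θ < 1) :
    (volume.restrict (Metric.ball 0 r)).map (fun z : (ℝ ∙ N)ᗮ => y + (z : Rn n) + τ z • N) ≤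
      surfaceMeasure U := by
  refine Measure.le_iff.2 fun B hB => ?_
  rw [Measure.map_apply_of_aemeasurable (h.aemeasurable hθ) hB,
    Measure.restrict_apply' Metric.isOpen_ball.measurableSet, surfaceMeasure,
    Measure.restrict_apply hB, ← euclideanHausdorffMeasure_orthogonal_eq_volume hN]
  set π : Rn n → (ℝ ∙ N)ᗮ := fun x => (ℝ ∙ N)ᗮ.orthogonalProjectionOnto (x - y) with hπ
  have hlip : LipschitzWith 1 π := by
    refine LipschitzWith.of_dist_le_mul fun x x' => ?_
    rw [NNReal.coe_one, one_mul, dist_eq_norm, dist_eq_norm, hπ]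
    simp only
    rw [← map_sub, sub_sub_sub_cancel_right]
    exact Submodule.norm_orthogonalProjectionOnto_apply_le _ _
  have hsub : (fun z : (ℝ ∙ N)ᗮ => y + (z : Rn n) + τ z • N) ⁻¹' B ∩ Metric.ball 0 r ⊆
      π '' (B ∩ frontier U) := by
    rintro z ⟨hzB, hz⟩
    refine ⟨_, ⟨hzB, h.mem_frontier z (by simpa using hz)⟩, ?_⟩
    rw [hπ]
    simp only
    rw [add_assoc, add_sub_cancel_left, map_add,
      Submodule.orthogonalProjectionOnto_mem_subspace_eq_self,
      Submodule.orthogonalProjectionOnto_apply_of_mem_orthogonal, add_zero]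
    rw [Submodule.orthogonal_orthogonal]
    exact Submodule.smul_mem _ _ (Submodule.mem_span_singleton_self N)
  refine (measure_mono hsub).trans ?_
  simpa using euclideanHausdorffMeasure_image_le (hlip.lipschitzOnWith (s := B ∩ frontier U))
    (n - 1)

/-- The opposite comparison: every boundary point in the ball lies on the graph, and the graph map
has Lipschitz constant (1 - θ)⁻¹, which costs its (n - 1)-th power. -/
theorem GraphChart.le_map (h : GraphChart U y N θ r τ) (hN : ‖N‖ = 1) (hθ : θ < 1) :
    (surfaceMeasure U).restrict (Metric.ball y r) ≤
      ((1 - θ)⁻¹.toNNReal : ENNReal) ^ (n - 1) •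
        (volume.restrict (Metric.ball 0 r)).map
          (fun z : (ℝ ∙ N)ᗮ => y + (z : Rn n) + τ z • N) := by
  refine Measure.le_iff.2 fun B hB => ?_
  rw [Measure.smul_apply, Measure.map_apply_of_aemeasurable (h.aemeasurable hθ) hB,
    Measure.restrict_apply' Metric.isOpen_ball.measurableSet,
    Measure.restrict_apply' Metric.isOpen_ball.measurableSet, surfaceMeasure,
    Measure.restrict_apply (hB.inter Metric.isOpen_ball.measurableSet),
    ← euclideanHausdorffMeasure_orthogonal_eq_volume hN]
  have hsub : B ∩ Metric.ball y r ∩ frontier U ⊆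
      (fun z : (ℝ ∙ N)ᗮ => y + (z : Rn n) + τ z • N) ''
        ((fun z : (ℝ ∙ N)ᗮ => y + (z : Rn n) + τ z • N) ⁻¹' B ∩ Metric.ball 0 r) := by
    -- A boundary point in the ball is split as y + z + t N; both parts have norm below r, so the
    -- chart forces t = τ z.
    rintro x ⟨⟨hxB, hxb⟩, hxf⟩
    set z := (ℝ ∙ N)ᗮ.orthogonalProjectionOnto (x - y) with hz
    set t := ⟪N, x - y⟫ with ht
    rw [mem_ball_iff_norm] at hxb
    have hzr : ‖z‖ < r :=
      (Submodule.norm_orthogonalProjectionOnto_apply_le _ _).trans_lt hxb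
    have htr : |t| ≤ r := by
      have := abs_real_inner_le_norm N (x - y)
      rw [hN, one_mul] at this
      linarith
    have hx : y + z + t • N = x := by
      have h1 := Submodule.starProjection_add_starProjection_orthogonal (K := ℝ ∙ N) (x - y)
      rw [Submodule.starProjection_unit_singleton ℝ hN] at h1
      have h2 : (z : Rn n) = (ℝ ∙ N)ᗮ.starProjection (x - y) := rfl
      rw [h2, add_assoc, add_comm ((ℝ ∙ N)ᗮ.starProjection (x - y)), ht, h1]
      abel
    have hteq := h.eq_of_mem_frontier z hzr t htr (by rwa [hx])
    have hx' : y + (z : Rn n) + τ z • N = x := by rw [← hteq, hx]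
    refine ⟨z, ⟨?_, by simpa using hzr⟩, hx'⟩
    rw [mem_preimage, hx']
    exact hxB
  exact (measure_mono hsub).trans (euclideanHausdorffMeasure_image_le
    ((h.lipschitzOnWith hθ).mono inter_subset_right) (n - 1))

theorem GraphChart.surfaceMeasure_ball_lt_top (h : GraphChart U y N θ r τ) (hN : ‖N‖ = 1)
    (hθ : θ < 1) : surfaceMeasure U (Metric.ball y r) < ⊤ := by
  have h1 := h.le_map hN hθ univ
  rw [Measure.restrict_apply_univ, Measure.smul_apply,
    Measure.map_apply_of_aemeasurable (h.aemeasurable hθ) MeasurableSet.univ, preimage_univ,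
    Measure.restrict_apply_univ] at h1
  refine h1.trans_lt (ENNReal.mul_lt_top ?_ Metric.isBounded_ball.measure_lt_top)
  exact ENNReal.pow_lt_top ENNReal.coe_lt_top

/-- The integral of the normal derivative over `U` nearly equals the surface integral. -/
theorem GraphChart.surface_bounds [IsFiniteMeasure (surfaceMeasure U)]
    (h : GraphChart U y N θ r τ) (hU : IsOpen U) (hN : ‖N‖ = 1) (hθ : θ < 1)
    {w : Rn n → ℝ} (hw : ContDiff ℝ 1 w) (hwc : HasCompactSupport w)
    (hws : tsupport w ⊆ Metric.ball y r) (hw0 : ∀ x, 0 ≤ w x) :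
    ∫ x in U, fderiv ℝ w x N ≤ ∫ x, w x ∂(surfaceMeasure U) ∧
    ∫ x, w x ∂(surfaceMeasure U) ≤ (1 - θ)⁻¹ ^ (n - 1) * ∫ x in U, fderiv ℝ w x N := by
  set ν := (volume.restrict (Metric.ball 0 r)).map
    (fun z : (ℝ ∙ N)ᗮ => y + (z : Rn n) + τ z • N) with hν
  have e1 : ∫ x in U, fderiv ℝ w x N = ∫ x, w x ∂ν := by
    rw [h.setIntegral_fderiv_eq hU hN hw hwc hws, hν, integral_map (h.aemeasurable hθ)]
    exact hw.continuous.aestronglyMeasurable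
  have hi : Integrable w (surfaceMeasure U) := hw.continuous.integrable_of_hasCompactSupport hwc
  have hle := h.map_le hN hθ
  have hiν : Integrable w ν := hi.mono_measure hle
  rw [e1]
  constructor
  · exact integral_mono_measure hle (Eventually.of_forall hw0) hi
  · have e2 : ∫ x, w x ∂(surfaceMeasure U) =
        ∫ x, w x ∂((surfaceMeasure U).restrict (Metric.ball y r)) := by
      rw [setIntegral_eq_integral_of_forall_compl_eq_zero]
      exact fun x hx => image_eq_zero_of_notMem_tsupport fun h => hx (hws h)
    rw [e2]
    have hc : ((1 - θ)⁻¹.toNNReal : ENNReal) ^ (n - 1) ≠ ⊤ := ENNReal.pow_ne_top ENNReal.coe_ne_top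
    refine (integral_mono_measure (h.le_map hN hθ) (Eventually.of_forall hw0)
      (hiν.smul_measure hc)).trans ?_
    rw [integral_smul_measure, ENNReal.toReal_pow, ENNReal.coe_toReal,
      Real.coe_toNNReal _ (inv_nonneg.2 (by linarith)), smul_eq_mul]

end GraphChart

theorem isFiniteMeasure_surfaceMeasure {U : Set (Rn n)} (hU : IsOpen U)
    (hUb : Bornology.IsBounded U) (hnormal : ∀ y ∈ frontier U, ∃ N, IsNormal U y N) :
    IsFiniteMeasure (surfaceMeasure U) := by
  have hK : IsCompact (frontier U) :=
    Metric.isCompact_of_isClosed_isBounded isClosed_frontier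
      (hUb.closure.subset frontier_subset_closure)
  constructor
  have h1 : surfaceMeasure U univ = surfaceMeasure U (frontier U) := by
    rw [surfaceMeasure, Measure.restrict_apply_univ, Measure.restrict_apply_self]
  rw [h1]
  refine hK.measure_lt_top_of_nhdsWithin fun y hy => ?_
  obtain ⟨N, hN⟩ := hnormal y hy
  obtain ⟨R, σ, hf⟩ := hN.2 (1 / 3) (by norm_num)
  obtain ⟨τ, hτ⟩ := hf.exists_graphChart hU hN.1 (by norm_num) le_rfl
  exact ⟨Metric.ball y (R / 4), mem_nhdsWithin_of_mem_nhds (Metric.ball_mem_nhds y hτ.pos),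
    hτ.surfaceMeasure_ball_lt_top hN.1 (by norm_num)⟩

/-- Finite (n - 1)-dimensional measure forces n-dimensional measure zero. Here n ≥ 1 is essential,
since n - 1 is a truncated subtraction. -/
theorem volume_frontier_eq_zero (hn : 1 ≤ n) {U : Set (Rn n)}
    [IsFiniteMeasure (surfaceMeasure U)] : volume (frontier U) = 0 := by
  have h1 := Measure.euclideanHausdorffMeasure_zero_or_top (show n - 1 < n by omega) (frontier U)
  rw [EuclideanSpace.euclideanHausdorffMeasure_eq_volume] at h1
  refine h1.resolve_right ?_
  have := measure_ne_top (surfaceMeasure U) univ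
  rwa [surfaceMeasure, Measure.restrict_apply_univ] at this

end

/-! ### Partition of unity and the extended normal field -/

section

open scoped Manifold

variable {n : ℕ}

theorem exists_finite_partition {K : Set (Rn n)} (hK : IsCompact K) (B : K → Set (Rn n))
    (hB : ∀ y, IsOpen (B y)) (hyB : ∀ y : K, (y : Rn n) ∈ B y) :
    ∃ (t : Finset K) (χ : t → Rn n → ℝ), (∀ k, ContDiff ℝ ∞ (χ k)) ∧
      (∀ k, tsupport (χ k) ⊆ B k) ∧ (∀ k x, 0 ≤ χ k x) ∧ ∀ x ∈ K, ∑ k, χ k x = 1 := by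
  obtain ⟨t, ht⟩ := hK.elim_finite_subcover B hB fun y hy => mem_iUnion.2 ⟨⟨y, hy⟩, hyB ⟨y, hy⟩⟩
  obtain ⟨f, hf⟩ := SmoothPartitionOfUnity.exists_isSubordinate 𝓘(ℝ, Rn n) hK.isClosed
    (fun k : t => B k) (fun k => hB k) (by
      intro x hx
      obtain ⟨i, hi, hxi⟩ := mem_iUnion₂.1 (ht hx)
      exact mem_iUnion.2 ⟨⟨i, hi⟩, hxi⟩)
  refine ⟨t, fun k => f k, fun k => (f k).contMDiff.contDiff, hf, fun k x => f.nonneg k x,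
    fun x hx => ?_⟩
  rw [← f.sum_eq_one hx, finsum_eq_sum_of_fintype]

theorem contDiff_smul_of_tsupport_subset {F : Type*} [NormedAddCommGroup F] [NormedSpace ℝ F]
    {V : Set (Rn n)} (hV : IsOpen V) {χ : Rn n → ℝ} {f : Rn n → F} (hχ : ContDiff ℝ 1 χ)
    (hs : tsupport χ ⊆ V) (hf : ContDiffOn ℝ 1 f V) : ContDiff ℝ 1 fun x => χ x • f x := by
  rw [contDiff_iff_contDiffAt]
  intro x
  by_cases hx : x ∈ tsupport χ
  · exact hχ.contDiffAt.smul ((hf x (hs hx)).contDiffAt (hV.mem_nhds (hs hx)))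
  · have : (fun x => χ x • f x) =ᶠ[𝓝 x] fun _ => 0 := by
      filter_upwards [(isClosed_tsupport χ).isOpen_compl.mem_nhds hx] with z hz
      rw [image_eq_zero_of_notMem_tsupport hz, zero_smul]
    exact contDiffAt_const.congr_of_eventuallyEq this

/-- A set with `C³` boundary has an inward unit normal that extends to a compactly supported
`C¹` vector field. -/
theorem exists_normal_field {U W : Set (Rn n)} (hUb : Bornology.IsBounded U)
    (hC3 : HasC3Boundary U) (hW : IsOpen W) (hWb : Bornology.IsBounded W)
    (hUW : frontier U ⊆ W) :
    ∃ X : Rn n → Rn n, ContDiff ℝ 1 X ∧ HasCompactSupport X ∧ tsupport X ⊆ W ∧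
      ∀ y ∈ frontier U, IsNormal U y (-X y) := by
  have hK : IsCompact (frontier U) :=
    Metric.isCompact_of_isClosed_isBounded isClosed_frontier
      (hUb.closure.subset frontier_subset_closure)
  have hC : ∀ y : frontier U, ∃ (V : Set (Rn n)) (ρ : Rn n → ℝ), IsOpen V ∧ (y : Rn n) ∈ V ∧
      V ⊆ W ∧ ContDiffOn ℝ 2 (gradient ρ) V ∧ ContDiffOn ℝ 1 ρ V ∧ (∀ x ∈ V, fderiv ℝ ρ x ≠ 0) ∧
      ∀ x ∈ V, (x ∈ U ↔ ρ x < 0) := by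
    rintro ⟨y, hy⟩
    obtain ⟨V, ρ, hV, hyV, hρ, hρ', hUV⟩ := hC3 y hy
    have hd : ContDiffOn ℝ 2 (fderiv ℝ ρ) V := hρ.fderiv_of_isOpen hV (by norm_num)
    -- The chart is shrunk so that the gradient vanishes nowhere and can be normalised throughout.
    have hopen : IsOpen (V ∩ fderiv ℝ ρ ⁻¹' {0}ᶜ) :=
      hd.continuousOn.isOpen_inter_preimage hV isOpen_compl_singleton
    refine ⟨V ∩ fderiv ℝ ρ ⁻¹' {0}ᶜ ∩ W, ρ, hopen.inter hW, ⟨⟨hyV, hρ'⟩, hUW hy⟩,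
      inter_subset_right, ?_, ?_, fun x hx => hx.1.2, fun x hx => ?_⟩
    · have : ContDiffOn ℝ 2 (gradient ρ) V :=
        (InnerProductSpace.toDual ℝ (Rn n)).symm.contDiff.comp_contDiffOn hd
      exact this.mono fun x hx => hx.1.1
    · exact (hρ.of_le (by norm_num)).mono fun x hx => hx.1.1
    · have := Set.ext_iff.1 hUV x
      simp only [mem_inter_iff, hx.1.1, and_true, mem_ofPred_eq, true_and] at this
      exact this
  choose V ρ hV hyV hVW hgrad hρ hne hUV using hC
  obtain ⟨t, χ, hχ, hχs, hχ0, hχ1⟩ := exists_finite_partition hK V hV hyV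
  set Nrm : t → Rn n → Rn n := fun k x => ‖gradient (ρ k) x‖⁻¹ • gradient (ρ k) x with hNrm
  have hNd : ∀ k : t, ContDiffOn ℝ 1 (Nrm k) (V k) := by
    intro k
    have h1 : ContDiffOn ℝ 1 (gradient (ρ k)) (V k) := (hgrad k).of_le (by norm_num)
    have h2 : ∀ x ∈ V k, gradient (ρ k) x ≠ 0 := by
      intro x hx
      rw [gradient]
      simpa using hne k x hx
    exact ((h1.norm ℝ h2).inv fun x hx => norm_ne_zero_iff.2 (h2 x hx)).smul h1
  set Z : Set (Rn n) := ⋃ k : t, tsupport (χ k) with hZ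
  have hZW : Z ⊆ W := iUnion_subset fun k => (hχs k).trans (hVW k)
  have hZc : IsClosed Z := isClosed_iUnion_of_finite fun k => isClosed_tsupport _
  have hX0 : ∀ x, x ∉ Z → (-∑ k, χ k x • Nrm k x) = 0 := by
    intro x hx
    rw [neg_eq_zero]
    refine Finset.sum_eq_zero fun k _ => ?_
    have : x ∉ tsupport (χ k) := fun h => hx (mem_iUnion.2 ⟨k, h⟩)
    rw [image_eq_zero_of_notMem_tsupport this, zero_smul]
  have hts : tsupport (fun x => -∑ k, χ k x • Nrm k x) ⊆ Z := by
    refine closure_minimal (fun x hx => ?_) hZc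
    by_contra h
    exact hx (hX0 x h)
  refine ⟨fun x => -∑ k, χ k x • Nrm k x, ?_, ?_, hts.trans hZW, fun y hy => ?_⟩
  · refine (ContDiff.sum fun k _ => ?_).neg
    exact contDiff_smul_of_tsupport_subset (hV k) ((hχ k).of_le (by simp)) (hχs k) (hNd k)
  · exact Metric.isCompact_of_isClosed_isBounded (isClosed_tsupport _)
      (hWb.subset (hts.trans hZW))
  · have hnorm : ∀ k : t, y ∈ V k → IsNormal U y (Nrm k y) := fun k hk =>
      isNormal_of_chart (hV k) hk (hρ k) (hne k y hk) (hUV k) hy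
    obtain ⟨k₀, hk₀⟩ : ∃ k, χ k y ≠ 0 := by
      by_contra! h
      have := hχ1 y hy
      simp [h] at this
    have hmem : ∀ k, χ k y ≠ 0 → y ∈ V k := fun k hk => hχs k (subset_tsupport _ hk)
    -- On the boundary all local unit normals agree by uniqueness, so the partition average is again
    -- the unit normal; away from it the average need not have length 1.
    have hsum : ∑ k, χ k y • Nrm k y = Nrm k₀ y := by
      calc ∑ k, χ k y • Nrm k y = ∑ k, χ k y • Nrm k₀ y := by
            refine Finset.sum_congr rfl fun k _ => ?_
            by_cases hk : χ k y = 0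
            · simp [hk]
            · rw [(hnorm k (hmem k hk)).unique (hnorm k₀ (hmem k₀ hk₀))]
        _ = Nrm k₀ y := by rw [← Finset.sum_smul, hχ1 y hy, one_smul]
    simp only [neg_neg, hsum]
    exact hnorm k₀ (hmem k₀ hk₀)

/-- The divergence of a vector field. -/
def divergence (X : Rn n → Rn n) (x : Rn n) : ℝ :=
  ∑ i, fderiv ℝ (fun z => X z i) x (EuclideanSpace.single i 1)

/-! ### Control of all derivatives by the normal derivative -/

section DivergenceTheorem

variable {U : Set (Rn n)} {h w : Rn n → ℝ}

theorem integrableOn_fderiv_apply (hh : ContDiff ℝ 1 h) (hc : HasCompactSupport h) (e : Rn n) :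
    IntegrableOn (fun x => fderiv ℝ h x e) U :=
  (((hh.continuous_fderiv one_ne_zero).clm_apply continuous_const).integrable_of_hasCompactSupport
    (hc.fderiv_apply (𝕜 := ℝ) e)).integrableOn

theorem setIntegral_fderiv_sub (hh : ContDiff ℝ 1 h) (hc : HasCompactSupport h)
    (hw : ContDiff ℝ 1 w) (hwc : HasCompactSupport w) (e : Rn n) :
    ∫ x in U, fderiv ℝ (fun x => h x - w x) x e =
      (∫ x in U, fderiv ℝ h x e) - ∫ x in U, fderiv ℝ w x e := by
  rw [← integral_sub (integrableOn_fderiv_apply hh hc e) (integrableOn_fderiv_apply hw hwc e)]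
  congr 1 with x
  rw [fderiv_fun_sub (hh.differentiable one_ne_zero x) (hw.differentiable one_ne_zero x)]
  rfl

theorem setIntegral_fderiv_const_mul (hh : ContDiff ℝ 1 h) (c : ℝ) (e : Rn n) :
    ∫ x in U, fderiv ℝ (fun x => c * h x) x e = c * ∫ x in U, fderiv ℝ h x e := by
  rw [← integral_const_mul]
  congr 1 with x
  rw [fderiv_const_mul (hh.differentiable one_ne_zero x)]
  rfl

theorem setIntegral_fderiv_add_smul (hh : ContDiff ℝ 1 h) (hc : HasCompactSupport h)
    (e e' : Rn n) (c : ℝ) :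
    ∫ x in U, fderiv ℝ h x (e + c • e') =
      (∫ x in U, fderiv ℝ h x e) + c * ∫ x in U, fderiv ℝ h x e' := by
  rw [← integral_const_mul, ← integral_add (integrableOn_fderiv_apply hh hc e)
    ((integrableOn_fderiv_apply hh hc e').const_mul c)]
  congr 1 with x
  simp

theorem setIntegral_fderiv_eq_sum (hh : ContDiff ℝ 1 h) (hc : HasCompactSupport h) (e : Rn n) :
    ∫ x in U, fderiv ℝ h x e =
      ∑ i, e i * ∫ x in U, fderiv ℝ h x (EuclideanSpace.single i 1) := by
  simp_rw [← integral_const_mul]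
  rw [← integral_finsetSum _ fun i _ => (integrableOn_fderiv_apply hh hc _).const_mul _]
  congr 1 with x
  conv_lhs => rw [← (EuclideanSpace.basisFun (Fin n) ℝ).sum_repr e]
  simp

/-- For θ ≤ 1/3 both N + e/2 and N - e/2 lie in the cone of directions with nonnegative integral;
linearity in the direction then bounds the integral along e by twice the one along N. -/
theorem FlatChart.abs_setIntegral_fderiv_le {y N : Rn n} {θ R : ℝ} {σ : Rn n → ℝ}
    (hf : FlatChart U y N θ R σ) (hU : IsOpen U) (hUb : Bornology.IsBounded U) (hN : ‖N‖ = 1)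
    (hθ : θ ≤ 1 / 3) {e : Rn n} (he : ‖e‖ = 1) (hw : ContDiff ℝ 1 w)
    (hwc : HasCompactSupport w) (hws : tsupport w ⊆ Metric.ball y R) (hw0 : ∀ x, 0 ≤ w x) :
    |∫ x in U, fderiv ℝ w x e| ≤ 2 * ∫ x in U, fderiv ℝ w x N := by
  have key : ∀ c : ℝ, |c| = 1 / 2 → 0 ≤ ∫ x in U, fderiv ℝ w x (N + c • e) := by
    intro c hc
    refine hf.setIntegral_fderiv_nonneg hU hUb ?_ hw hwc hws hw0
    have h1 : ‖N + c • e‖ ≤ 3 / 2 := by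
      refine (norm_add_le _ _).trans ?_
      rw [norm_smul, Real.norm_eq_abs, hc, hN, he]
      norm_num
    have h2 : 1 / 2 ≤ ⟪N, N + c • e⟫ := by
      rw [inner_add_right, real_inner_self_eq_norm_sq, hN, inner_smul_right]
      have h3 : |c * ⟪N, e⟫| ≤ 1 / 2 := by
        rw [abs_mul, hc]
        have := abs_real_inner_le_norm N e
        rw [hN, he] at this
        linarith
      linarith [(abs_le.1 h3).1]
    -- The cone condition holds with equality in the worst case: θ ‖N + c e‖ ≤ (1/3)(3/2) = 1/2 ≤
    -- ⟪N, N + c e⟫.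
    nlinarith [norm_nonneg (N + c • e)]
  have h1 := key (1 / 2) (by norm_num)
  have h2 := key (-(1 / 2)) (by norm_num)
  rw [setIntegral_fderiv_add_smul hw hwc] at h1 h2
  rw [abs_le]
  constructor <;> linarith

/-- The previous bound needs nonnegative functions. Shifting a small factor Y by δ gives w (Y + δ) ≥
0 and w (δ - Y) ≥ 0, so only the size of Y matters, not its derivative. The constant is 4δ from w (Y
+ δ), whose normal integral is at most 2δ times that of w, plus 2δ from the subtracted δ w. -/
theorem FlatChart.abs_setIntegral_fderiv_mul_le {y N : Rn n} {θ R δ : ℝ} {σ Y : Rn n → ℝ}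
    (hf : FlatChart U y N θ R σ) (hU : IsOpen U) (hUb : Bornology.IsBounded U) (hN : ‖N‖ = 1)
    (hθ : θ ≤ 1 / 3) {e : Rn n} (he : ‖e‖ = 1) (hw : ContDiff ℝ 1 w)
    (hwc : HasCompactSupport w) (hws : tsupport w ⊆ Metric.ball y R) (hw0 : ∀ x, 0 ≤ w x)
    (hY : ContDiff ℝ 1 Y) (hδ : 0 ≤ δ) (hYδ : ∀ x ∈ Metric.ball y R, |Y x| ≤ δ) :
    |∫ x in U, fderiv ℝ (fun x => w x * Y x) x e| ≤ 6 * δ * ∫ x in U, fderiv ℝ w x N := by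
  have hts : ∀ f : Rn n → ℝ, tsupport (fun x => w x * f x) ⊆ Metric.ball y R := fun f =>
    (tsupport_mul_subset_left).trans hws
  have hcs : ∀ f : Rn n → ℝ, HasCompactSupport (fun x => w x * f x) := fun f => hwc.mul_right
  have hp : ContDiff ℝ 1 fun x => w x * (Y x + δ) := hw.mul (hY.add contDiff_const)
  have hm : ContDiff ℝ 1 fun x => w x * (δ - Y x) := hw.mul (contDiff_const.sub hY)
  have hsign : ∀ x, 0 ≤ w x * (Y x + δ) ∧ 0 ≤ w x * (δ - Y x) := by
    intro x
    by_cases hx : x ∈ tsupport w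
    · have := abs_le.1 (hYδ x (hws hx))
      exact ⟨mul_nonneg (hw0 x) (by linarith), mul_nonneg (hw0 x) (by linarith)⟩
    · simp [image_eq_zero_of_notMem_tsupport hx]
  have b1 := hf.abs_setIntegral_fderiv_le hU hUb hN hθ he hp (hcs _) (hts _)
    fun x => (hsign x).1
  have b2 := hf.abs_setIntegral_fderiv_le hU hUb hN hθ he hw hwc hws hw0
  have b3 : 0 ≤ ∫ x in U, fderiv ℝ (fun x => w x * (δ - Y x)) x N := by
    refine hf.setIntegral_fderiv_nonneg hU hUb ?_ hm (hcs _) (hts _) fun x => (hsign x).2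
    rw [hN, real_inner_self_eq_norm_sq, hN]
    linarith
  have e1 : ∫ x in U, fderiv ℝ (fun x => w x * Y x) x e =
      (∫ x in U, fderiv ℝ (fun x => w x * (Y x + δ)) x e) - δ * ∫ x in U, fderiv ℝ w x e := by
    rw [← setIntegral_fderiv_const_mul hw,
      ← setIntegral_fderiv_sub hp (hcs _) (contDiff_const.mul hw) hwc.mul_left]
    congr 3 with x
    congr 2 with x
    ring
  have e2 : ∫ x in U, fderiv ℝ (fun x => w x * (δ - Y x)) x N =
      2 * δ * (∫ x in U, fderiv ℝ w x N) - ∫ x in U, fderiv ℝ (fun x => w x * (Y x + δ)) x N := by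
    rw [← setIntegral_fderiv_const_mul hw,
      ← setIntegral_fderiv_sub (contDiff_const.mul hw) hwc.mul_left hp (hcs _)]
    congr 3 with x
    congr 2 with x
    ring
  rw [e2] at b3
  rw [e1]
  refine (abs_sub _ _).trans ?_
  rw [abs_mul, abs_of_nonneg hδ]
  nlinarith

end DivergenceTheorem

end

/-! ### The divergence theorem with the Hausdorff surface measure -/

section

variable {n : ℕ} {U : Set (Rn n)}

theorem contDiff_coord {X : Rn n → Rn n} (hX : ContDiff ℝ 1 X) (i : Fin n) :
    ContDiff ℝ 1 fun z => X z i :=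
  (EuclideanSpace.proj i : Rn n →L[ℝ] ℝ).contDiff.comp hX

theorem setIntegral_divergence_smul {X : Rn n → Rn n} (hX : ContDiff ℝ 1 X) {w : Rn n → ℝ}
    (hw : ContDiff ℝ 1 w) (hc : HasCompactSupport w) :
    ∫ x in U, divergence (fun x => w x • X x) x =
      ∑ i, ∫ x in U, fderiv ℝ (fun x => w x * X x i) x (EuclideanSpace.single i 1) := by
  simp only [divergence, PiLp.smul_apply, smul_eq_mul]
  exact integral_finsetSum _ fun i _ =>
    integrableOn_fderiv_apply (hw.mul (contDiff_coord hX i)) hc.mul_right _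

/-- Freezing X at y contributes exactly minus the normal derivative, which is close to minus the
surface integral; the oscillation of X in the ball is a small factor. Each of the two errors takes
η/2. -/
theorem exists_ball_abs_divergence_add_le [IsFiniteMeasure (surfaceMeasure U)] (hU : IsOpen U)
    (hUb : Bornology.IsBounded U) {X : Rn n → Rn n} (hX : ContDiff ℝ 1 X) {y : Rn n}
    (hy : IsNormal U y (-X y)) {η : ℝ} (hη : 0 < η) :
    ∃ b > 0, ∀ w : Rn n → ℝ, ContDiff ℝ 1 w → HasCompactSupport w →
      tsupport w ⊆ Metric.ball y b → (∀ x, 0 ≤ w x) →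
      |(∫ x in U, divergence (fun x => w x • X x) x) + ∫ x, w x ∂(surfaceMeasure U)| ≤
        η * ∫ x, w x ∂(surfaceMeasure U) := by
  set N := -X y with hNdef
  have hN := hy.1
  obtain ⟨θ, hθ0, hθ, hθη⟩ : ∃ θ : ℝ, 0 < θ ∧ θ ≤ 1 / 3 ∧ (1 - θ)⁻¹ ^ (n - 1) ≤ 1 + η / 2 := by
    have hc : ContinuousAt (fun θ : ℝ => (1 - θ)⁻¹ ^ (n - 1)) 0 := by
      refine ContinuousAt.pow (ContinuousAt.inv₀ (by fun_prop) (by simp)) _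
    have h1 : ∀ᶠ θ in 𝓝[>] (0 : ℝ), (1 - θ)⁻¹ ^ (n - 1) < 1 + η / 2 := by
      refine nhdsWithin_le_nhds (hc.eventually (gt_mem_nhds ?_))
      simp [hη]
    have h2 : ∀ᶠ θ in 𝓝[>] (0 : ℝ), θ < 1 / 3 := nhdsWithin_le_nhds (gt_mem_nhds (by norm_num))
    obtain ⟨θ, h3, h4, h5⟩ := (h1.and (h2.and self_mem_nhdsWithin)).exists
    exact ⟨θ, h5, h4.le, h3.le⟩
  obtain ⟨R, σ, hf⟩ := hy.2 θ hθ0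
  -- Chosen so that n coordinate errors of size 6δ add up to at most η/2; the summand 12 keeps the
  -- denominator positive without using n ≥ 1.
  set δ : ℝ := η / (12 * n + 12) with hδ
  have hδ0 : 0 < δ := by positivity
  have hev : ∀ᶠ x in 𝓝 y, ‖X x - X y‖ ≤ δ := by
    filter_upwards [Metric.continuousAt_iff'.1 hX.continuous.continuousAt δ hδ0] with x hx
    rw [← dist_eq_norm]; exact hx.le
  obtain ⟨R', hR', hXδ⟩ := Metric.eventually_nhds_iff_ball.1 hev
  have hf' := hf.mono (lt_min hf.pos hR') (min_le_left R R')
  obtain ⟨τ, hτ⟩ := hf'.exists_graphChart hU hN hθ0.le hθ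
  refine ⟨min R R' / 4, hτ.pos, fun w hw hwc hws hw0 => ?_⟩
  have hws' : tsupport w ⊆ Metric.ball y (min R R') :=
    hws.trans (Metric.ball_subset_ball (by linarith [hf'.pos]))
  obtain ⟨hb1, hb2⟩ := hτ.surface_bounds hU hN (by linarith) hw hwc hws hw0
  set T := ∫ x in U, fderiv ℝ w x N with hT
  have hT0 : 0 ≤ T := by
    refine hf'.setIntegral_fderiv_nonneg hU hUb ?_ hw hwc hws' hw0
    rw [hN, real_inner_self_eq_norm_sq, hN]
    linarith
  have hsplit : ∫ x in U, divergence (fun x => w x • X x) x = -T +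
      ∑ i, ∫ x in U, fderiv ℝ (fun x => w x * (X x i - X y i)) x (EuclideanSpace.single i 1) := by
    rw [setIntegral_divergence_smul hX hw hwc, hT, setIntegral_fderiv_eq_sum hw hwc,
      ← Finset.sum_neg_distrib, ← Finset.sum_add_distrib]
    refine Finset.sum_congr rfl fun i _ => ?_
    have : (fun x => w x * (X x i - X y i)) = fun x => w x * X x i - X y i * w x := by
      funext x; ring
    rw [this, setIntegral_fderiv_sub (hw.mul (contDiff_coord hX i)) hwc.mul_right
      (contDiff_const.mul hw) hwc.mul_left, setIntegral_fderiv_const_mul hw, hNdef,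
      PiLp.neg_apply]
    ring
  have herr : |∑ i, ∫ x in U, fderiv ℝ (fun x => w x * (X x i - X y i)) x
      (EuclideanSpace.single i 1)| ≤ n * (6 * δ * T) := by
    refine (Finset.abs_sum_le_sum_abs _ _).trans ?_
    refine (Finset.sum_le_sum fun i _ => hf'.abs_setIntegral_fderiv_mul_le hU hUb hN hθ
      (e := EuclideanSpace.single i 1) (by simp) hw hwc hws' hw0
      ((contDiff_coord hX i).sub contDiff_const) hδ0.le fun x hx => ?_).trans ?_
    · have h1 := hXδ x (Metric.ball_subset_ball (min_le_right _ _) hx)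
      have h2 := PiLp.norm_apply_le (X x - X y) i
      rw [PiLp.sub_apply, Real.norm_eq_abs] at h2
      exact h2.trans h1
    · simp [hT]
  have hnδ : (n : ℝ) * (6 * δ * T) ≤ η / 2 * T := by
    have : (n : ℝ) * (6 * δ) ≤ η / 2 := by
      rw [hδ]
      have : (n : ℝ) * (6 * (η / (12 * n + 12))) = (6 * n * η) / (12 * n + 12) := by ring
      rw [this, div_le_iff₀ (by positivity)]
      nlinarith
    nlinarith
  have hb3 : ∫ x, w x ∂(surfaceMeasure U) ≤ T + η / 2 * T := by
    refine hb2.trans ?_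
    nlinarith
  rw [hsplit]
  have h1 := abs_le.1 (herr.trans hnδ)
  rw [abs_le]
  constructor <;> nlinarith

theorem integral_fderiv_eq_zero {w : Rn n → ℝ} (hw : ContDiff ℝ 1 w) (hwc : HasCompactSupport w)
    (e : Rn n) : ∫ x, fderiv ℝ w x e = 0 := by
  obtain ⟨C, hC⟩ := ContDiff.lipschitzWith_of_hasCompactSupport hwc hw one_ne_zero
  have h1 := (LipschitzWith.const (1 : ℝ)).integral_lineDeriv_mul_eq (μ := volume) hC hwc (-e)
  simp only [neg_neg, mul_one] at h1
  calc ∫ x, fderiv ℝ w x e = ∫ x, lineDeriv ℝ w x e := by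
        congr 1 with x
        rw [(hw.differentiable one_ne_zero x).lineDeriv_eq_fderiv]
    _ = 0 := by
        rw [← h1]
        refine integral_eq_zero_of_ae (Eventually.of_forall fun x => ?_)
        simp [lineDeriv]

/-- If s missed the boundary, U and the complement of its closure would separate it. -/
theorem inter_frontier_nonempty_of_isPreconnected {s : Set (Rn n)} (hs : IsPreconnected s)
    (hU : IsOpen U) (h : (s ∩ U).Nonempty) (h' : (s ∩ Uᶜ).Nonempty) :
    (s ∩ frontier U).Nonempty := by
  by_contra hne
  rw [not_nonempty_iff_eq_empty] at hne
  have hnf : ∀ z ∈ s, z ∉ U → z ∈ (closure U)ᶜ := fun z hz hzU hzc => by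
    have : z ∈ s ∩ frontier U := ⟨hz, by rw [hU.frontier_eq]; exact ⟨hzc, hzU⟩⟩
    rw [hne] at this
    exact this
  obtain ⟨x, hx, hxU⟩ := h'
  obtain ⟨z, -, hzU, hzc⟩ := hs U (closure U)ᶜ hU isClosed_closure.isOpen_compl
    (fun z hz => (em (z ∈ U)).imp id (hnf z hz)) h ⟨x, hx, hnf x hx hxU⟩
  exact hzc (subset_closure hzU)

theorem ball_subset_or_disjoint {y : Rn n} {b : ℝ} (hU : IsOpen U)
    (hb : Disjoint (Metric.ball y b) (frontier U)) :
    Metric.ball y b ⊆ U ∨ Disjoint (Metric.ball y b) U := by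
  have hc : IsPreconnected (Metric.ball y b) := (convex_ball y b).isPreconnected
  by_cases h : (Metric.ball y b ∩ U).Nonempty
  · left
    by_contra hns
    obtain ⟨x, hx, hxU⟩ := not_subset.1 hns
    obtain ⟨z, hz, hzf⟩ := inter_frontier_nonempty_of_isPreconnected hc hU h ⟨x, hx, hxU⟩
    exact hb.ne_of_mem hz hzf rfl
  · right
    rwa [disjoint_iff_inter_eq_empty, ← not_nonempty_iff_eq_empty]

theorem setIntegral_divergence_eq_zero (hU : IsOpen U) {X : Rn n → Rn n} (hX : ContDiff ℝ 1 X)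
    {y : Rn n} {b : ℝ} (hb : Disjoint (Metric.ball y b) (frontier U)) {w : Rn n → ℝ}
    (hw : ContDiff ℝ 1 w) (hc : HasCompactSupport w) (hws : tsupport w ⊆ Metric.ball y b) :
    ∫ x in U, divergence (fun x => w x • X x) x = 0 := by
  rw [setIntegral_divergence_smul hX hw hc]
  refine Finset.sum_eq_zero fun i _ => ?_
  have hwX : ContDiff ℝ 1 fun x => w x * X x i := hw.mul (contDiff_coord hX i)
  have h0 : ∀ x ∉ Metric.ball y b,
      fderiv ℝ (fun x => w x * X x i) x (EuclideanSpace.single i 1) = 0 := by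
    intro x hx
    have : fderiv ℝ (fun x => w x * X x i) x = 0 :=
      image_eq_zero_of_notMem_tsupport fun hmem =>
        hx (hws (tsupport_mul_subset_left (tsupport_fderiv_subset ℝ hmem)))
    simp [this]
  rcases ball_subset_or_disjoint hU hb with h | h
  · rw [setIntegral_eq_integral_of_forall_compl_eq_zero fun x hx => h0 x fun hx' => hx (h hx')]
    exact integral_fderiv_eq_zero hwX hc.mul_right _
  · exact setIntegral_eq_zero_of_forall_eq_zero fun x hx =>
      h0 x fun hx' => h.ne_of_mem hx' hx rfl

theorem setIntegral_divergence_eq_neg_surface_of_nonneg [IsFiniteMeasure (surfaceMeasure U)]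
    (hU : IsOpen U) (hUb : Bornology.IsBounded U) {X : Rn n → Rn n} (hX : ContDiff ℝ 1 X)
    (hXc : HasCompactSupport X) (hnormal : ∀ y ∈ frontier U, IsNormal U y (-X y)) {w : Rn n → ℝ}
    (hw : ContDiff ℝ 1 w) (hw0 : ∀ x, 0 ≤ w x) :
    ∫ x in U, divergence (fun x => w x • X x) x = -∫ x, w x ∂(surfaceMeasure U) := by
  -- X is a unit vector on the boundary, so a partition of unity on the support of X serves the
  -- volume and the surface integral at once.
  have hfK : frontier U ⊆ tsupport X := by
    intro y hy
    refine subset_tsupport _ fun h => ?_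
    have := (hnormal y hy).1
    simp [h] at this
  have hlocal : ∀ η > 0, ∀ y : tsupport X, ∃ b > 0, ∀ w : Rn n → ℝ, ContDiff ℝ 1 w →
      HasCompactSupport w → tsupport w ⊆ Metric.ball (y : Rn n) b → (∀ x, 0 ≤ w x) →
      |(∫ x in U, divergence (fun x => w x • X x) x) + ∫ x, w x ∂(surfaceMeasure U)| ≤
        η * ∫ x, w x ∂(surfaceMeasure U) := by
    intro η hη y
    by_cases hy : (y : Rn n) ∈ frontier U
    · exact exists_ball_abs_divergence_add_le hU hUb hX (hnormal y hy) hη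
    · obtain ⟨b, hb, hbs⟩ := Metric.isOpen_iff.1 isClosed_frontier.isOpen_compl (y : Rn n) hy
      refine ⟨b, hb, fun w hw hwc hws hw0 => ?_⟩
      have hd : Disjoint (Metric.ball (y : Rn n) b) (frontier U) :=
        disjoint_left.2 fun x hx => hbs hx
      have h0 : ∫ x, w x ∂(surfaceMeasure U) = 0 := by
        rw [surfaceMeasure]
        exact setIntegral_eq_zero_of_forall_eq_zero fun x hx =>
          image_eq_zero_of_notMem_tsupport fun h => hbs (hws h) hx
      rw [setIntegral_divergence_eq_zero hU hX hd hw hwc hws, h0]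
      simp
  have hest : ∀ η > 0, |(∫ x in U, divergence (fun x => w x • X x) x) +
      ∫ x, w x ∂(surfaceMeasure U)| ≤ η * ∫ x, w x ∂(surfaceMeasure U) := by
    intro η hη
    choose b hb hest using hlocal η hη
    obtain ⟨t, χ, hχ, hχs, hχ0, hχ1⟩ := exists_finite_partition hXc.isCompact
      (fun y => Metric.ball (y : Rn n) (b y)) (fun y => Metric.isOpen_ball)
      fun y => Metric.mem_ball_self (hb y)
    have hχc : ∀ k, HasCompactSupport (χ k) := fun k =>
      Metric.isCompact_of_isClosed_isBounded (isClosed_tsupport _)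
        (Metric.isBounded_ball.subset (hχs k))
    have hwk : ∀ k, ContDiff ℝ 1 fun x => χ k x * w x := fun k => ((hχ k).of_le (by simp)).mul hw
    have e1 : ∫ x in U, divergence (fun x => w x • X x) x =
        ∑ k, ∫ x in U, divergence (fun x => (χ k x * w x) • X x) x := by
      have h1 : ∀ k, Integrable (divergence fun x => (χ k x * w x) • X x)
          (volume.restrict U) := by
        intro k
        unfold divergence
        simp only [PiLp.smul_apply, smul_eq_mul]
        exact integrable_finsetSum _ fun i _ => integrableOn_fderiv_apply
          ((hwk k).mul (contDiff_coord hX i)) (hχc k).mul_right.mul_right _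
      rw [← integral_finsetSum _ fun k _ => h1 k]
      congr 1 with x
      simp only [divergence, PiLp.smul_apply, smul_eq_mul]
      rw [Finset.sum_comm]
      refine Finset.sum_congr rfl fun i _ => ?_
      have h2 : (fun z => w z * X z i) = fun z => ∑ k, χ k z * w z * X z i := by
        funext z
        by_cases hz : z ∈ tsupport X
        · simp_rw [← Finset.sum_mul]
          rw [hχ1 z hz, one_mul]
        · simp [image_eq_zero_of_notMem_tsupport hz]
      rw [h2, fderiv_fun_sum fun k _ =>
        ((hwk k).mul (contDiff_coord hX i)).differentiable one_ne_zero x, _root_.sum_apply]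
    have e2 : ∫ x, w x ∂(surfaceMeasure U) =
        ∑ k, ∫ x, χ k x * w x ∂(surfaceMeasure U) := by
      rw [← integral_finsetSum _ fun k _ =>
        (hwk k).continuous.integrable_of_hasCompactSupport (hχc k).mul_right]
      rw [surfaceMeasure]
      refine setIntegral_congr_fun isClosed_frontier.measurableSet fun x hx => ?_
      rw [← Finset.sum_mul, hχ1 x (hfK hx), one_mul]
    -- The local errors are relative to the surface integrals of χ_k w, which sum to that of w.
    -- Hence the total error is η times a fixed number, however many balls this η requires.
    rw [e1, e2, ← Finset.sum_add_distrib, Finset.mul_sum]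
    refine (Finset.abs_sum_le_sum_abs _ _).trans (Finset.sum_le_sum fun k _ => ?_)
    exact hest k _ (hwk k) (hχc k).mul_right ((tsupport_mul_subset_left).trans (hχs k))
      fun x => mul_nonneg (hχ0 k x) (hw0 x)
  have hS0 : 0 ≤ ∫ x, w x ∂(surfaceMeasure U) := integral_nonneg hw0
  have hlim : Tendsto (fun η : ℝ => η * ∫ x, w x ∂(surfaceMeasure U)) (𝓝[>] 0) (𝓝 0) := by
    have : Tendsto (fun η : ℝ => η * ∫ x, w x ∂(surfaceMeasure U)) (𝓝[>] 0)
        (𝓝 (0 * ∫ x, w x ∂(surfaceMeasure U))) :=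
      (Continuous.tendsto (by fun_prop) _).mono_left nhdsWithin_le_nhds
    rwa [zero_mul] at this
  have h0 := ge_of_tendsto hlim (by
    filter_upwards [self_mem_nhdsWithin] with η hη using hest η hη)
  have := abs_nonpos_iff.1 h0
  linarith

end

/-! ### The signed distance and its gradient -/

section

variable {n : ℕ} {U : Set (Rn n)}

theorem abs_signedDist (x : Rn n) : |signedDist U x| = Metric.infDist x (frontier U) := by
  unfold signedDist
  split_ifs
  · exact abs_of_nonneg Metric.infDist_nonneg
  · rw [abs_neg, abs_of_nonneg Metric.infDist_nonneg]

/-- The segment from x to x' crosses the boundary, and the crossing point bounds both distances.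
This makes the signed distance 1-Lipschitz across the interface. -/
theorem infDist_add_infDist_frontier_le (hU : IsOpen U) {x x' : Rn n} (hx : x ∈ U)
    (hx' : x' ∉ U) :
    Metric.infDist x (frontier U) + Metric.infDist x' (frontier U) ≤ dist x x' := by
  obtain ⟨z, hz, hzf⟩ := inter_frontier_nonempty_of_isPreconnected
    (convex_segment (𝕜 := ℝ) x x').isPreconnected hU
    ⟨x, left_mem_segment ℝ x x', hx⟩ ⟨x', right_mem_segment ℝ x x', hx'⟩
  rw [← dist_add_dist_of_mem_segment hz, dist_comm z x']
  exact add_le_add (Metric.infDist_le_dist_of_mem hzf) (Metric.infDist_le_dist_of_mem hzf)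

theorem lipschitzWith_signedDist (hU : IsOpen U) : LipschitzWith 1 (signedDist U) := by
  refine LipschitzWith.of_le_add fun x x' => ?_
  have h1 := Metric.infDist_le_infDist_add_dist (s := frontier U) (x := x) (y := x')
  have h2 := Metric.infDist_le_infDist_add_dist (s := frontier U) (x := x') (y := x)
  rw [dist_comm] at h2
  have hx0 : 0 ≤ Metric.infDist x (frontier U) := Metric.infDist_nonneg
  have hx0' : 0 ≤ Metric.infDist x' (frontier U) := Metric.infDist_nonneg
  have hd : 0 ≤ dist x x' := dist_nonneg
  unfold signedDist
  split_ifs with hx hx'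
  · exact h1
  · linarith [infDist_add_infDist_frontier_le hU hx hx']
  · linarith
  · linarith

theorem eventually_mem_ball_of_inner_pos {x y e : Rn n} (he : 0 < ⟪x - y, e⟫) :
    ∀ᶠ t : ℝ in 𝓝[>] 0, y + t • e ∈ Metric.ball x (dist x y) := by
  have h1 : ∀ᶠ t : ℝ in 𝓝[>] 0, t * ‖e‖ ^ 2 < 2 * ⟪x - y, e⟫ := by
    have : Tendsto (fun t : ℝ => t * ‖e‖ ^ 2) (𝓝[>] 0) (𝓝 (0 * ‖e‖ ^ 2)) :=
      (Continuous.tendsto (by fun_prop) 0).mono_left nhdsWithin_le_nhds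
    rw [zero_mul] at this
    exact this.eventually (gt_mem_nhds (by linarith))
  filter_upwards [h1, self_mem_nhdsWithin] with t ht ht0
  have ht0 : 0 < t := ht0
  rw [mem_ball_iff_norm, dist_eq_norm]
  refine lt_of_pow_lt_pow_left₀ 2 (norm_nonneg _) ?_
  have e1 : y + t • e - x = t • e - (x - y) := by abel
  rw [e1, norm_sub_sq_real, norm_smul, inner_smul_left, real_inner_comm, Real.norm_of_nonneg ht0.le]
  simp only [conj_trivial]
  nlinarith

/-- Where the signed distance is differentiable, its gradient is the inward normal at a nearest
boundary point. -/
theorem gradient_signedDist_eq (hU : IsOpen U) {x y ν : Rn n} (hy : y ∈ frontier U)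
    (hxy : Metric.infDist x (frontier U) = dist x y) (hx : x ∉ frontier U)
    (hν : IsNormal U y (-ν)) (hd : DifferentiableAt ℝ (signedDist U) x) :
    gradient (signedDist U) x = ν := by
  have hne : x ≠ y := fun h => hx (h ▸ hy)
  set d := dist x y with hdd
  have hd0 : 0 < d := dist_pos.2 hne
  have hball : Disjoint (Metric.ball x d) (frontier U) := by
    rw [← hxy]; exact Metric.disjoint_ball_infDist
  set p : Rn n := d⁻¹ • (x - y) with hp
  have hp1 : ‖p‖ = 1 := by
    rw [hp, norm_smul, ← dist_eq_norm, norm_inv, Real.norm_of_nonneg hd0.le,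
      inv_mul_cancel₀ hd0.ne']
  have hpx : x - d • p = y := by
    rw [hp, smul_smul, mul_inv_cancel₀ hd0.ne', one_smul, sub_sub_cancel]
  have hgn : ‖gradient (signedDist U) x‖ ≤ 1 := by
    rw [gradient, LinearIsometryEquiv.norm_map]
    simpa using norm_fderiv_le_of_lipschitz ℝ (lipschitzWith_signedDist hU) (x₀ := x)
  -- Moving from x straight towards its nearest point y keeps y nearest, so the distance falls at
  -- unit rate.
  have hinf : ∀ t ∈ Icc 0 d, Metric.infDist (x + t • (-p)) (frontier U) = d - t := by
    intro t ht
    have h1 : dist (x + t • (-p)) y = d - t := by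
      rw [dist_eq_norm, ← hpx]
      have : x + t • (-p) - (x - d • p) = (d - t) • p := by rw [sub_smul, smul_neg]; abel
      rw [this, norm_smul, hp1, mul_one, Real.norm_of_nonneg (by linarith [ht.2])]
    refine le_antisymm (h1 ▸ Metric.infDist_le_dist_of_mem hy) ?_
    have h2 := Metric.infDist_le_infDist_add_dist (s := frontier U) (x := x) (y := x + t • (-p))
    have h3 : dist x (x + t • (-p)) = t := by
      rw [dist_self_add_right, norm_smul, norm_neg, hp1, mul_one, Real.norm_of_nonneg ht.1]
    linarith
  have hmem : ∀ t ∈ Ico 0 d, x + t • (-p) ∈ Metric.ball x d := by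
    intro t ht
    rw [mem_ball_iff_norm, add_sub_cancel_left, norm_smul, norm_neg, hp1, mul_one,
      Real.norm_of_nonneg ht.1]
    exact ht.2
  have hslope : ∀ s : ℝ, (∀ t ∈ Ico 0 d, signedDist U (x + t • (-p)) = s * (d - t)) →
      ⟪gradient (signedDist U) x, p⟫ = s := by
    intro s hs
    have h1 : HasDerivAt (fun t : ℝ => signedDist U (x + t • (-p)))
        (fderiv ℝ (signedDist U) x (-p)) 0 :=
      hd.hasFDerivAt.hasLineDerivAt (-p)
    have h2 : HasDerivAt (fun t : ℝ => s * (d - t)) (s * -1) 0 :=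
      ((hasDerivAt_id (0 : ℝ)).const_sub d).const_mul s
    have h3 : HasDerivWithinAt (fun t : ℝ => signedDist U (x + t • (-p))) (s * -1) (Ici 0) 0 := by
      refine h2.hasDerivWithinAt.congr_of_eventuallyEq ?_ (hs 0 ⟨le_rfl, hd0⟩)
      filter_upwards [self_mem_nhdsWithin, nhdsWithin_le_nhds (gt_mem_nhds hd0)] with t ht ht'
      exact hs t ⟨ht, ht'⟩
    have h4 := (uniqueDiffOn_Ici (0 : ℝ) 0 self_mem_Ici).eq_deriv _ h1.hasDerivWithinAt h3
    rw [map_neg] at h4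
    rw [gradient, InnerProductSpace.toDual_symm_apply]
    linarith
  -- Equality case of Cauchy–Schwarz: the gradient has norm at most 1 and component ±1 along the
  -- unit vector p, so it is ±p.
  have hcs : ∀ s : ℝ, s ^ 2 = 1 → ⟪gradient (signedDist U) x, p⟫ = s →
      gradient (signedDist U) x = s • p := by
    intro s hs h
    have h1 : ‖gradient (signedDist U) x - s • p‖ ^ 2 ≤ 0 := by
      rw [norm_sub_sq_real, inner_smul_right, h, norm_smul, hp1, Real.norm_eq_abs, mul_one, sq_abs]
      nlinarith [norm_nonneg (gradient (signedDist U) x)]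
    have h2 : ‖gradient (signedDist U) x - s • p‖ = 0 := by
      nlinarith [norm_nonneg (gradient (signedDist U) x - s • p)]
    exact sub_eq_zero.1 (norm_eq_zero.1 h2)
  have hev : ∀ e, 0 < ⟪p, e⟫ → ∀ᶠ t : ℝ in 𝓝[>] 0, y + t • e ∈ Metric.ball x d := by
    intro e he
    refine eventually_mem_ball_of_inner_pos ?_
    rw [hp, real_inner_smul_left] at he
    exact (pos_iff_pos_of_mul_pos he).1 (inv_pos.2 hd0)
  have hν1 : ‖ν‖ = 1 := by simpa using hν.1
  -- The ball about x touches the boundary at y from one side only. If p, up to sign, were not the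
  -- normal there, the difference of the two unit vectors would be a direction into the ball but to
  -- the wrong side of ∂U.
  rcases ball_subset_or_disjoint hU hball with hb | hb
  · have h1 := hcs 1 (by norm_num) (hslope 1 fun t ht => by
      rw [signedDist, if_pos (hb (hmem t ht)), hinf t ⟨ht.1, ht.2.le⟩, one_mul])
    rw [h1, one_smul]
    by_contra hpν
    obtain ⟨h2, h3⟩ := inner_sub_pos_of_ne hp1 hν1 hpν
    obtain ⟨t, ht, ht'⟩ := ((hev _ h2).and
      (hν.eventually_notMem (e := p - ν) (by rw [inner_neg_left]; linarith))).exists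
    exact ht' (hb ht)
  · have h1 := hcs (-1) (by norm_num) (hslope (-1) fun t ht => by
      rw [signedDist, if_neg fun h => hb.ne_of_mem (hmem t ht) h rfl, hinf t ⟨ht.1, ht.2.le⟩]
      ring)
    rw [h1, neg_one_smul, neg_eq_iff_eq_neg]
    by_contra hpν
    obtain ⟨h2, h3⟩ := inner_sub_pos_of_ne hp1 hν.1 hpν
    obtain ⟨t, ht, ht'⟩ := ((hev _ h2).and (hν.eventually_mem h3)).exists
    exact hb.ne_of_mem ht ht' rfl

end

/-! ### The tanh profile and the phase field -/

section

variable {n : ℕ} {U : Set (Rn n)} {ε : ℝ}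

theorem hasDerivAt_tanh (s : ℝ) : HasDerivAt Real.tanh (1 / Real.cosh s ^ 2) s := by
  have h : HasDerivAt (fun s => Real.sinh s / Real.cosh s)
      ((Real.cosh s * Real.cosh s - Real.sinh s * Real.sinh s) / Real.cosh s ^ 2) s :=
    (Real.hasDerivAt_sinh s).div (Real.hasDerivAt_cosh s) (Real.cosh_pos s).ne'
  have e : Real.cosh s * Real.cosh s - Real.sinh s * Real.sinh s = 1 := by
    nlinarith [Real.cosh_sq s]
  rw [e] at h
  exact h.congr_of_eventuallyEq (Eventually.of_forall fun s => Real.tanh_eq_sinh_div_cosh s)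

/-- It follows from |sinh s| ≥ |s|. The resulting algebraic decay replaces the exponential one and
is all that the limit needs. -/
theorem one_add_sq_le_cosh_sq (s : ℝ) : 1 + s ^ 2 ≤ Real.cosh s ^ 2 := by
  rw [Real.cosh_sq]
  have : |s| ≤ |Real.sinh s| := by
    rcases le_total 0 s with h | h
    · rw [abs_of_nonneg h, abs_of_nonneg (Real.sinh_nonneg_iff.2 h)]
      exact Real.self_le_sinh_iff.2 h
    · rw [abs_of_nonpos h, abs_of_nonpos (Real.sinh_nonpos_iff.2 h)]
      linarith [Real.sinh_le_self_iff.2 h]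
  have := sq_le_sq.2 this
  linarith

theorem tanh_sq_eq (s : ℝ) : Real.tanh s ^ 2 = 1 - 1 / Real.cosh s ^ 2 := by
  rw [Real.tanh_eq_sinh_div_cosh, div_pow, Real.sinh_sq]
  have := (Real.cosh_pos s).ne'
  field_simp

theorem abs_tanh_le_one (s : ℝ) : |Real.tanh s| ≤ 1 := by
  rw [← sq_le_one_iff_abs_le_one, tanh_sq_eq]
  have : 0 ≤ 1 / Real.cosh s ^ 2 := by positivity
  linarith

theorem one_sub_tanh_le {s : ℝ} (hs : 0 ≤ s) : 1 - Real.tanh s ≤ 1 / (1 + s ^ 2) := by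
  have h0 : 0 ≤ Real.tanh s := by
    rw [Real.tanh_eq_sinh_div_cosh]
    exact div_nonneg (Real.sinh_nonneg_iff.2 hs) (Real.cosh_pos s).le
  have h1 := (abs_le.1 (abs_tanh_le_one s)).2
  have h2 : 1 / Real.cosh s ^ 2 ≤ 1 / (1 + s ^ 2) :=
    one_div_le_one_div_of_le (by positivity) (one_add_sq_le_cosh_sq s)
  nlinarith [tanh_sq_eq s]

theorem phaseField_mem_Icc (x : Rn n) : phaseField U ε x ∈ Icc (0 : ℝ) 1 := by
  have := abs_le.1 (abs_tanh_le_one (signedDist U x / ε))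
  unfold phaseField
  constructor <;> linarith

theorem lipschitzWith_tanh : LipschitzWith 1 Real.tanh := by
  refine lipschitzWith_of_nnnorm_deriv_le (fun s => (hasDerivAt_tanh s).differentiableAt)
    fun s => ?_
  rw [(hasDerivAt_tanh s).deriv, ← NNReal.coe_le_coe, coe_nnnorm,
    Real.norm_of_nonneg (by positivity), NNReal.coe_one,
    div_le_one (by have := Real.cosh_pos s; positivity)]
  nlinarith [one_add_sq_le_cosh_sq s, sq_nonneg s]

theorem lipschitzWith_phaseField (hU : IsOpen U) (hε : 0 < ε) :
    LipschitzWith (1 / (2 * ε)).toNNReal (phaseField U ε) := by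
  refine LipschitzWith.of_dist_le_mul fun x x' => ?_
  rw [Real.coe_toNNReal _ (by positivity), Real.dist_eq]
  have h1 := lipschitzWith_tanh.dist_le_mul (signedDist U x / ε) (signedDist U x' / ε)
  have h2 := (lipschitzWith_signedDist hU).dist_le_mul x x'
  rw [NNReal.coe_one, one_mul, Real.dist_eq, Real.dist_eq, ← sub_div, abs_div, abs_of_pos hε] at h1
  rw [NNReal.coe_one, one_mul, Real.dist_eq] at h2
  have e : phaseField U ε x - phaseField U ε x' = 1 / 2 *
      (Real.tanh (signedDist U x / ε) - Real.tanh (signedDist U x' / ε)) := by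
    unfold phaseField; ring
  rw [e, abs_mul, abs_of_pos (by norm_num : (0 : ℝ) < 1 / 2)]
  calc 1 / 2 * |Real.tanh (signedDist U x / ε) - Real.tanh (signedDist U x' / ε)|
      ≤ 1 / 2 * (|signedDist U x - signedDist U x'| / ε) := by gcongr
    _ ≤ 1 / 2 * (dist x x' / ε) := by gcongr
    _ = 1 / (2 * ε) * dist x x' := by field_simp

theorem norm_gradient_phaseField_le (hU : IsOpen U) (hε : 0 < ε) (x : Rn n) :
    ‖gradient (phaseField U ε) x‖ ≤ 1 / (2 * ε) := by
  rw [gradient, LinearIsometryEquiv.norm_map]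
  have := norm_fderiv_le_of_lipschitz ℝ (lipschitzWith_phaseField hU hε) (x₀ := x)
  rwa [Real.coe_toNNReal _ (by positivity)] at this

theorem measurable_gradient (φ : Rn n → ℝ) : Measurable (gradient φ) :=
  (InnerProductSpace.toDual ℝ (Rn n)).symm.continuous.measurable.comp (measurable_fderiv ℝ φ)

theorem gradient_phaseField {x : Rn n} (hd : DifferentiableAt ℝ (signedDist U) x) :
    gradient (phaseField U ε) x =
      (1 / (2 * ε) * (1 / Real.cosh (signedDist U x / ε) ^ 2)) • gradient (signedDist U) x := by
  have h1 : HasFDerivAt (fun z => signedDist U z / ε) (ε⁻¹ • fderiv ℝ (signedDist U) x) x := by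
    simpa only [div_eq_mul_inv] using hd.hasFDerivAt.mul_const ε⁻¹
  have h2 := (((hasDerivAt_tanh (signedDist U x / ε)).comp_hasFDerivAt x h1).const_add 1).const_mul
    (1 / 2)
  have h3 : fderiv ℝ (phaseField U ε) x = _ := h2.fderiv
  rw [gradient, h3, gradient]
  simp only [map_smul, smul_smul]
  congr 1
  ring

theorem abs_phaseField_sub_indicator_le (hε : 0 < ε) (x : Rn n) :
    |phaseField U ε x - U.indicator (fun _ => 1) x| ≤
      1 / (1 + (Metric.infDist x (frontier U) / ε) ^ 2) := by
  set s := Metric.infDist x (frontier U) / ε with hs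
  have hs0 : 0 ≤ s := div_nonneg Metric.infDist_nonneg hε.le
  have h1 := one_sub_tanh_le hs0
  have h2 := abs_le.1 (abs_tanh_le_one s)
  have h3 : 0 ≤ 1 / (1 + s ^ 2) := by positivity
  unfold phaseField signedDist
  by_cases hx : x ∈ U
  · rw [if_pos hx, indicator_of_mem hx, ← hs, abs_le]
    constructor <;> linarith
  · rw [if_neg hx, indicator_of_notMem hx, neg_div, ← hs, Real.tanh_neg, abs_le]
    constructor <;> linarith

/-- The defect between `|∇φ_ε|` and its projection on the extended normal field is small. -/
theorem abs_norm_gradient_phaseField_sub_inner_le (hU : IsOpen U) (hne : (frontier U).Nonempty)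
    (hε : 0 < ε) {X : Rn n → Rn n} {L : NNReal} (hX : LipschitzWith L X)
    (hnormal : ∀ y ∈ frontier U, IsNormal U y (-X y)) {x : Rn n} (hx : x ∉ frontier U)
    (hd : DifferentiableAt ℝ (signedDist U) x) :
    |‖gradient (phaseField U ε) x‖ - ⟪gradient (phaseField U ε) x, X x⟫| ≤
      L * ((Metric.infDist x (frontier U) / ε) /
        (1 + (Metric.infDist x (frontier U) / ε) ^ 2)) := by
  obtain ⟨y, hy, hxy⟩ := isClosed_frontier.exists_infDist_eq_dist hne x
  have hg := gradient_signedDist_eq hU hy hxy hx (hnormal y hy) hd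
  have hν : ‖X y‖ = 1 := by simpa using (hnormal y hy).1
  have hc0 : 0 < Real.cosh (signedDist U x / ε) := Real.cosh_pos _
  set k : ℝ := 1 / (2 * ε) * (1 / Real.cosh (signedDist U x / ε) ^ 2) with hk
  have hk0 : 0 ≤ k := by positivity
  rw [gradient_phaseField hd, hg, norm_smul, hν, real_inner_smul_left, Real.norm_of_nonneg hk0,
    ← mul_sub, abs_mul, abs_of_nonneg hk0]
  -- The factor dist(x, ∂U) gained here cancels the 1/ε in |∇φ_ε|, which leaves a bounded function
  -- of dist/ε.
  have h1 : |1 - ⟪X y, X x⟫| ≤ L * Metric.infDist x (frontier U) := by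
    have e : 1 - ⟪X y, X x⟫ = ⟪X y, X y - X x⟫ := by
      rw [inner_sub_right, real_inner_self_eq_norm_sq, hν, one_pow]
    rw [e, hxy]
    refine (abs_real_inner_le_norm _ _).trans ?_
    rw [hν, one_mul, ← dist_eq_norm, dist_comm]
    exact hX.dist_le_mul x y
  have h2 : k ≤ 1 / (2 * ε) * (1 / (1 + (Metric.infDist x (frontier U) / ε) ^ 2)) := by
    rw [hk]
    refine mul_le_mul_of_nonneg_left ?_ (by positivity)
    refine one_div_le_one_div_of_le (by positivity) ?_
    have := one_add_sq_le_cosh_sq (signedDist U x / ε)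
    rwa [← sq_abs (signedDist U x / ε), abs_div, abs_signedDist, abs_of_pos hε] at this
  have hi : 0 ≤ Metric.infDist x (frontier U) := Metric.infDist_nonneg
  have hL : (0 : ℝ) ≤ L := L.coe_nonneg
  calc k * |1 - ⟪X y, X x⟫| ≤ 1 / (2 * ε) * (1 / (1 + (Metric.infDist x (frontier U) / ε) ^ 2)) *
        (L * Metric.infDist x (frontier U)) := by gcongr
    _ = 1 / 2 * (L * ((Metric.infDist x (frontier U) / ε) /
        (1 + (Metric.infDist x (frontier U) / ε) ^ 2))) := by field_simp
    _ ≤ L * ((Metric.infDist x (frontier U) / ε) /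
        (1 + (Metric.infDist x (frontier U) / ε) ^ 2)) := by
      have : 0 ≤ L * ((Metric.infDist x (frontier U) / ε) /
        (1 + (Metric.infDist x (frontier U) / ε) ^ 2)) := by positivity
      linarith

theorem div_one_add_sq_le_one (s : ℝ) : s / (1 + s ^ 2) ≤ 1 := by
  rw [div_le_one (by positivity)]
  nlinarith [sq_nonneg (s - 1), sq_nonneg s]

theorem div_one_add_sq_le_inv {s : ℝ} (hs : 0 < s) : s / (1 + s ^ 2) ≤ 1 / s := by
  rw [div_le_div_iff₀ (by positivity) hs]
  nlinarith

theorem one_div_one_add_sq_le_inv {s : ℝ} (hs : 0 < s) : 1 / (1 + s ^ 2) ≤ 1 / s := by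
  refine one_div_le_one_div_of_le hs ?_
  nlinarith [sq_nonneg (s - 1), sq_nonneg s]

/-- Integration by parts of a Lipschitz function against a compactly supported field. -/
theorem integral_inner_gradient_eq_neg {φ : Rn n → ℝ} {C : NNReal} (hφ : LipschitzWith C φ)
    {Y : Rn n → Rn n} (hY : ContDiff ℝ 1 Y) (hYc : HasCompactSupport Y) :
    ∫ x, ⟪gradient φ x, Y x⟫ = -∫ x, φ x * divergence Y x := by
  have hYi : ∀ i, ContDiff ℝ 1 fun z => Y z i := contDiff_coord hY
  have hYic : ∀ i, HasCompactSupport fun z => Y z i := fun i =>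
    hYc.comp_left (g := fun v : Rn n => v i) rfl
  have hdi : ∀ i, Integrable fun x =>
      φ x * fderiv ℝ (fun z => Y z i) x (EuclideanSpace.single i 1) := fun i =>
    ((hφ.continuous).mul (((hYi i).continuous_fderiv one_ne_zero).clm_apply
      continuous_const)).integrable_of_hasCompactSupport
      ((hYic i).fderiv_apply (𝕜 := ℝ) _).mul_left
  have hgi : ∀ i, Integrable fun x => gradient φ x i * Y x i := by
    intro i
    refine ((hYi i).continuous.integrable_of_hasCompactSupport (hYic i)).bdd_mul (c := C)
      ?_ (Eventually.of_forall fun x => ?_)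
    · exact ((EuclideanSpace.proj i : Rn n →L[ℝ] ℝ).continuous.measurable.comp
        (measurable_gradient φ)).aestronglyMeasurable
    · refine (PiLp.norm_apply_le _ i).trans ?_
      rw [gradient, LinearIsometryEquiv.norm_map]
      exact norm_fderiv_le_of_lipschitz ℝ hφ
  have e1 : ∀ x, ⟪gradient φ x, Y x⟫ = ∑ i, gradient φ x i * Y x i := by
    intro x
    rw [PiLp.inner_apply]
    simp [mul_comm]
  have e2 : ∀ x, φ x * divergence Y x =
      ∑ i, φ x * fderiv ℝ (fun z => Y z i) x (EuclideanSpace.single i 1) := fun x => by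
    rw [divergence, Finset.mul_sum]
  simp_rw [e1, e2]
  rw [integral_finsetSum _ fun i _ => hgi i, integral_finsetSum _ fun i _ => hdi i,
    ← Finset.sum_neg_distrib]
  refine Finset.sum_congr rfl fun i _ => ?_
  obtain ⟨D, hD⟩ := ContDiff.lipschitzWith_of_hasCompactSupport (hYic i) (hYi i) one_ne_zero
  -- Each coordinate is Lipschitz integration by parts. The classical partial derivative agrees with
  -- the component of the gradient almost everywhere, by Rademacher.
  have h1 := hφ.integral_lineDeriv_mul_eq (μ := volume) hD (hYic i) (EuclideanSpace.single i 1)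
  have h2 : ∫ x, gradient φ x i * Y x i =
      ∫ x, lineDeriv ℝ φ x (EuclideanSpace.single i 1) * Y x i := by
    refine integral_congr_ae ?_
    filter_upwards [hφ.ae_differentiableAt] with x hx
    rw [hx.lineDeriv_eq_fderiv]
    congr 1
    have h3 : fderiv ℝ φ x (EuclideanSpace.single i 1) =
        ⟪gradient φ x, EuclideanSpace.single i (1 : ℝ)⟫ := by
      rw [gradient, InnerProductSpace.toDual_symm_apply]
    rw [h3, EuclideanSpace.inner_single_right]
    simp
  rw [h2, h1, ← integral_neg]
  congr 1 with x
  rw [((hYi i).differentiable one_ne_zero x).lineDeriv_eq_fderiv, map_neg]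
  ring

end

/-! ### Dilation and mollification in L² -/

section

open scoped Convolution
open ContinuousLinearMap (lsmul)

variable {n : ℕ} {F : Type*} [NormedAddCommGroup F]

theorem sq_eLpNorm_two {α : Type*} {m : MeasurableSpace α} {μ : Measure α} {E : Type*}
    [NormedAddCommGroup E] (f : α → E) : eLpNorm f 2 μ ^ 2 = ∫⁻ x, ‖f x‖ₑ ^ 2 ∂μ := by
  have h := eLpNorm_nnreal_pow_eq_lintegral (f := f) (μ := μ) (p := 2) two_ne_zero
  simpa using h

/-- The normalised bump is the density of a probability measure, so the L¹ norm of a translate is at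
most its L² norm for that measure; Tonelli and translation invariance finish. -/
theorem eLpNorm_convolution_normed_le [NormedSpace ℝ F] [CompleteSpace F]
    (φ : ContDiffBump (0 : Rn n))
    {f : Rn n → F} (hf : StronglyMeasurable f) :
    eLpNorm (φ.normed volume ⋆[lsmul ℝ ℝ, volume] f) 2 volume ≤ eLpNorm f 2 volume := by
  rw [← ENNReal.pow_le_pow_left_iff two_ne_zero, sq_eLpNorm_two, sq_eLpNorm_two]
  set η := φ.normed (volume : Measure (Rn n)) with hη
  have hηm : Measurable fun t => ENNReal.ofReal (η t) :=
    φ.continuous_normed.measurable.ennreal_ofReal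
  have hη1 : ∫⁻ t, ENNReal.ofReal (η t) = 1 := by
    rw [← ofReal_integral_eq_lintegral_ofReal φ.integrable_normed
      (Eventually.of_forall φ.nonneg_normed), φ.integral_normed, ENNReal.ofReal_one]
  set ν := (volume : Measure (Rn n)).withDensity fun t => ENNReal.ofReal (η t) with hν
  have : IsProbabilityMeasure ν := ⟨by
    rw [hν, withDensity_apply _ MeasurableSet.univ, Measure.restrict_univ, hη1]⟩
  have hfm : ∀ p : Rn n, StronglyMeasurable fun t => f (p - t) := fun p =>
    hf.comp_measurable (measurable_const.sub measurable_id)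
  have h1 : ∀ p, ‖(η ⋆[lsmul ℝ ℝ, volume] f) p‖ₑ ^ 2 ≤
      ∫⁻ t, ENNReal.ofReal (η t) * ‖f (p - t)‖ₑ ^ 2 := by
    intro p
    have e1 : ‖(η ⋆[lsmul ℝ ℝ, volume] f) p‖ₑ ≤ eLpNorm (fun t => f (p - t)) 1 ν := by
      rw [convolution_def, eLpNorm_one_eq_lintegral_enorm, hν,
        lintegral_withDensity_eq_lintegral_mul₀ hηm.aemeasurable (hfm p).enorm.aemeasurable]
      refine (enorm_integral_le_lintegral_enorm _).trans (le_of_eq ?_)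
      congr 1 with t
      rw [ContinuousLinearMap.lsmul_apply, enorm_smul, Pi.mul_apply,
        Real.enorm_of_nonneg (φ.nonneg_normed t)]
    have e2 := e1.trans (eLpNorm_le_eLpNorm_of_exponent_le (by norm_num : (1 : ENNReal) ≤ 2)
      (hfm p).aestronglyMeasurable)
    refine (pow_le_pow_left' e2 2).trans (le_of_eq ?_)
    rw [sq_eLpNorm_two, hν, lintegral_withDensity_eq_lintegral_mul₀ hηm.aemeasurable
      ((hfm p).enorm.pow_const 2).aemeasurable]
    rfl
  refine (lintegral_mono h1).trans ?_
  rw [lintegral_lintegral_swap]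
  · have h2 : ∀ t, ∫⁻ p, ENNReal.ofReal (η t) * ‖f (p - t)‖ₑ ^ 2 =
        ENNReal.ofReal (η t) * ∫⁻ p, ‖f p‖ₑ ^ 2 := by
      intro t
      rw [lintegral_const_mul' _ _ ENNReal.ofReal_ne_top,
        lintegral_sub_right_eq_self (fun p => ‖f p‖ₑ ^ 2) t]
    simp_rw [h2]
    rw [lintegral_mul_const _ hηm, hη1, one_mul]
  · refine Measurable.aemeasurable ?_
    exact (hηm.comp measurable_snd).mul
      ((hf.enorm.comp (measurable_fst.sub measurable_snd)).pow_const 2)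

/-- The change of variables costs l⁻ⁿ ≤ 2ⁿ. Only uniformity in l matters. -/
theorem eLpNorm_comp_dilation_le (c : Rn n) {l : ℝ} (hl : 1 / 2 ≤ l) {g : Rn n → F}
    (hg : AEStronglyMeasurable g volume) :
    eLpNorm (fun x => g (c + l • (x - c))) 2 volume ≤
      (2 ^ n : ENNReal) ^ (1 / 2 : ℝ) * eLpNorm g 2 volume := by
  have hl0 : 0 < l := by linarith
  have hm : Measure.map (fun x : Rn n => c + l • (x - c)) volume =
      ENNReal.ofReal |(l ^ n)⁻¹| • (volume : Measure (Rn n)) := by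
    have e : (fun x : Rn n => c + l • (x - c)) = (fun x => (c - l • c) + x) ∘ (fun x => l • x) := by
      funext x
      simp only [Function.comp, smul_sub]
      abel
    rw [e, ← Measure.map_map (by fun_prop) (by fun_prop), Measure.map_addHaar_smul _ hl0.ne',
      Measure.map_smul, map_add_left_eq_self, finrank_euclideanSpace_fin]
  have hac : AEStronglyMeasurable g (Measure.map (fun x : Rn n => c + l • (x - c)) volume) := by
    rw [hm]
    exact hg.mono_ac Measure.smul_absolutelyContinuous
  have h1 := eLpNorm_map_measure (p := 2) hac
    (by fun_prop : AEMeasurable (fun x : Rn n => c + l • (x - c)) volume)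
  rw [hm, eLpNorm_smul_measure_of_ne_top (by norm_num)] at h1
  change eLpNorm (g ∘ fun x => c + l • (x - c)) 2 volume ≤ _
  rw [← h1, smul_eq_mul]
  have e2 : (1 / (2 : ENNReal)).toReal = 1 / 2 := by simp
  rw [e2]
  gcongr
  rw [abs_of_pos (by positivity)]
  calc ENNReal.ofReal (l ^ n)⁻¹ ≤ ENNReal.ofReal (2 ^ n) := by
        apply ENNReal.ofReal_le_ofReal
        rw [← inv_pow]
        gcongr
        rw [inv_le_comm₀ hl0 (by norm_num)]
        linarith
    _ = 2 ^ n := by rw [ENNReal.ofReal_pow (by norm_num)]; simp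

/-- Dilating slightly and mollifying approximates an `L²` function on a bounded set. -/
theorem tendsto_eLpNorm_dilate_mollify [NormedSpace ℝ F] [CompleteSpace F] {Ω : Set (Rn n)}
    (hΩ : Bornology.IsBounded Ω) (hΩm : MeasurableSet Ω) (c : Rn n) {l : ℕ → ℝ}
    (hl : ∀ k, 1 / 2 ≤ l k)
    (hl1 : Tendsto l atTop (𝓝 1)) {φ : ℕ → ContDiffBump (0 : Rn n)}
    (hφ : Tendsto (fun k => (φ k).rOut) atTop (𝓝 0)) {f : Rn n → F} (hf : StronglyMeasurable f)
    (hf2 : MemLp f 2 volume) :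
    Tendsto (fun k => eLpNorm (fun x =>
      ((φ k).normed volume ⋆[lsmul ℝ ℝ, volume] f) (c + l k • (x - c)) - f x) 2
        (volume.restrict Ω)) atTop (𝓝 0) := by
  set A : ℕ → (Rn n → F) → Rn n → F := fun k f x =>
    ((φ k).normed volume ⋆[lsmul ℝ ℝ, volume] f) (c + l k • (x - c)) with hA
  set C : ENNReal := (2 ^ n : ENNReal) ^ (1 / 2 : ℝ) with hC
  have hCt : C ≠ ⊤ := ENNReal.rpow_ne_top_of_nonneg (by norm_num) (by finiteness)
  rw [ENNReal.tendsto_atTop_zero]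
  intro ε hε
  by_cases hεt : ε = ⊤
  · exact ⟨0, fun k _ => by rw [hεt]; exact le_top⟩
  -- The three terms are the operator applied to f - g, its error on a compactly supported
  -- continuous g, and g - f.
  obtain ⟨ε', hε'0, hε'⟩ : ∃ ε' : ENNReal, ε' ≠ 0 ∧ C * ε' + ε' + ε' ≤ ε := by
    refine ⟨ε / (C + 2), (ENNReal.div_pos hε.ne' (by finiteness)).ne', ?_⟩
    have : C * (ε / (C + 2)) + ε / (C + 2) + ε / (C + 2) = (C + 2) * (ε / (C + 2)) := by ring
    rw [this]
    exact ENNReal.mul_div_le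
  obtain ⟨g, hgc, hfg, hg, hg2⟩ := hf2.exists_hasCompactSupport_eLpNorm_sub_le (by norm_num) hε'0
  have hvol : volume Ω < ⊤ := hΩ.measure_lt_top
  obtain ⟨D, hD⟩ := hΩ.subset_closedBall c
  obtain ⟨δ, hδ0, hδ⟩ : ∃ δ : ℝ, 0 < δ ∧
      ENNReal.ofReal δ * volume Ω ^ (1 / 2 : ℝ) ≤ ε' := by
    by_cases hε't : ε' = ⊤
    · exact ⟨1, one_pos, by rw [hε't]; exact le_top⟩
    set V := volume Ω ^ (1 / 2 : ℝ) with hV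
    have hVt : V ≠ ⊤ := ENNReal.rpow_ne_top_of_nonneg (by norm_num) hvol.ne
    -- Adding 1 to V avoids division by zero when Ω is a null set.
    refine ⟨(ε' / (V + 1)).toReal, ENNReal.toReal_pos (ENNReal.div_pos hε'0 (by finiteness)).ne'
      (ENNReal.div_ne_top hε't (by simp)), ?_⟩
    rw [ENNReal.ofReal_toReal (ENNReal.div_ne_top hε't (by simp))]
    calc ε' / (V + 1) * V ≤ ε' / (V + 1) * (V + 1) := by gcongr; exact le_self_add
      _ ≤ ε' := by rw [mul_comm]; exact ENNReal.mul_div_le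
  have hunif : ∀ᶠ k in atTop, ∀ x ∈ Ω, ‖A k g x - g x‖ ≤ δ := by
    have huc : UniformContinuous g := hgc.uniformContinuous_of_continuous hg
    obtain ⟨ρ, hρ0, hρ⟩ := Metric.uniformContinuous_iff.1 huc (δ / 2) (by linarith)
    have h1 : ∀ᶠ k in atTop, (φ k).rOut < ρ := hφ.eventually (gt_mem_nhds hρ0)
    have h2 : ∀ᶠ k in atTop, |l k - 1| * D < ρ := by
      have : Tendsto (fun k => |l k - 1| * D) atTop (𝓝 (|1 - 1| * D)) :=
        ((hl1.sub_const 1).abs).mul_const D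
      rw [sub_self, abs_zero, zero_mul] at this
      exact this.eventually (gt_mem_nhds hρ0)
    filter_upwards [h1, h2] with k hk1 hk2 x hx
    have h3 : dist (A k g x) (g (c + l k • (x - c))) ≤ δ / 2 :=
      (φ k).dist_normed_convolution_le hg.aestronglyMeasurable fun z hz =>
        (hρ (lt_trans hz hk1)).le
    have h4 : dist (g (c + l k • (x - c))) (g x) ≤ δ / 2 := by
      refine (hρ ?_).le
      have e : c + l k • (x - c) - x = (l k - 1) • (x - c) := by rw [sub_smul, one_smul]; abel
      rw [dist_eq_norm, e, norm_smul, Real.norm_eq_abs]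
      have h5 : ‖x - c‖ ≤ D := by
        have := hD hx
        rwa [mem_closedBall_iff_norm] at this
      exact (mul_le_mul_of_nonneg_left h5 (abs_nonneg _)).trans_lt hk2
    rw [← dist_eq_norm]
    linarith [dist_triangle (A k g x) (g (c + l k • (x - c))) (g x)]
  rw [eventually_atTop] at hunif
  obtain ⟨k₀, hk₀⟩ := hunif
  refine ⟨k₀, fun k hk => ?_⟩
  have hgm : StronglyMeasurable g := hg.stronglyMeasurable
  have hloc : ∀ f : Rn n → F, MemLp f 2 volume → LocallyIntegrable f volume := fun f hf =>
    hf.locallyIntegrable (by norm_num)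
  have hcont : ∀ f : Rn n → F, MemLp f 2 volume →
      Continuous ((φ k).normed volume ⋆[lsmul ℝ ℝ, volume] f) := fun f hf =>
    (φ k).hasCompactSupport_normed.continuous_convolution_left _ (φ k).continuous_normed (hloc f hf)
  have hcA : ∀ f : Rn n → F, MemLp f 2 volume → Continuous (A k f) := fun f hf =>
    (hcont f hf).comp (by fun_prop)
  have hsplit : (fun x => A k f x - f x) =
      (A k (f - g)) + ((fun x => A k g x - g x) + fun x => g x - f x) := by
    funext x
    have hce : ∀ f : Rn n → F, MemLp f 2 volume → ConvolutionExists ((φ k).normed volume) f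
        (lsmul ℝ ℝ) volume := fun f hf =>
      (φ k).hasCompactSupport_normed.convolutionExists_left _ (φ k).continuous_normed (hloc f hf)
    have h1 : A k f x = A k (f - g) x + A k g x := by
      have h2 := (hce _ (hf2.sub hg2)).distrib_add (hce _ hg2)
      rw [sub_add_cancel] at h2
      exact congrFun h2 _
    simp only [Pi.add_apply, h1]
    abel
  change eLpNorm (fun x => A k f x - f x) 2 (volume.restrict Ω) ≤ ε
  rw [hsplit]
  refine (eLpNorm_add_le (hcA _ (hf2.sub hg2)).aestronglyMeasurable
    (((hcA _ hg2).sub hg).aestronglyMeasurable.add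
      (hgm.sub hf).aestronglyMeasurable) (by norm_num)).trans ?_
  refine (add_le_add_right (eLpNorm_add_le ((hcA _ hg2).sub hg).aestronglyMeasurable
    (hgm.sub hf).aestronglyMeasurable (by norm_num)) _).trans ?_
  have b1 : eLpNorm (A k (f - g)) 2 (volume.restrict Ω) ≤ C * ε' := by
    refine (eLpNorm_mono_measure _ Measure.restrict_le_self).trans ?_
    refine (eLpNorm_comp_dilation_le c (hl k)
      (hcont _ (hf2.sub hg2)).aestronglyMeasurable).trans ?_
    gcongr
    exact (eLpNorm_convolution_normed_le _ (hf.sub hgm)).trans hfg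
  have b2 : eLpNorm (fun x => A k g x - g x) 2 (volume.restrict Ω) ≤ ε' := by
    have h1 := hk₀ k hk
    have h2 : ∀ᵐ x ∂(volume.restrict Ω), ‖A k g x - g x‖ ≤ δ := by
      exact (ae_restrict_iff' hΩm).2 (Eventually.of_forall h1)
    have h3 := eLpNorm_le_of_ae_bound (p := 2) h2
    refine h3.trans (le_trans (le_of_eq ?_) hδ)
    rw [Measure.restrict_apply_univ, mul_comm]
    simp
  have b3 : eLpNorm (fun x => g x - f x) 2 (volume.restrict Ω) ≤ ε' := by
    refine (eLpNorm_mono_measure _ Measure.restrict_le_self).trans ?_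
    have : (fun x => g x - f x) = g - f := rfl
    rw [this, eLpNorm_sub_comm]
    exact hfg
  refine (add_le_add b1 (add_le_add b2 b3)).trans ?_
  rw [← add_assoc]
  exact hε'

end

/-! ### Density of smooth functions in H¹ of a convex set -/

section

open scoped Convolution
open ContinuousLinearMap (lsmul)

variable {n : ℕ} {Ω : Set (Rn n)}

/-- The reflected bump s ↦ η(p - s) is supported in Ω, hence is an admissible test function, and the
weak gradient identity for it is the claim. Extension by zero does no harm as long as the ball
around p stays inside Ω. -/
theorem gradient_convolution_indicator (hΩ : IsOpen Ω) (u : H1 Ω) (φ : ContDiffBump (0 : Rn n))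
    {p : Rn n} (hp : Metric.closedBall p φ.rOut ⊆ Ω) :
    HasGradientAt (φ.normed volume ⋆[lsmul ℝ ℝ, volume] Ω.indicator u.fn)
      ((φ.normed volume ⋆[lsmul ℝ ℝ, volume] Ω.indicator u.grad) p) p := by
  set η := φ.normed (volume : Measure (Rn n)) with hη
  have hηs : ContDiff ℝ ∞ η := φ.contDiff_normed
  have hu2 : MemLp (Ω.indicator u.fn) 2 volume :=
    (memLp_indicator_iff_restrict hΩ.measurableSet).2 (Lp.memLp u.fn)
  have hG2 : MemLp (Ω.indicator u.grad) 2 volume :=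
    (memLp_indicator_iff_restrict hΩ.measurableSet).2 (Lp.memLp u.grad)
  have hul : LocallyIntegrable (Ω.indicator u.fn) volume := hu2.locallyIntegrable (by norm_num)
  have hGl : LocallyIntegrable (Ω.indicator u.grad) volume := hG2.locallyIntegrable (by norm_num)
  have hd := φ.hasCompactSupport_normed.hasFDerivAt_convolution_left (lsmul ℝ ℝ)
    (hηs.of_le (by simp)) hul p (μ := volume)
  rw [hasGradientAt_iff_hasFDerivAt]
  refine hd.congr_fderiv (Eq.symm ?_)
  refine ContinuousLinearMap.ext_on (s := range fun i : Fin n => EuclideanSpace.single i (1 : ℝ))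
    ?_ ?_
  · have h1 := (EuclideanSpace.basisFun (Fin n) ℝ).toBasis.span_eq
    have h2 : range (EuclideanSpace.basisFun (Fin n) ℝ).toBasis =
        range fun i : Fin n => EuclideanSpace.single i (1 : ℝ) := by
      congr 1
      funext i
      simp
    rw [h2] at h1
    rw [h1]
    exact dense_univ
  rintro _ ⟨i, rfl⟩
  simp only [InnerProductSpace.toDual_apply_apply]
  rw [EuclideanSpace.inner_single_right]
  simp only [one_mul, conj_trivial]
  set ψ : Rn n → ℝ := fun s => η (p - s) with hψ
  have hψs : ContDiff ℝ ∞ ψ := hηs.comp (contDiff_const.sub contDiff_id)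
  have hψt : tsupport ψ ⊆ Metric.closedBall p φ.rOut := by
    refine closure_minimal (fun s hs => ?_) Metric.isClosed_closedBall
    have h1 : p - s ∈ Function.support η := hs
    rw [φ.support_normed_eq, mem_ball_zero_iff] at h1
    rw [mem_closedBall_iff_norm, norm_sub_rev]
    exact h1.le
  have hψc : HasCompactSupport ψ :=
    (isCompact_closedBall p φ.rOut).of_isClosed_subset (isClosed_tsupport _) hψt
  have hψd : ∀ s, fderiv ℝ ψ s (EuclideanSpace.single i 1) =
      -fderiv ℝ η (p - s) (EuclideanSpace.single i 1) := by
    intro s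
    have h1 : HasFDerivAt (fun s : Rn n => p - s) (-ContinuousLinearMap.id ℝ (Rn n)) s :=
      (hasFDerivAt_id s).const_sub p
    have h2 := ((hηs.differentiable (by simp)) (p - s)).hasFDerivAt.comp s h1
    rw [show fderiv ℝ ψ s = _ from h2.fderiv]
    simp
  have hw := u.2 ψ hψs hψc (hψt.trans hp) i
  have hindu : ∀ (f : Rn n → ℝ), ∫ s, f s * Ω.indicator u.fn s = ∫ s in Ω, u.fn s * f s := by
    intro f
    rw [← integral_indicator hΩ.measurableSet]
    congr 1 with s
    by_cases hs : s ∈ Ω <;> simp [hs, mul_comm]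
  have eR : (((fderiv ℝ η) ⋆[(lsmul ℝ ℝ).precompL (Rn n), volume] Ω.indicator u.fn) p)
      (EuclideanSpace.single i 1) =
      -∫ s in Ω, u.fn s * fderiv ℝ ψ s (EuclideanSpace.single i 1) := by
    have hce := (φ.hasCompactSupport_normed.fderiv (𝕜 := ℝ)).convolutionExists_left
      ((lsmul ℝ ℝ).precompL (Rn n)) (hηs.continuous_fderiv (by simp)) hul p (μ := volume)
    rw [convolution_def, ContinuousLinearMap.integral_apply hce]
    have e1 : ∀ t, ((lsmul ℝ ℝ).precompL (Rn n) (fderiv ℝ η t) (Ω.indicator u.fn (p - t)))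
        (EuclideanSpace.single i 1) =
        fderiv ℝ η t (EuclideanSpace.single i 1) * Ω.indicator u.fn (p - t) := fun t => rfl
    refine (integral_congr_ae (Eventually.of_forall e1)).trans ?_
    rw [← integral_sub_left_eq_self _ volume p]
    simp only [sub_sub_cancel]
    rw [hindu, ← integral_neg]
    congr 1 with s
    rw [hψd]
    ring
  have eL : ((η ⋆[lsmul ℝ ℝ, volume] Ω.indicator u.grad) p) i = ∫ s in Ω, u.grad s i * ψ s := by
    have hce : Integrable (fun t => (lsmul ℝ ℝ) (η t) (Ω.indicator u.grad (p - t))) volume :=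
      φ.hasCompactSupport_normed.convolutionExists_left
        (lsmul ℝ ℝ) φ.continuous_normed hGl p (μ := volume)
    have h1 := (EuclideanSpace.proj i : Rn n →L[ℝ] ℝ).integral_comp_comm hce
    have h2 : ((η ⋆[lsmul ℝ ℝ, volume] Ω.indicator u.grad) p) i =
        ∫ t, η t * Ω.indicator u.grad (p - t) i := h1.symm
    rw [h2, ← integral_sub_left_eq_self _ volume p]
    simp only [sub_sub_cancel]
    rw [← integral_indicator hΩ.measurableSet]
    congr 1 with s
    by_cases hs : s ∈ Ω <;> simp [hs, mul_comm, hψ]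
  rw [eR, eL]
  change ∫ s in Ω, u.fn s * fderiv ℝ ψ s (EuclideanSpace.single i 1) =
    -∫ s in Ω, u.grad s i * ψ s at hw
  rw [hw, neg_neg]

/-- Smooth functions on the whole space are dense in `H¹` of a bounded convex open set. -/
theorem H1.exists_smooth_approx (hΩ : IsOpen Ω) (hconv : Convex ℝ Ω)
    (hb : Bornology.IsBounded Ω) (hne : Ω.Nonempty) (u : H1 Ω) :
    ∃ ψ : ℕ → Rn n → ℝ, (∀ k, ContDiff ℝ ∞ (ψ k)) ∧
      Tendsto (fun k => eLpNorm (fun x => ψ k x - u.fn x) 2 (volume.restrict Ω)) atTop (𝓝 0) ∧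
      Tendsto (fun k => eLpNorm (fun x => gradient (ψ k) x - u.grad x) 2 (volume.restrict Ω))
        atTop (𝓝 0) := by
  obtain ⟨c, hc⟩ := hne
  obtain ⟨ρ, hρ, hρΩ⟩ := Metric.isOpen_iff.1 hΩ c hc
  set l : ℕ → ℝ := fun k => 1 - 1 / ((k : ℝ) + 2) with hl
  have hk2 : ∀ k : ℕ, (0 : ℝ) < 1 / ((k : ℝ) + 2) := fun k => by positivity
  have hl2 : ∀ k, 1 / 2 ≤ l k := by
    intro k
    have : 1 / ((k : ℝ) + 2) ≤ 1 / 2 := one_div_le_one_div_of_le (by norm_num) (by simp)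
    simp only [hl]; linarith
  have hlim : Tendsto (fun k : ℕ => 1 / ((k : ℝ) + 2)) atTop (𝓝 0) := by
    have h1 : Tendsto (fun k : ℕ => (k : ℝ) + 2) atTop atTop :=
      tendsto_atTop_add_const_right _ _ tendsto_natCast_atTop_atTop
    simp_rw [one_div]
    exact h1.inv_tendsto_atTop
  have hl1 : Tendsto l atTop (𝓝 1) := by
    have := hlim.const_sub 1
    rwa [sub_zero] at this
  set φ : ℕ → ContDiffBump (0 : Rn n) := fun k =>
    ⟨1 / ((k : ℝ) + 2) * (ρ / 4), 1 / ((k : ℝ) + 2) * (ρ / 2), by positivity,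
      mul_lt_mul_of_pos_left (by linarith) (hk2 k)⟩ with hφ
  have hφ0 : Tendsto (fun k => (φ k).rOut) atTop (𝓝 0) := by
    have := hlim.mul_const (ρ / 2)
    rwa [zero_mul] at this
  -- Shrinking towards c by the factor 1 - s makes room for a ball of radius sρ/2: any point of it
  -- is (1 - s) x + s z' with z' within ρ/2 of c, and Ω is convex.
  have hball : ∀ k, ∀ x ∈ Ω, Metric.closedBall (c + l k • (x - c)) (φ k).rOut ⊆ Ω := by
    intro k x hx z hz
    set s := 1 / ((k : ℝ) + 2) with hs
    have hs0 : 0 < s := hk2 k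
    have hs1 : 1 / 2 ≤ 1 - s := hl2 k
    set z' : Rn n := c + s⁻¹ • (z - (c + l k • (x - c))) with hz'
    have hz'Ω : z' ∈ Ω := by
      apply hρΩ
      rw [mem_closedBall_iff_norm] at hz
      rw [mem_ball_iff_norm, hz', add_sub_cancel_left, norm_smul, norm_inv,
        Real.norm_of_nonneg hs0.le]
      have h1 : (φ k).rOut = s * (ρ / 2) := rfl
      rw [h1] at hz
      calc s⁻¹ * ‖z - (c + l k • (x - c))‖ ≤ s⁻¹ * (s * (ρ / 2)) := by gcongr
        _ = ρ / 2 := by field_simp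
        _ < ρ := by linarith
    have hcomb := hconv hx hz'Ω (a := 1 - s) (b := s) (by linarith) hs0.le (by ring)
    convert hcomb using 1
    have h2 : s • z' = s • c + (z - (c + l k • (x - c))) := by
      rw [hz', smul_add, smul_smul, mul_inv_cancel₀ hs0.ne', one_smul]
    have h3 : l k = 1 - s := rfl
    rw [h2, h3]
    module
  have hul : LocallyIntegrable (Ω.indicator u.fn) volume :=
    ((memLp_indicator_iff_restrict hΩ.measurableSet).2 (Lp.memLp u.fn)).locallyIntegrable
      (by norm_num)
  have hau := tendsto_eLpNorm_dilate_mollify hb hΩ.measurableSet c hl2 hl1 hφ0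
    ((Lp.stronglyMeasurable u.fn).indicator hΩ.measurableSet)
    ((memLp_indicator_iff_restrict hΩ.measurableSet).2 (Lp.memLp u.fn))
  have hag := tendsto_eLpNorm_dilate_mollify hb hΩ.measurableSet c hl2 hl1 hφ0
    ((Lp.stronglyMeasurable u.grad).indicator hΩ.measurableSet)
    ((memLp_indicator_iff_restrict hΩ.measurableSet).2 (Lp.memLp u.grad))
  have hin : ∀ᵐ x ∂(volume.restrict Ω), x ∈ Ω := ae_restrict_mem hΩ.measurableSet
  refine ⟨fun k x => ((φ k).normed volume ⋆[lsmul ℝ ℝ, volume] Ω.indicator u.fn)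
    (c + l k • (x - c)), fun k => ?_, ?_, ?_⟩
  · have h1 : ContDiff ℝ ∞ ((φ k).normed volume ⋆[lsmul ℝ ℝ, volume] Ω.indicator u.fn) :=
      (φ k).hasCompactSupport_normed.contDiff_convolution_left _ (φ k).contDiff_normed hul
    exact h1.comp (by fun_prop)
  · refine hau.congr fun k => eLpNorm_congr_ae ?_
    filter_upwards [hin] with x hx
    rw [indicator_of_mem hx]
  · have hgrad : ∀ k, ∀ x ∈ Ω, gradient (fun x =>
        ((φ k).normed volume ⋆[lsmul ℝ ℝ, volume] Ω.indicator u.fn) (c + l k • (x - c))) x =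
        l k • ((φ k).normed volume ⋆[lsmul ℝ ℝ, volume] Ω.indicator u.grad)
          (c + l k • (x - c)) := by
      intro k x hx
      have h1 := gradient_convolution_indicator hΩ u (φ k) (hball k x hx)
      have h2 : HasFDerivAt (fun x : Rn n => c + l k • (x - c))
          (l k • ContinuousLinearMap.id ℝ (Rn n)) x :=
        (((hasFDerivAt_id x).sub_const c).const_smul (l k)).const_add c
      have h3 := h1.hasFDerivAt.comp x h2
      refine HasGradientAt.gradient ?_
      rw [hasGradientAt_iff_hasFDerivAt]
      refine h3.congr_fderiv ?_
      ext v
      simp [InnerProductSpace.toDual_apply_apply]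
    have hbound : ∀ k, eLpNorm (fun x => gradient (fun x =>
        ((φ k).normed volume ⋆[lsmul ℝ ℝ, volume] Ω.indicator u.fn) (c + l k • (x - c))) x -
          u.grad x) 2 (volume.restrict Ω) ≤
        eLpNorm (fun x => ((φ k).normed volume ⋆[lsmul ℝ ℝ, volume] Ω.indicator u.grad)
          (c + l k • (x - c)) - Ω.indicator u.grad x) 2 (volume.restrict Ω) +
          ENNReal.ofReal (1 / ((k : ℝ) + 2)) * eLpNorm u.grad 2 (volume.restrict Ω) := by
      intro k
      have hcG : Continuous fun x => ((φ k).normed volume ⋆[lsmul ℝ ℝ, volume]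
          Ω.indicator u.grad) (c + l k • (x - c)) := by
        have h1 : Continuous ((φ k).normed volume ⋆[lsmul ℝ ℝ, volume] Ω.indicator u.grad) :=
          (φ k).hasCompactSupport_normed.continuous_convolution_left _ (φ k).continuous_normed
            (((memLp_indicator_iff_restrict hΩ.measurableSet).2
              (Lp.memLp u.grad)).locallyIntegrable (by norm_num))
        exact h1.comp (by fun_prop)
      have hm : AEStronglyMeasurable (fun x => ((φ k).normed volume ⋆[lsmul ℝ ℝ, volume]
          Ω.indicator u.grad) (c + l k • (x - c)) - Ω.indicator u.grad x)
          (volume.restrict Ω) :=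
        hcG.aestronglyMeasurable.sub
          ((Lp.stronglyMeasurable u.grad).indicator hΩ.measurableSet).aestronglyMeasurable
      -- The chain rule produces the factor l, so besides the mollification error there is the
      -- vanishing term (l - 1) ∇u.
      have e1 : (fun x => gradient (fun x => ((φ k).normed volume ⋆[lsmul ℝ ℝ, volume]
          Ω.indicator u.fn) (c + l k • (x - c))) x - u.grad x) =ᵐ[volume.restrict Ω]
          (l k • fun x => ((φ k).normed volume ⋆[lsmul ℝ ℝ, volume] Ω.indicator u.grad)
            (c + l k • (x - c)) - Ω.indicator u.grad x) + (-(1 / ((k : ℝ) + 2))) • ⇑u.grad := by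
        filter_upwards [hin] with x hx
        rw [hgrad k x hx]
        simp only [Pi.add_apply, Pi.smul_apply, indicator_of_mem hx, hl]
        module
      rw [eLpNorm_congr_ae e1]
      refine (eLpNorm_add_le (hm.const_smul _)
        ((Lp.aestronglyMeasurable u.grad).const_smul _) (by norm_num)).trans ?_
      rw [eLpNorm_const_smul, eLpNorm_const_smul, enorm_neg, Real.enorm_of_nonneg (hk2 k).le]
      gcongr
      have h1 : ‖l k‖ₑ ≤ 1 := by
        rw [Real.enorm_of_nonneg (by linarith [hl2 k]), ← ENNReal.ofReal_one]
        refine ENNReal.ofReal_le_ofReal ?_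
        have := hk2 k
        simp only [hl]; linarith
      calc _ ≤ 1 * eLpNorm (fun x => ((φ k).normed volume ⋆[lsmul ℝ ℝ, volume]
            Ω.indicator u.grad) (c + l k • (x - c)) - Ω.indicator u.grad x) 2
            (volume.restrict Ω) := by gcongr
        _ = _ := one_mul _
    refine tendsto_of_tendsto_of_tendsto_of_le_of_le tendsto_const_nhds ?_ (fun k => zero_le)
      hbound
    have h1 : Tendsto (fun k : ℕ => ENNReal.ofReal (1 / ((k : ℝ) + 2)) *
        eLpNorm u.grad 2 (volume.restrict Ω)) atTop (𝓝 0) := by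
      have h2 := ENNReal.Tendsto.mul_const (ENNReal.tendsto_ofReal hlim)
        (b := eLpNorm u.grad 2 (volume.restrict Ω)) (Or.inr (Lp.memLp u.grad).2.ne)
      simpa using h2
    simpa using hag.add h1

end

/-! ### Multiplication by bounded weights and completeness of H¹ -/

section

section WeightedMaps

variable {α : Type*} {m : MeasurableSpace α} {μ : Measure α} {V E F : Type*}
  [NormedAddCommGroup V] [NormedSpace ℝ V] [NormedAddCommGroup E] [NormedSpace ℝ E]
  [NormedAddCommGroup F] [NormedSpace ℝ F]

open Classical in
/-- The operator `f ↦ B (W x) (f x)` on `L²`, for a bounded measurable weight `W` (and `0` for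
other `W`). -/
def weightedMap (μ : Measure α) (B : V →L[ℝ] E →L[ℝ] F) (W : α → V) :
    Lp E 2 μ →L[ℝ] Lp F 2 μ :=
  if h : MemLp W ⊤ μ then B.holderL μ ⊤ 2 2 h.toLp else 0

theorem coeFn_weightedMap (B : V →L[ℝ] E →L[ℝ] F) {W : α → V} (hW : MemLp W ⊤ μ) (f : Lp E 2 μ) :
    weightedMap μ B W f =ᵐ[μ] fun x => B (W x) (f x) := by
  have h0 : weightedMap μ B W f = B.holder 2 hW.toLp f := by
    rw [weightedMap, dif_pos hW]
    rfl
  rw [h0]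
  filter_upwards [B.coeFn_holder (r := 2) hW.toLp f, hW.coeFn_toLp] with x h1 h2
  rw [h1, h2]

/-- Dominated convergence for weighted operators applied to a fixed function. -/
theorem tendsto_weightedMap (B : V →L[ℝ] E →L[ℝ] F) {W : ℕ → α → V} {W₀ : α → V}
    (hWm : ∀ k, AEStronglyMeasurable (W k) μ) (hW₀m : AEStronglyMeasurable W₀ μ) {C : ℝ}
    (hW : ∀ k, ∀ᵐ x ∂μ, ‖W k x‖ ≤ C) (hW₀ : ∀ᵐ x ∂μ, ‖W₀ x‖ ≤ C)
    (hlim : ∀ᵐ x ∂μ, Tendsto (fun k => W k x) atTop (𝓝 (W₀ x))) (f : Lp E 2 μ) :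
    Tendsto (fun k => weightedMap μ B (W k) f) atTop (𝓝 (weightedMap μ B W₀ f)) := by
  have hk : ∀ k, MemLp (W k) ⊤ μ := fun k => memLp_top_of_bound (hWm k) C (hW k)
  have h0 : MemLp W₀ ⊤ μ := memLp_top_of_bound hW₀m C hW₀
  rw [Lp.tendsto_Lp_iff_tendsto_eLpNorm']
  have hf2 : ∫⁻ x, ‖f x‖ₑ ^ 2 ∂μ ≠ ⊤ := by
    rw [← sq_eLpNorm_two]
    exact ENNReal.pow_ne_top (Lp.memLp f).2.ne
  have h1 : Tendsto (fun k => ∫⁻ x, ‖B (W k x) (f x) - B (W₀ x) (f x)‖ₑ ^ 2 ∂μ) atTop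
      (𝓝 (∫⁻ _, 0 ∂μ)) := by
    refine tendsto_lintegral_of_dominated_convergence'
      (fun x => ENNReal.ofReal (‖B‖ * (2 * C)) ^ 2 * ‖f x‖ₑ ^ 2) (fun k => ?_) (fun k => ?_) ?_ ?_
    · have hm : ∀ {Z : α → V}, MemLp Z ⊤ μ →
          AEStronglyMeasurable (fun x => B (Z x) (f x)) μ := fun hZ =>
        (B.memLp_of_bilin 2 hZ (Lp.memLp f)).1
      exact ((hm (hk k)).sub (hm h0)).enorm.pow_const 2
    · filter_upwards [hW k, hW₀] with x hx hx0
      rw [← mul_pow]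
      gcongr
      have hC : 0 ≤ C := (norm_nonneg _).trans hx
      have h2 : ‖B (W k x) (f x) - B (W₀ x) (f x)‖ ≤ ‖B‖ * (2 * C) * ‖f x‖ := by
        rw [← sub_apply, ← map_sub]
        refine (B.le_opNorm₂ _ _).trans ?_
        gcongr
        refine (norm_sub_le _ _).trans ?_
        linarith
      rw [← ofReal_norm, ← ofReal_norm, ← ENNReal.ofReal_mul (by positivity)]
      exact ENNReal.ofReal_le_ofReal h2
    · rw [lintegral_const_mul'' _ ((Lp.aestronglyMeasurable f).enorm.pow_const 2)]
      exact ENNReal.mul_ne_top (by finiteness) hf2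
    · filter_upwards [hlim] with x hx
      have h2 : Tendsto (fun k => B (W k x) (f x) - B (W₀ x) (f x)) atTop (𝓝 0) := by
        rw [tendsto_sub_nhds_zero_iff]
        exact (((B.flip (f x)).continuous.tendsto _).comp hx)
      have h3 := (continuous_enorm.tendsto _).comp h2
      rw [enorm_zero] at h3
      have h4 := ((ENNReal.continuous_pow 2).tendsto _).comp h3
      simpa [Function.comp_def] using h4
  rw [lintegral_zero] at h1
  have h2 : Tendsto (fun k => eLpNorm (fun x => B (W k x) (f x) - B (W₀ x) (f x)) 2 μ ^ 2) atTop
      (𝓝 0) := by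
    simp_rw [sq_eLpNorm_two]
    exact h1
  have h3 := ((ENNReal.continuous_rpow_const (y := (1 / 2 : ℝ))).tendsto _).comp h2
  have h4 : ∀ a : ENNReal, (a ^ 2) ^ (1 / 2 : ℝ) = a := fun a => by
    rw [← ENNReal.rpow_natCast, ← ENNReal.rpow_mul]
    norm_num
  rw [ENNReal.zero_rpow_of_pos (by norm_num)] at h3
  refine h3.congr fun k => ?_
  rw [Function.comp_apply, h4]
  refine eLpNorm_congr_ae ?_
  filter_upwards [coeFn_weightedMap B (hk k) f, coeFn_weightedMap B h0 f] with x hx hx0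
  rw [Pi.sub_apply, hx, hx0]

end WeightedMaps

variable {n : ℕ} {Ω : Set (Rn n)}

theorem continuous_setIntegral_mul {f : Rn n → ℝ} (hf : MemLp f 2 (volume.restrict Ω)) :
    Continuous fun u : L2 Ω => ∫ x in Ω, u x * f x := by
  have h : (fun u : L2 Ω => ∫ x in Ω, u x * f x) = fun u => ⟪hf.toLp f, u⟫ := by
    funext u
    rw [L2.inner_def]
    refine integral_congr_ae ?_
    filter_upwards [hf.coeFn_toLp] with x hx
    simp [hx]
  rw [h]
  fun_prop

theorem continuous_setIntegral_coord_mul {f : Rn n → ℝ} (hf : MemLp f 2 (volume.restrict Ω))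
    (i : Fin n) : Continuous fun G : L2Vec Ω => ∫ x in Ω, G x i * f x := by
  have hf' : MemLp (fun x => f x • (EuclideanSpace.single i (1 : ℝ) : Rn n)) 2
      (volume.restrict Ω) :=
    (ContinuousLinearMap.toSpanSingleton ℝ (EuclideanSpace.single i (1 : ℝ) : Rn n)).comp_memLp' hf
  have h : (fun G : L2Vec Ω => ∫ x in Ω, G x i * f x) = fun G => ⟪hf'.toLp _, G⟫ := by
    funext G
    rw [L2.inner_def]
    refine integral_congr_ae ?_
    filter_upwards [hf'.coeFn_toLp] with x hx
    rw [hx, real_inner_smul_left, EuclideanSpace.inner_single_left]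
    simp [mul_comm]
  rw [h]
  fun_prop

/-- For fixed ψ and i the defining identity is an equality of continuous functionals of (u, ∇u).
Closedness makes H¹ a Hilbert space, as Lax–Milgram requires. -/
theorem isClosed_H1Submodule (Ω : Set (Rn n)) :
    IsClosed (H1Submodule Ω : Set (WithLp 2 (L2 Ω × L2Vec Ω))) := by
  have h : (H1Submodule Ω : Set (WithLp 2 (L2 Ω × L2Vec Ω))) =
      ⋂ (ψ : Rn n → ℝ) (_ : ContDiff ℝ ∞ ψ) (_ : HasCompactSupport ψ) (_ : tsupport ψ ⊆ Ω)
        (i : Fin n), {w | ∫ x in Ω, w.fst x * fderiv ℝ ψ x (EuclideanSpace.single i 1) =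
          -∫ x in Ω, w.snd x i * ψ x} := by
    ext w
    simp only [mem_iInter]
    exact Iff.rfl
  rw [h]
  refine isClosed_iInter fun ψ => isClosed_iInter fun hψ => isClosed_iInter fun hs =>
    isClosed_iInter fun _ => isClosed_iInter fun i => ?_
  refine isClosed_eq ?_ ?_
  · exact (continuous_setIntegral_mul ((continuous_partial hψ _).memLp_of_hasCompactSupport
      (hasCompactSupport_partial hs _))).comp (WithLp.fstL 2 ℝ (L2 Ω) (L2Vec Ω)).continuous
  · exact ((continuous_setIntegral_coord_mul (hψ.continuous.memLp_of_hasCompactSupport hs)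
      i).comp (WithLp.sndL 2 ℝ (L2 Ω) (L2Vec Ω)).continuous).neg

instance (Ω : Set (Rn n)) : CompleteSpace (H1 Ω) :=
  (isClosed_H1Submodule Ω).completeSpace_coe

/-- The embedding of `H¹(Ω)` in `L²(Ω)`. -/
def H1.fnL (Ω : Set (Rn n)) : H1 Ω →L[ℝ] L2 Ω :=
  (WithLp.fstL 2 ℝ (L2 Ω) (L2Vec Ω)) ∘L (H1Submodule Ω).subtypeL

/-- The weak gradient as a continuous linear map. -/
def H1.gradL (Ω : Set (Rn n)) : H1 Ω →L[ℝ] L2Vec Ω :=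
  (WithLp.sndL 2 ℝ (L2 Ω) (L2Vec Ω)) ∘L (H1Submodule Ω).subtypeL

theorem H1.norm_sq_eq (u : H1 Ω) : ‖u‖ ^ 2 = ‖u.fn‖ ^ 2 + ‖u.grad‖ ^ 2 :=
  WithLp.prod_norm_sq_eq_of_L2 u.1

end

/-! ### The energy form: Lax–Milgram and stability -/

section

variable {n : ℕ} {Ω : Set (Rn n)}

/-- The real inner product as a continuous bilinear form. -/
def innerForm (H : Type*) [NormedAddCommGroup H] [InnerProductSpace ℝ H] : H →L[ℝ] H →L[ℝ] ℝ :=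
  (isBoundedBilinearMap_inner (𝕜 := ℝ) (E := H)).toContinuousLinearMap

theorem innerForm_apply {H : Type*} [NormedAddCommGroup H] [InnerProductSpace ℝ H] (x y : H) :
    innerForm H x y = ⟪x, y⟫ := rfl

/-- Multiplication of square integrable functions by a bounded measurable function. -/
abbrev mulMap {E : Type*} [NormedAddCommGroup E] [NormedSpace ℝ E] (Ω : Set (Rn n))
    (s : Rn n → ℝ) :
    Lp E 2 ((volume : Measure (Rn n)).restrict Ω) →L[ℝ]
      Lp E 2 ((volume : Measure (Rn n)).restrict Ω) :=
  weightedMap (volume.restrict Ω) (ContinuousLinearMap.lsmul ℝ ℝ) s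

theorem coeFn_mulMap {E : Type*} [NormedAddCommGroup E] [NormedSpace ℝ E] {s : Rn n → ℝ}
    (hs : MemLp s ⊤ (volume.restrict Ω)) (f : Lp E 2 ((volume : Measure (Rn n)).restrict Ω)) :
    mulMap Ω s f =ᵐ[volume.restrict Ω] fun x => s x • f x :=
  coeFn_weightedMap _ hs f

/-- The energy form `∫_Ω (D ∇u·∇v + c u v)`. -/
def energy (Ω : Set (Rn n)) (D c : Rn n → ℝ) : H1 Ω →L[ℝ] H1 Ω →L[ℝ] ℝ :=
  (innerForm (L2Vec Ω)).bilinearComp (mulMap Ω D ∘L H1.gradL Ω) (H1.gradL Ω) +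
    (innerForm (L2 Ω)).bilinearComp (mulMap Ω c ∘L H1.fnL Ω) (H1.fnL Ω)

theorem energy_apply (D c : Rn n → ℝ) (u v : H1 Ω) :
    energy Ω D c u v = ⟪mulMap Ω D u.grad, v.grad⟫ + ⟪mulMap Ω c u.fn, v.fn⟫ := rfl

theorem inner_mulMap {E : Type*} [NormedAddCommGroup E] [InnerProductSpace ℝ E] {s : Rn n → ℝ}
    (hs : MemLp s ⊤ (volume.restrict Ω)) (f g : Lp E 2 ((volume : Measure (Rn n)).restrict Ω)) :
    ⟪mulMap Ω s f, g⟫ = ∫ x in Ω, s x * ⟪f x, g x⟫ := by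
  rw [L2.inner_def]
  refine integral_congr_ae ?_
  filter_upwards [coeFn_mulMap hs f] with x hx
  rw [hx, real_inner_smul_left]

theorem integrable_mul_inner {E : Type*} [NormedAddCommGroup E] [InnerProductSpace ℝ E]
    {s : Rn n → ℝ} (hs : MemLp s ⊤ (volume.restrict Ω))
    (f g : Lp E 2 ((volume : Measure (Rn n)).restrict Ω)) :
    Integrable (fun x => s x * ⟪f x, g x⟫) (volume.restrict Ω) := by
  refine (L2.integrable_inner (𝕜 := ℝ) (mulMap Ω s f) g).congr ?_
  filter_upwards [coeFn_mulMap hs f] with x hx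
  rw [hx, real_inner_smul_left]

theorem energy_eq_integral {D c : Rn n → ℝ} (hD : MemLp D ⊤ (volume.restrict Ω))
    (hc : MemLp c ⊤ (volume.restrict Ω)) (u v : H1 Ω) :
    energy Ω D c u v = ∫ x in Ω, (D x * ⟪u.grad x, v.grad x⟫ + c x * u.fn x * v.fn x) := by
  have h : ∀ x, c x * u.fn x * v.fn x = c x * ⟪u.fn x, v.fn x⟫ := fun x => by
    rw [real_inner_eq_re_inner]
    simp only [RCLike.inner_apply, conj_trivial, RCLike.re_to_real]
    ring
  simp_rw [h]
  rw [integral_add (integrable_mul_inner hD _ _) (integrable_mul_inner hc _ _), energy_apply,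
    inner_mulMap hD, inner_mulMap hc]

theorem mul_sq_norm_le_inner_mulMap {E : Type*} [NormedAddCommGroup E] [InnerProductSpace ℝ E]
    {s : Rn n → ℝ} (hs : MemLp s ⊤ (volume.restrict Ω)) {κ : ℝ}
    (hκ : ∀ᵐ x ∂(volume.restrict Ω), κ ≤ s x)
    (f : Lp E 2 ((volume : Measure (Rn n)).restrict Ω)) :
    κ * ‖f‖ ^ 2 ≤ ⟪mulMap Ω s f, f⟫ := by
  rw [inner_mulMap hs, ← real_inner_self_eq_norm_sq, L2.inner_def, ← integral_const_mul]
  refine integral_mono_ae ((L2.integrable_inner (𝕜 := ℝ) f f).const_mul κ)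
    (integrable_mul_inner hs f f) ?_
  filter_upwards [hκ] with x hx
  exact mul_le_mul_of_nonneg_right hx real_inner_self_nonneg

theorem mul_sq_norm_le_energy {D c : Rn n → ℝ} (hD : MemLp D ⊤ (volume.restrict Ω))
    (hc : MemLp c ⊤ (volume.restrict Ω)) {κ : ℝ} (hκD : ∀ᵐ x ∂(volume.restrict Ω), κ ≤ D x)
    (hκc : ∀ᵐ x ∂(volume.restrict Ω), κ ≤ c x) (u : H1 Ω) : κ * ‖u‖ ^ 2 ≤ energy Ω D c u u := by
  rw [H1.norm_sq_eq, energy_apply]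
  linarith [mul_sq_norm_le_inner_mulMap hD hκD u.grad, mul_sq_norm_le_inner_mulMap hc hκc u.fn]

/-- Lax–Milgram: common lower bounds on D and c give coercivity, and the right-hand side is
represented by Riesz. -/
theorem existsUnique_energy_eq {D c : Rn n → ℝ} (hD : MemLp D ⊤ (volume.restrict Ω))
    (hc : MemLp c ⊤ (volume.restrict Ω)) {κ : ℝ} (hκ : 0 < κ)
    (hκD : ∀ᵐ x ∂(volume.restrict Ω), κ ≤ D x) (hκc : ∀ᵐ x ∂(volume.restrict Ω), κ ≤ c x)
    (F : L2 Ω) (G : L2Vec Ω) :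
    ∃! u : H1 Ω, ∀ v : H1 Ω, energy Ω D c u v = ⟪F, v.fn⟫ + ⟪G, v.grad⟫ := by
  have hco : IsCoercive (energy Ω D c) := ⟨κ, hκ, fun u => by
    rw [mul_assoc, ← sq]
    exact mul_sq_norm_le_energy hD hc hκD hκc u⟩
  set l : H1 Ω →L[ℝ] ℝ := innerForm (L2 Ω) F ∘L H1.fnL Ω + innerForm (L2Vec Ω) G ∘L H1.gradL Ω
    with hl
  set w := (InnerProductSpace.toDual ℝ (H1 Ω)).symm l with hw
  refine ⟨hco.continuousLinearEquivOfBilin.symm w, fun v => ?_, fun u hu => ?_⟩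
  · rw [← hco.continuousLinearEquivOfBilin_apply, ContinuousLinearEquiv.apply_symm_apply, hw,
      InnerProductSpace.toDual_symm_apply]
    rfl
  · rw [ContinuousLinearEquiv.eq_symm_apply]
    refine ext_inner_right ℝ fun v => ?_
    rw [hco.continuousLinearEquivOfBilin_apply, hu v, hw, InnerProductSpace.toDual_symm_apply]
    rfl

theorem H1.norm_fn_le (u : H1 Ω) : ‖u.fn‖ ≤ ‖u‖ :=
  abs_le_of_sq_le_sq' (by nlinarith [H1.norm_sq_eq u, sq_nonneg ‖u.grad‖]) (norm_nonneg _) |>.2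

theorem H1.norm_grad_le (u : H1 Ω) : ‖u.grad‖ ≤ ‖u‖ :=
  abs_le_of_sq_le_sq' (by nlinarith [H1.norm_sq_eq u, sq_nonneg ‖u.fn‖]) (norm_nonneg _) |>.2

/-- Stability of the solution of a uniformly elliptic problem under bounded almost everywhere
convergence of the coefficients and convergence of the data in `L²`. -/
theorem tendsto_of_energy_eq {D c : ℕ → Rn n → ℝ} {D' c' : Rn n → ℝ} {κ C : ℝ} (hκ : 0 < κ)
    (hDm : ∀ k, AEStronglyMeasurable (D k) (volume.restrict Ω))
    (hcm : ∀ k, AEStronglyMeasurable (c k) (volume.restrict Ω))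
    (hDm' : AEStronglyMeasurable D' (volume.restrict Ω))
    (hcm' : AEStronglyMeasurable c' (volume.restrict Ω))
    (hDC : ∀ k x, ‖D k x‖ ≤ C) (hcC : ∀ k x, ‖c k x‖ ≤ C)
    (hDC' : ∀ x, ‖D' x‖ ≤ C) (hcC' : ∀ x, ‖c' x‖ ≤ C)
    (hDκ : ∀ k x, κ ≤ D k x) (hcκ : ∀ k x, κ ≤ c k x)
    (hD : ∀ᵐ x ∂(volume.restrict Ω), Tendsto (fun k => D k x) atTop (𝓝 (D' x)))
    (hc : ∀ᵐ x ∂(volume.restrict Ω), Tendsto (fun k => c k x) atTop (𝓝 (c' x)))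
    {F : ℕ → L2 Ω} {F' : L2 Ω} (hF : Tendsto F atTop (𝓝 F'))
    {G : ℕ → L2Vec Ω} {G' : L2Vec Ω} (hG : Tendsto G atTop (𝓝 G'))
    {u : ℕ → H1 Ω} {u' : H1 Ω}
    (hu : ∀ k, ∀ v : H1 Ω, energy Ω (D k) (c k) (u k) v = ⟪F k, v.fn⟫ + ⟪G k, v.grad⟫)
    (hu' : ∀ v : H1 Ω, energy Ω D' c' u' v = ⟪F', v.fn⟫ + ⟪G', v.grad⟫) :
    Tendsto u atTop (𝓝 u') := by
  have hDlim := tendsto_weightedMap (ContinuousLinearMap.lsmul ℝ ℝ) hDm hDm'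
    (fun k => Eventually.of_forall (hDC k)) (Eventually.of_forall hDC') hD u'.grad
  have hclim := tendsto_weightedMap (ContinuousLinearMap.lsmul ℝ ℝ) hcm hcm'
    (fun k => Eventually.of_forall (hcC k)) (Eventually.of_forall hcC') hc u'.fn
  rw [tendsto_iff_norm_sub_tendsto_zero] at hDlim hclim hF hG ⊢
  have hsum := (((hF.add hG).add hDlim).add hclim).div_const κ
  simp only [add_zero, zero_div] at hsum
  refine squeeze_zero (fun k => norm_nonneg _) (fun k => ?_) hsum
  set e := u k - u' with he
  have hco := mul_sq_norm_le_energy (memLp_top_of_bound (hDm k) C (Eventually.of_forall (hDC k)))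
    (memLp_top_of_bound (hcm k) C (Eventually.of_forall (hcC k)))
    (Eventually.of_forall (hDκ k)) (Eventually.of_forall (hcκ k)) e
  -- Testing both equations with the error leaves coefficient differences acting only on the fixed
  -- limit u'. Pointwise convergence of the coefficients therefore suffices.
  have h1 : energy Ω (D k) (c k) e e = ⟪F k - F', e.fn⟫ + ⟪G k - G', e.grad⟫
      - ⟪mulMap Ω (D k) u'.grad - mulMap Ω D' u'.grad, e.grad⟫
      - ⟪mulMap Ω (c k) u'.fn - mulMap Ω c' u'.fn, e.fn⟫ := by
    have h2 := hu k e
    have h3 := hu' e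
    have h4 : energy Ω (D k) (c k) e e =
        energy Ω (D k) (c k) (u k) e - energy Ω (D k) (c k) u' e := by
      rw [← sub_apply, ← map_sub]
    rw [energy_apply] at h3
    rw [h4, h2, energy_apply]
    simp only [inner_sub_left]
    linarith
  have b1 := (abs_le.1 (abs_real_inner_le_norm (F k - F') e.fn)).2
  have b2 := (abs_le.1 (abs_real_inner_le_norm (G k - G') e.grad)).2
  have b3 := (abs_le.1 (abs_real_inner_le_norm
    (mulMap Ω (D k) u'.grad - mulMap Ω D' u'.grad) e.grad)).1
  have b4 := (abs_le.1 (abs_real_inner_le_norm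
    (mulMap Ω (c k) u'.fn - mulMap Ω c' u'.fn) e.fn)).1
  have g1 := mul_le_mul_of_nonneg_left e.norm_fn_le (norm_nonneg (F k - F'))
  have g2 := mul_le_mul_of_nonneg_left e.norm_grad_le (norm_nonneg (G k - G'))
  have g3 := mul_le_mul_of_nonneg_left e.norm_grad_le
    (norm_nonneg (mulMap Ω (D k) u'.grad - mulMap Ω D' u'.grad))
  have g4 := mul_le_mul_of_nonneg_left e.norm_fn_le
    (norm_nonneg (mulMap Ω (c k) u'.fn - mulMap Ω c' u'.fn))
  rw [le_div_iff₀ hκ]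
  rcases (norm_nonneg e).eq_or_lt with h0 | h0
  · rw [← h0, zero_mul]
    positivity
  · refine le_of_mul_le_mul_right ?_ h0
    linarith

end

/-! ### Surface integrals in terms of volume integrals -/

section

variable {n : ℕ} {Ω U : Set (Rn n)}

theorem divergence_smul {X : Rn n → Rn n} (hX : ContDiff ℝ 1 X) {w : Rn n → ℝ} {x : Rn n}
    (hw : DifferentiableAt ℝ w x) :
    divergence (fun x => w x • X x) x = w x * divergence X x + ⟪gradient w x, X x⟫ := by
  have h1 : ∀ i : Fin n, fderiv ℝ (fun z => w z * X z i) x (EuclideanSpace.single i 1) =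
      w x * fderiv ℝ (fun z => X z i) x (EuclideanSpace.single i 1) +
        X x i * fderiv ℝ w x (EuclideanSpace.single i 1) := fun i => by
    rw [fderiv_fun_mul hw ((contDiff_coord hX i).differentiable one_ne_zero x)]
    simp
  have h2 : ⟪gradient w x, X x⟫ = ∑ i, X x i * fderiv ℝ w x (EuclideanSpace.single i 1) := by
    rw [inner_gradient_left]
    conv_lhs => rw [← (EuclideanSpace.basisFun (Fin n) ℝ).sum_repr (X x)]
    rw [map_sum]
    simp
  simp only [divergence, PiLp.smul_apply, smul_eq_mul, h1, Finset.sum_add_distrib, h2,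
    Finset.mul_sum]

theorem continuous_divergence {X : Rn n → Rn n} (hX : ContDiff ℝ 1 X) :
    Continuous (divergence X) :=
  continuous_finsetSum _ fun i _ =>
    ((contDiff_coord hX i).continuous_fderiv one_ne_zero).clm_apply continuous_const

theorem tsupport_divergence_subset (X : Rn n → Rn n) : tsupport (divergence X) ⊆ tsupport X := by
  refine closure_minimal (fun x hx => ?_) (isClosed_tsupport X)
  by_contra h
  refine hx (Finset.sum_eq_zero fun i _ => ?_)
  have h0 : (fun z => X z i) =ᶠ[𝓝 x] fun _ => 0 := by
    filter_upwards [(isClosed_tsupport X).isOpen_compl.mem_nhds h] with z hz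
    rw [image_eq_zero_of_notMem_tsupport hz]
    rfl
  rw [h0.fderiv_eq]
  simp

theorem hasCompactSupport_divergence {X : Rn n → Rn n} (hXc : HasCompactSupport X) :
    HasCompactSupport (divergence X) :=
  hXc.mono' (subset_closure.trans (tsupport_divergence_subset X))

theorem memLp_surfaceMeasure [IsFiniteMeasure (surfaceMeasure U)] (hUb : Bornology.IsBounded U)
    {f : Rn n → ℝ} (hf : Continuous f) (p : ENNReal) : MemLp f p (surfaceMeasure U) := by
  have hK : IsCompact (frontier U) :=
    Metric.isCompact_of_isClosed_isBounded isClosed_frontier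
      (hUb.closure.subset frontier_subset_closure)
  obtain ⟨C, hC⟩ := hK.exists_bound_of_continuousOn hf.continuousOn
  refine MemLp.of_bound hf.aestronglyMeasurable C ?_
  rw [surfaceMeasure]
  filter_upwards [ae_restrict_mem isClosed_frontier.measurableSet] with x hx using hC x hx

/-- The divergence theorem for `w X`, where `-X` is the outer unit normal. -/
theorem setIntegral_divergence_eq_neg_surface [IsFiniteMeasure (surfaceMeasure U)]
    (hU : IsOpen U) (hUb : Bornology.IsBounded U) {X : Rn n → Rn n} (hX : ContDiff ℝ 1 X)
    (hXc : HasCompactSupport X) (hnormal : ∀ y ∈ frontier U, IsNormal U y (-X y))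
    {w : Rn n → ℝ} (hw : ContDiff ℝ 1 w) :
    ∫ x in U, divergence (fun x => w x • X x) x = -∫ x, w x ∂(surfaceMeasure U) := by
  -- A C¹ function of arbitrary sign is a difference of nonnegative C¹ functions: w = ((w + 1)/2)² -
  -- ((w - 1)/2)².
  have key : ∀ c : ℝ, ContDiff ℝ 1 fun x => ((w x + c) / 2) ^ 2 := fun c =>
    ((hw.add contDiff_const).div_const 2).pow 2
  have hInt : ∀ c : ℝ, Integrable (divergence fun x => ((w x + c) / 2) ^ 2 • X x)
      (volume.restrict U) := fun c =>
    ((continuous_divergence ((key c).smul hX)).integrable_of_hasCompactSupport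
      (hasCompactSupport_divergence hXc.smul_left)).restrict
  have h1 := setIntegral_divergence_eq_neg_surface_of_nonneg hU hUb hX hXc hnormal (key 1)
    fun x => sq_nonneg _
  have h2 := setIntegral_divergence_eq_neg_surface_of_nonneg hU hUb hX hXc hnormal (key (-1))
    fun x => sq_nonneg _
  have e1 : ∀ x, divergence (fun x => w x • X x) x =
      divergence (fun x => ((w x + 1) / 2) ^ 2 • X x) x -
        divergence (fun x => ((w x + -1) / 2) ^ 2 • X x) x := fun x => by
    have hd : ∀ c : ℝ, DifferentiableAt ℝ (fun x => ((w x + c) / 2) ^ 2) x := fun c =>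
      (key c).differentiable one_ne_zero x
    have hdiff : gradient w x = gradient (fun x => ((w x + 1) / 2) ^ 2) x -
        gradient (fun x => ((w x + -1) / 2) ^ 2) x := by
      rw [gradient, gradient, gradient, ← map_sub, ← fderiv_fun_sub (hd 1) (hd (-1))]
      congr 2
      funext y
      ring
    rw [divergence_smul hX (hw.differentiable one_ne_zero x), divergence_smul hX (hd 1),
      divergence_smul hX (hd (-1)), hdiff, inner_sub_left]
    ring
  have e2 : ∀ x, w x = ((w x + 1) / 2) ^ 2 - ((w x + -1) / 2) ^ 2 := fun x => by ring
  have hsurf : ∀ c : ℝ, Integrable (fun x => ((w x + c) / 2) ^ 2) (surfaceMeasure U) := fun c =>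
    memLp_one_iff_integrable.1 (memLp_surfaceMeasure hUb (key c).continuous 1)
  have e3 : ∫ x, w x ∂(surfaceMeasure U) = ∫ x, ((w x + 1) / 2) ^ 2 ∂(surfaceMeasure U) -
      ∫ x, ((w x + -1) / 2) ^ 2 ∂(surfaceMeasure U) := by
    rw [← integral_sub (hsurf 1) (hsurf (-1))]
    exact integral_congr_ae (Eventually.of_forall e2)
  simp_rw [e1]
  rw [integral_sub (hInt 1) (hInt (-1)), h1, h2, e3]
  ring

/-! ### The weak form of integrals over the interface -/

/-- The form `∫_Ω φ (f₁ f₂ div X + f₂ G₁·X + f₁ G₂·X)` of pairs `(f₁, G₁)`, `(f₂, G₂)`. -/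
def fluxForm (Ω : Set (Rn n)) (X : Rn n → Rn n) (φ : Rn n → ℝ) :
    WithLp 2 (L2 Ω × L2Vec Ω) →L[ℝ] WithLp 2 (L2 Ω × L2Vec Ω) →L[ℝ] ℝ :=
  (innerForm (L2 Ω)).bilinearComp
      (mulMap Ω (fun x => φ x * divergence X x) ∘L WithLp.fstL 2 ℝ (L2 Ω) (L2Vec Ω) +
        weightedMap (volume.restrict Ω) (innerForm (Rn n)) (fun x => φ x • X x) ∘L
          WithLp.sndL 2 ℝ (L2 Ω) (L2Vec Ω))
      (WithLp.fstL 2 ℝ (L2 Ω) (L2Vec Ω)) +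
    (innerForm (L2Vec Ω)).bilinearComp
      (weightedMap (volume.restrict Ω) (ContinuousLinearMap.lsmul ℝ ℝ).flip
        (fun x => φ x • X x) ∘L WithLp.fstL 2 ℝ (L2 Ω) (L2Vec Ω))
      (WithLp.sndL 2 ℝ (L2 Ω) (L2Vec Ω))

theorem memLp_top_mul_divergence {X : Rn n → Rn n} (hX : ContDiff ℝ 1 X)
    (hXc : HasCompactSupport X) {φ : Rn n → ℝ} (hφ : MemLp φ ⊤ (volume.restrict Ω)) :
    MemLp (fun x => φ x * divergence X x) ⊤ (volume.restrict Ω) :=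
  ((continuous_divergence hX).memLp_top_of_hasCompactSupport
    (hasCompactSupport_divergence hXc) _).mul hφ

theorem memLp_top_smul_field {X : Rn n → Rn n} (hX : ContDiff ℝ 1 X)
    (hXc : HasCompactSupport X) {φ : Rn n → ℝ} (hφ : MemLp φ ⊤ (volume.restrict Ω)) :
    MemLp (fun x => φ x • X x) ⊤ (volume.restrict Ω) :=
  (hX.continuous.memLp_top_of_hasCompactSupport hXc _).smul hφ

theorem memLp_of_isBounded {E : Type*} [NormedAddCommGroup E] (hb : Bornology.IsBounded Ω)
    {f : Rn n → E} (hf : Continuous f) (p : ENNReal) : MemLp f p (volume.restrict Ω) := by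
  have : IsFiniteMeasure (volume.restrict Ω) := ⟨by
    rw [Measure.restrict_apply_univ]
    exact hb.measure_lt_top⟩
  obtain ⟨C, hC⟩ := (Metric.isCompact_of_isClosed_isBounded isClosed_closure
    hb.closure).exists_bound_of_continuousOn hf.continuousOn
  have h : MemLp f p (volume.restrict (closure Ω)) := by
    have : IsFiniteMeasure (volume.restrict (closure Ω)) := ⟨by
      rw [Measure.restrict_apply_univ]
      exact hb.closure.measure_lt_top⟩
    refine MemLp.of_bound hf.aestronglyMeasurable C ?_
    filter_upwards [ae_restrict_mem isClosed_closure.measurableSet] with x hx using hC x hx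
  exact h.mono_measure (Measure.restrict_mono subset_closure le_rfl)

theorem continuous_gradient {ψ : Rn n → ℝ} (hψ : ContDiff ℝ ∞ ψ) : Continuous (gradient ψ) :=
  (InnerProductSpace.toDual ℝ (Rn n)).symm.continuous.comp (hψ.continuous_fderiv (by simp))

/-- The pair `(ψ, ∇ψ)` in `L²(Ω) × L²(Ω; ℝⁿ)` given by a smooth function on a bounded set. -/
def smoothPair (hb : Bornology.IsBounded Ω) {ψ : Rn n → ℝ} (hψ : ContDiff ℝ ∞ ψ) :
    WithLp 2 (L2 Ω × L2Vec Ω) :=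
  WithLp.toLp 2 ((memLp_of_isBounded hb hψ.continuous 2).toLp,
    (memLp_of_isBounded hb (continuous_gradient hψ) 2).toLp)

theorem smoothPair_sub (hb : Bornology.IsBounded Ω) {ψ η : Rn n → ℝ} (hψ : ContDiff ℝ ∞ ψ)
    (hη : ContDiff ℝ ∞ η) :
    smoothPair hb (hψ.sub hη) = smoothPair hb hψ - smoothPair hb hη := by
  have h : gradient (ψ - η) = gradient ψ - gradient η := by
    funext x
    rw [Pi.sub_apply, gradient, gradient, gradient, ← map_sub, ← fderiv_sub
      (hψ.differentiable (by simp) x) (hη.differentiable (by simp) x)]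
  rw [smoothPair, smoothPair, smoothPair, ← WithLp.toLp_sub, Prod.mk_sub_mk, ← MemLp.toLp_sub,
    ← MemLp.toLp_sub]
  congr 2
  exact MemLp.toLp_congr _ _ (Eventually.of_forall fun x => congrFun h x)

theorem tendsto_smoothPair (hb : Bornology.IsBounded Ω) {u : H1 Ω} {ψ : ℕ → Rn n → ℝ}
    (hψ : ∀ k, ContDiff ℝ ∞ (ψ k))
    (h1 : Tendsto (fun k => eLpNorm (fun x => ψ k x - u.fn x) 2 (volume.restrict Ω)) atTop (𝓝 0))
    (h2 : Tendsto (fun k => eLpNorm (fun x => gradient (ψ k) x - u.grad x) 2 (volume.restrict Ω))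
      atTop (𝓝 0)) :
    Tendsto (fun k => smoothPair hb (hψ k)) atTop (𝓝 u.1) := by
  refine ((WithLp.prodContinuousLinearEquiv 2 ℝ (L2 Ω) (L2Vec Ω)).symm.continuous.tendsto
    (u.fn, u.grad)).comp (Tendsto.prodMk_nhds ?_ ?_)
  · rw [Lp.tendsto_Lp_iff_tendsto_eLpNorm']
    refine h1.congr fun k => eLpNorm_congr_ae ?_
    filter_upwards [(memLp_of_isBounded hb (hψ k).continuous 2).coeFn_toLp] with x hx
    rw [Pi.sub_apply, hx]
  · rw [Lp.tendsto_Lp_iff_tendsto_eLpNorm']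
    refine h2.congr fun k => eLpNorm_congr_ae ?_
    filter_upwards [(memLp_of_isBounded hb (continuous_gradient (hψ k)) 2).coeFn_toLp] with x hx
    rw [Pi.sub_apply, hx]

theorem fluxForm_smoothPair (hb : Bornology.IsBounded Ω) {X : Rn n → Rn n} (hX : ContDiff ℝ 1 X)
    (hXc : HasCompactSupport X) {φ : Rn n → ℝ} (hφ : MemLp φ ⊤ (volume.restrict Ω))
    {ψ η : Rn n → ℝ} (hψ : ContDiff ℝ ∞ ψ) (hη : ContDiff ℝ ∞ η) :
    fluxForm Ω X φ (smoothPair hb hψ) (smoothPair hb hη) =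
      ∫ x in Ω, φ x * divergence (fun x => (ψ x * η x) • X x) x := by
  set a : L2 Ω := (memLp_of_isBounded hb hψ.continuous 2).toLp with ha
  set A : L2Vec Ω := (memLp_of_isBounded hb (continuous_gradient hψ) 2).toLp with hA
  set b : L2 Ω := (memLp_of_isBounded hb hη.continuous 2).toLp with hbb
  set B : L2Vec Ω := (memLp_of_isBounded hb (continuous_gradient hη) 2).toLp with hB
  have h1 : fluxForm Ω X φ (smoothPair hb hψ) (smoothPair hb hη) =
      ⟪mulMap Ω (fun x => φ x * divergence X x) a +
        weightedMap (volume.restrict Ω) (innerForm (Rn n)) (fun x => φ x • X x) A, b⟫ +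
      ⟪weightedMap (volume.restrict Ω) (ContinuousLinearMap.lsmul ℝ ℝ).flip
        (fun x => φ x • X x) a, B⟫ := rfl
  rw [h1, L2.inner_def, L2.inner_def, ← integral_add (L2.integrable_inner _ _)
    (L2.integrable_inner _ _)]
  refine integral_congr_ae ?_
  filter_upwards [coeFn_mulMap (memLp_top_mul_divergence hX hXc hφ) a,
    coeFn_weightedMap (innerForm (Rn n)) (memLp_top_smul_field hX hXc hφ) A,
    coeFn_weightedMap (ContinuousLinearMap.lsmul ℝ ℝ).flip (memLp_top_smul_field hX hXc hφ) a,
    Lp.coeFn_add (mulMap Ω (fun x => φ x * divergence X x) a)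
      (weightedMap (volume.restrict Ω) (innerForm (Rn n)) (fun x => φ x • X x) A),
    (memLp_of_isBounded hb hψ.continuous 2).coeFn_toLp,
    (memLp_of_isBounded hb hη.continuous 2).coeFn_toLp,
    (memLp_of_isBounded hb (continuous_gradient hψ) 2).coeFn_toLp,
    (memLp_of_isBounded hb (continuous_gradient hη) 2).coeFn_toLp] with x e1 e2 e3 e4 e5 e6 e7 e8
  have hdψ := hψ.differentiable (by simp) x
  have hdη := hη.differentiable (by simp) x
  have hg : gradient (fun x => ψ x * η x) x = ψ x • gradient η x + η x • gradient ψ x := by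
    rw [gradient, fderiv_fun_mul hdψ hdη, map_add, map_smulₛₗ, map_smulₛₗ]
    rfl
  rw [e4, Pi.add_apply, e1, e2, e3, ha, hA, hbb, hB, e5, e6, e7, e8,
    divergence_smul hX (hdψ.fun_mul hdη), hg]
  simp only [innerForm_apply, ContinuousLinearMap.flip_apply, ContinuousLinearMap.lsmul_apply,
    inner_add_left, real_inner_smul_left, smul_eq_mul, RCLike.inner_apply, conj_trivial]
  rw [real_inner_comm (X x) (gradient ψ x), real_inner_comm (X x) (gradient η x)]
  ring

end

/-! ### Traces and integration by parts on H¹ -/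

section

variable {n : ℕ} {Ω U : Set (Rn n)}

theorem memLp_top_indicator_one (hU : MeasurableSet U) :
    MemLp (U.indicator fun _ => (1 : ℝ)) ⊤ (volume.restrict Ω) :=
  memLp_top_of_bound (aestronglyMeasurable_const.indicator hU) 1 (Eventually.of_forall fun x => by
    by_cases hx : x ∈ U <;> simp [hx])

theorem fluxForm_indicator_smoothPair [IsFiniteMeasure (surfaceMeasure U)] (hU : IsOpen U)
    (hUΩ : U ⊆ Ω) (hb : Bornology.IsBounded Ω) {X : Rn n → Rn n} (hX : ContDiff ℝ 1 X)
    (hXc : HasCompactSupport X) (hnormal : ∀ y ∈ frontier U, IsNormal U y (-X y))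
    {ψ η : Rn n → ℝ} (hψ : ContDiff ℝ ∞ ψ) (hη : ContDiff ℝ ∞ η) :
    fluxForm Ω X (U.indicator fun _ => 1) (smoothPair hb hψ) (smoothPair hb hη) =
      -∫ x, ψ x * η x ∂(surfaceMeasure U) := by
  have hle : (1 : WithTop ℕ∞) ≤ ∞ := by exact_mod_cast le_top
  rw [fluxForm_smoothPair hb hX hXc (memLp_top_indicator_one hU.measurableSet),
    ← setIntegral_divergence_eq_neg_surface hU (hb.subset hUΩ) hX hXc hnormal
      ((hψ.mul hη).of_le hle)]
  have h : ∀ x, U.indicator (fun _ => (1 : ℝ)) x * divergence (fun x => (ψ x * η x) • X x) x =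
      U.indicator (divergence fun x => (ψ x * η x) • X x) x := fun x => by
    by_cases hx : x ∈ U <;> simp [hx]
  simp_rw [h]
  rw [setIntegral_indicator hU.measurableSet, inter_eq_right.2 hUΩ]

/-- Smooth approximations in `H¹(Ω)` converge on the interface. -/
theorem exists_isTrace [IsFiniteMeasure (surfaceMeasure U)] (hU : IsOpen U) (hUΩ : U ⊆ Ω)
    (hΩ : IsOpen Ω) (hconv : Convex ℝ Ω) (hb : Bornology.IsBounded Ω) (hne : Ω.Nonempty)
    {X : Rn n → Rn n} (hX : ContDiff ℝ 1 X) (hXc : HasCompactSupport X)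
    (hnormal : ∀ y ∈ frontier U, IsNormal U y (-X y)) (u : H1 Ω) : ∃ τ, IsTrace U u τ := by
  obtain ⟨ψ, hψ, h1, h2⟩ := u.exists_smooth_approx hΩ hconv hb hne
  have hUb := hb.subset hUΩ
  have hlim := tendsto_smoothPair hb hψ h1 h2
  have hmem : ∀ k, MemLp (ψ k) 2 (surfaceMeasure U) := fun k =>
    memLp_surfaceMeasure hUb (hψ k).continuous 2
  set K := ‖fluxForm Ω X (U.indicator fun _ => (1 : ℝ))‖ with hK
  have hK0 : 0 ≤ K := ContinuousLinearMap.opNorm_nonneg _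
  -- The trace inequality: the squared surface norm of a smooth function is minus its flux form,
  -- hence at most K times its squared H¹ norm.
  have hdist : ∀ k l, dist ((hmem k).toLp) ((hmem l).toLp) ≤
      √K * dist (smoothPair hb (hψ k)) (smoothPair hb (hψ l)) := fun k l => by
    have e1 : ‖(hmem k).toLp - (hmem l).toLp‖ ^ 2 =
        ∫ x, (ψ k - ψ l) x * (ψ k - ψ l) x ∂(surfaceMeasure U) := by
      rw [← MemLp.toLp_sub, ← real_inner_self_eq_norm_sq, L2.inner_def]
      refine integral_congr_ae ?_
      filter_upwards [((hmem k).sub (hmem l)).coeFn_toLp] with x hx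
      rw [hx]
      simp [sq]
    have e2 := fluxForm_indicator_smoothPair hU hUΩ hb hX hXc hnormal ((hψ k).sub (hψ l))
      ((hψ k).sub (hψ l))
    rw [smoothPair_sub hb (hψ k) (hψ l)] at e2
    have e3 := (fluxForm Ω X (U.indicator fun _ => (1 : ℝ))).le_opNorm₂
      (smoothPair hb (hψ k) - smoothPair hb (hψ l)) (smoothPair hb (hψ k) - smoothPair hb (hψ l))
    rw [e2, norm_neg] at e3
    rw [dist_eq_norm, dist_eq_norm]
    refine abs_le_of_sq_le_sq' ?_ (by positivity) |>.2
    rw [mul_pow, Real.sq_sqrt hK0, e1]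
    calc _ ≤ ‖∫ x, (ψ k - ψ l) x * (ψ k - ψ l) x ∂(surfaceMeasure U)‖ := le_abs_self _
      _ ≤ _ := e3
      _ = _ := by rw [← hK]; ring
  have hC : CauchySeq fun k => (hmem k).toLp := by
    rw [cauchySeq_iff_tendsto_dist_atTop_0]
    refine squeeze_zero (fun _ => dist_nonneg) (fun p => hdist p.1 p.2) ?_
    have := (cauchySeq_iff_tendsto_dist_atTop_0.1 hlim.cauchySeq).const_mul (√K)
    rwa [mul_zero] at this
  obtain ⟨τ, hτ⟩ := cauchySeq_tendsto_of_complete hC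
  refine ⟨τ, ψ, hψ, h1, h2, ?_⟩
  rw [Lp.tendsto_Lp_iff_tendsto_eLpNorm'] at hτ
  refine hτ.congr fun k => eLpNorm_congr_ae ?_
  filter_upwards [(hmem k).coeFn_toLp] with x hx
  rw [Pi.sub_apply, hx]

/-- Both sides are limits along the approximating smooth functions. As the right side does not see
the approximations, the choice made in `trace` is immaterial. -/
theorem integral_mul_of_isTrace [IsFiniteMeasure (surfaceMeasure U)] (hU : IsOpen U) (hUΩ : U ⊆ Ω)
    (hb : Bornology.IsBounded Ω) {X : Rn n → Rn n} (hX : ContDiff ℝ 1 X)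
    (hXc : HasCompactSupport X) (hnormal : ∀ y ∈ frontier U, IsNormal U y (-X y)) {u v : H1 Ω}
    {τ σ : Lp ℝ 2 (surfaceMeasure U)} (hτ : IsTrace U u τ) (hσ : IsTrace U v σ) :
    ∫ x, τ x * σ x ∂(surfaceMeasure U) =
      -fluxForm Ω X (U.indicator fun _ => 1) u.1 v.1 := by
  obtain ⟨ψ, hψ, hψ1, hψ2, hψ3⟩ := hτ
  obtain ⟨η, hη, hη1, hη2, hη3⟩ := hσ
  have hlim : ∀ {ζ : ℕ → Rn n → ℝ} {ρ : Lp ℝ 2 (surfaceMeasure U)} (hζ : ∀ k, ContDiff ℝ ∞ (ζ k)),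
      Tendsto (fun k => eLpNorm (fun x => ζ k x - ρ x) 2 (surfaceMeasure U)) atTop (𝓝 0) →
      Tendsto (fun k => (memLp_surfaceMeasure (hb.subset hUΩ) (hζ k).continuous 2).toLp) atTop
        (𝓝 ρ) := fun hζ h => by
    rw [Lp.tendsto_Lp_iff_tendsto_eLpNorm']
    refine h.congr fun k => eLpNorm_congr_ae ?_
    filter_upwards [(memLp_surfaceMeasure (hb.subset hUΩ) (hζ k).continuous 2).coeFn_toLp]
      with x hx
    rw [Pi.sub_apply, hx]
  have hS := (hlim hψ hψ3).inner (𝕜 := ℝ) (hlim hη hη3)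
  have hF := (((fluxForm Ω X (U.indicator fun _ => (1 : ℝ))).continuous₂.tendsto _).comp
    ((tendsto_smoothPair hb hψ hψ1 hψ2).prodMk_nhds (tendsto_smoothPair hb hη hη1 hη2))).neg
  have h0 := tendsto_nhds_unique (hS.congr fun k => ?_) hF
  · refine Eq.trans ?_ h0
    rw [L2.inner_def]
    refine integral_congr_ae (Eventually.of_forall fun x => ?_)
    simp [mul_comm]
  · simp only [Function.comp_apply, Function.uncurry_apply_pair]
    rw [fluxForm_indicator_smoothPair hU hUΩ hb hX hXc hnormal (hψ k) (hη k), neg_neg,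
      L2.inner_def]
    refine integral_congr_ae ?_
    filter_upwards [(memLp_surfaceMeasure (hb.subset hUΩ) (hψ k).continuous 2).coeFn_toLp,
      (memLp_surfaceMeasure (hb.subset hUΩ) (hη k).continuous 2).coeFn_toLp] with x h1 h2
    rw [h1, h2]
    simp [mul_comm]

theorem integral_trace_mul_trace [IsFiniteMeasure (surfaceMeasure U)] (hU : IsOpen U)
    (hUΩ : U ⊆ Ω) (hΩ : IsOpen Ω) (hconv : Convex ℝ Ω) (hb : Bornology.IsBounded Ω)
    (hne : Ω.Nonempty) {X : Rn n → Rn n} (hX : ContDiff ℝ 1 X) (hXc : HasCompactSupport X)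
    (hnormal : ∀ y ∈ frontier U, IsNormal U y (-X y)) (u v : H1 Ω) :
    ∫ x, trace U u x * trace U v x ∂(surfaceMeasure U) =
      -fluxForm Ω X (U.indicator fun _ => 1) u.1 v.1 := by
  have h : ∀ w : H1 Ω, IsTrace U w (trace U w) := fun w => by
    have hw := exists_isTrace hU hUΩ hΩ hconv hb hne hX hXc hnormal w
    rw [trace, dif_pos hw]
    exact hw.choose_spec
  exact integral_mul_of_isTrace hU hUΩ hb hX hXc hnormal (h u) (h v)

/-- Since X is supported inside Ω, the integrals extend to the whole space and no term on ∂Ω arises.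
-/
theorem setIntegral_mul_divergence_smul {X : Rn n → Rn n} (hX : ContDiff ℝ 1 X)
    (hXc : HasCompactSupport X) (hXΩ : tsupport X ⊆ Ω) {φ : Rn n → ℝ} {C : NNReal}
    (hφ : LipschitzWith C φ) {w : Rn n → ℝ} (hw : ContDiff ℝ 1 w) :
    ∫ x in Ω, φ x * divergence (fun x => w x • X x) x =
      -∫ x in Ω, ⟪gradient φ x, X x⟫ * w x := by
  have hY : ContDiff ℝ 1 fun x => w x • X x := hw.smul hX
  have hsub : (Function.support fun x => w x • X x) ⊆ Function.support X := fun x hx h =>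
    hx (by simp [h])
  have hYc : HasCompactSupport fun x => w x • X x := hXc.mono hsub
  have h1 : ∫ x, ⟪gradient φ x, w x • X x⟫ = -∫ x, φ x * divergence (fun x => w x • X x) x :=
    integral_inner_gradient_eq_neg (Y := fun x => w x • X x) hφ hY hYc
  have h2 : ∫ x in Ω, φ x * divergence (fun x => w x • X x) x =
      ∫ x, φ x * divergence (fun x => w x • X x) x := by
    refine setIntegral_eq_integral_of_forall_compl_eq_zero fun x hx => ?_
    have hx' : x ∉ tsupport (divergence fun x => w x • X x) := fun h =>
      hx (hXΩ (closure_mono hsub (tsupport_divergence_subset _ h)))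
    rw [image_eq_zero_of_notMem_tsupport hx', mul_zero]
  have h3 : ∫ x in Ω, ⟪gradient φ x, w x • X x⟫ = ∫ x, ⟪gradient φ x, w x • X x⟫ := by
    refine setIntegral_eq_integral_of_forall_compl_eq_zero fun x hx => ?_
    have hx' : x ∉ tsupport X := fun h => hx (hXΩ h)
    rw [image_eq_zero_of_notMem_tsupport hx', smul_zero, inner_zero_right]
  rw [h2, ← neg_eq_iff_eq_neg, ← h1, ← h3]
  simp_rw [real_inner_smul_right, mul_comm]

theorem inner_mulMap_inner_gradient_smoothPair (hb : Bornology.IsBounded Ω) {X : Rn n → Rn n}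
    (hX : ContDiff ℝ 1 X) (hXc : HasCompactSupport X) (hXΩ : tsupport X ⊆ Ω) {φ : Rn n → ℝ}
    {C : NNReal} (hφ : LipschitzWith C φ) (hφm : MemLp φ ⊤ (volume.restrict Ω))
    (hm : MemLp (fun x => ⟪gradient φ x, X x⟫) ⊤ (volume.restrict Ω)) {ψ η : Rn n → ℝ}
    (hψ : ContDiff ℝ ∞ ψ) (hη : ContDiff ℝ ∞ η) :
    ⟪mulMap Ω (fun x => ⟪gradient φ x, X x⟫) (smoothPair hb hψ).fst, (smoothPair hb hη).fst⟫ =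
      -fluxForm Ω X φ (smoothPair hb hψ) (smoothPair hb hη) := by
  have hle : (1 : WithTop ℕ∞) ≤ ∞ := by exact_mod_cast le_top
  have hw : ContDiff ℝ 1 (fun x => ψ x * η x) := (hψ.mul hη).of_le hle
  rw [fluxForm_smoothPair hb hX hXc hφm hψ hη, setIntegral_mul_divergence_smul hX hXc hXΩ hφ hw,
    neg_neg, inner_mulMap hm]
  refine integral_congr_ae ?_
  filter_upwards [(memLp_of_isBounded hb hψ.continuous 2).coeFn_toLp,
    (memLp_of_isBounded hb hη.continuous 2).coeFn_toLp] with x e1 e2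
  have e3 : (smoothPair hb hψ).fst x = ψ x := e1
  have e4 : (smoothPair hb hη).fst x = η x := e2
  rw [e3, e4]
  simp only [RCLike.inner_apply, conj_trivial]
  ring

/-- Integration by parts against the gradient of a Lipschitz function. -/
theorem inner_mulMap_inner_gradient (hΩ : IsOpen Ω) (hconv : Convex ℝ Ω)
    (hb : Bornology.IsBounded Ω) (hne : Ω.Nonempty) {X : Rn n → Rn n} (hX : ContDiff ℝ 1 X)
    (hXc : HasCompactSupport X) (hXΩ : tsupport X ⊆ Ω) {φ : Rn n → ℝ} {C : NNReal}
    (hφ : LipschitzWith C φ) (hφm : MemLp φ ⊤ (volume.restrict Ω))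
    (hm : MemLp (fun x => ⟪gradient φ x, X x⟫) ⊤ (volume.restrict Ω)) (u v : H1 Ω) :
    ⟪mulMap Ω (fun x => ⟪gradient φ x, X x⟫) u.fn, v.fn⟫ = -fluxForm Ω X φ u.1 v.1 := by
  obtain ⟨ψ, hψ, hψ1, hψ2⟩ := u.exists_smooth_approx hΩ hconv hb hne
  obtain ⟨η, hη, hη1, hη2⟩ := v.exists_smooth_approx hΩ hconv hb hne
  have hψl := tendsto_smoothPair hb hψ hψ1 hψ2
  have hηl := tendsto_smoothPair hb hη hη1 hη2
  have hfst : ∀ {w : H1 Ω} {p : ℕ → WithLp 2 (L2 Ω × L2Vec Ω)}, Tendsto p atTop (𝓝 w.1) →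
      Tendsto (fun k => (p k).fst) atTop (𝓝 w.fn) := fun hp =>
    ((WithLp.fstL 2 ℝ (L2 Ω) (L2Vec Ω)).continuous.tendsto _).comp hp
  have hM := ((mulMap Ω (fun x => ⟪gradient φ x, X x⟫)).continuous.tendsto u.fn).comp (hfst hψl)
  have hS := hM.inner (𝕜 := ℝ) (hfst hηl)
  have hF : Tendsto (fun k => -fluxForm Ω X φ (smoothPair hb (hψ k)) (smoothPair hb (hη k))) atTop
      (𝓝 (-fluxForm Ω X φ u.1 v.1)) :=
    (((fluxForm Ω X φ).continuous₂.tendsto (u.1, v.1)).comp (hψl.prodMk_nhds hηl)).neg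
  refine tendsto_nhds_unique hS (hF.congr fun k => ?_)
  exact (inner_mulMap_inner_gradient_smoothPair hb hX hXc hXΩ hφ hφm hm (hψ k) (hη k)).symm

end

/-! ### Both problems in the common form "energy = load" -/

section

variable {n : ℕ} {Ω U : Set (Rn n)}

theorem isOpen_cuboid (a b : Fin n → ℝ) : IsOpen (cuboid a b) := by
  simp only [cuboid, ofPred_forall, ofPred_and]
  exact isOpen_iInter_of_finite fun i =>
    (isOpen_lt continuous_const (by fun_prop)).inter (isOpen_lt (by fun_prop) continuous_const)

theorem convex_cuboid (a b : Fin n → ℝ) : Convex ℝ (cuboid a b) := by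
  have h : cuboid a b = ⋂ i, (EuclideanSpace.proj i : Rn n →L[ℝ] ℝ) ⁻¹' Ioo (a i) (b i) := by
    ext x
    simp [cuboid]
  rw [h]
  exact convex_iInter fun i => (convex_Ioo _ _).is_linear_preimage (LinearMap.isLinear _)

theorem isBounded_cuboid (a b : Fin n → ℝ) : Bornology.IsBounded (cuboid a b) := by
  have h : cuboid a b ⊆ EuclideanSpace.equiv (Fin n) ℝ ⁻¹' Icc a b := fun x hx =>
    ⟨fun i => (hx i).1.le, fun i => (hx i).2.le⟩
  exact ((EuclideanSpace.equiv (Fin n) ℝ).antilipschitz.isBounded_preimage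
    (Metric.isBounded_Icc a b)).subset h

theorem frontier_nonempty (hn : 1 ≤ n) (hne : U.Nonempty) (hUb : Bornology.IsBounded U) :
    (frontier U).Nonempty := by
  have : Nonempty (Fin n) := ⟨⟨0, hn⟩⟩
  refine nonempty_frontier_iff.2 ⟨hne, fun h => ?_⟩
  rw [h] at hUb
  exact NormedSpace.unbounded_univ ℝ (Rn n) hUb

/-- The part of the data of the limit and of the diffuse problem paired with the test function. -/
def loadFn (Ω : Set (Rn n)) (X : Rn n → Rn n) (φ m : Rn n → ℝ) (q h : L2 Ω) (g : H1 Ω) : L2 Ω :=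
  (h + mulMap Ω φ (q - h)) - mulMap Ω m g.fn +
    (mulMap Ω (fun x => φ x * divergence X x) g.fn +
      weightedMap (volume.restrict Ω) (innerForm (Rn n)) (fun x => φ x • X x) g.grad)

/-- The part of the data paired with the gradient of the test function. -/
def loadVec (Ω : Set (Rn n)) (X : Rn n → Rn n) (φ : Rn n → ℝ) (g : H1 Ω) : L2Vec Ω :=
  weightedMap (volume.restrict Ω) (ContinuousLinearMap.lsmul ℝ ℝ).flip (fun x => φ x • X x) g.fn

theorem inner_load (X : Rn n → Rn n) (φ m : Rn n → ℝ) (q h : L2 Ω) (g v : H1 Ω) :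
    ⟪loadFn Ω X φ m q h g, v.fn⟫ + ⟪loadVec Ω X φ g, v.grad⟫ =
      ⟪h + mulMap Ω φ (q - h), v.fn⟫ - ⟪mulMap Ω m g.fn, v.fn⟫ + fluxForm Ω X φ g.1 v.1 := by
  have h1 : fluxForm Ω X φ g.1 v.1 =
      ⟪mulMap Ω (fun x => φ x * divergence X x) g.fn +
        weightedMap (volume.restrict Ω) (innerForm (Rn n)) (fun x => φ x • X x) g.grad, v.fn⟫ +
      ⟪loadVec Ω X φ g, v.grad⟫ := rfl
  rw [h1, loadFn, inner_add_left, inner_sub_left]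
  ring

theorem inner_add_mulMap_sub {φ : Rn n → ℝ} (hφ : MemLp φ ⊤ (volume.restrict Ω)) (q h f : L2 Ω) :
    ⟪h + mulMap Ω φ (q - h), f⟫ = ∫ x in Ω, (h x + (q x - h x) * φ x) * f x := by
  rw [L2.inner_def]
  refine integral_congr_ae ?_
  filter_upwards [Lp.coeFn_add h (mulMap Ω φ (q - h)), coeFn_mulMap hφ (q - h),
    Lp.coeFn_sub q h] with x e1 e2 e3
  rw [e1, Pi.add_apply, e2, e3]
  simp only [RCLike.inner_apply, conj_trivial, Pi.sub_apply, smul_eq_mul]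
  ring

theorem memLp_top_affine {φ : Rn n → ℝ} (hφ : MemLp φ ⊤ (volume.restrict Ω)) (s t : ℝ) :
    MemLp (fun x => s + t * φ x) ⊤ (volume.restrict Ω) :=
  (memLp_top_const s).add (hφ.const_mul t)

/-- The two-sided problem in terms of the indicator function of `U`. -/
theorem isTwoSidedSolution_iff [IsFiniteMeasure (surfaceMeasure U)] (hn : 1 ≤ n) (hU : IsOpen U)
    (hUΩ : U ⊆ Ω) (hΩ : IsOpen Ω) (hconv : Convex ℝ Ω) (hb : Bornology.IsBounded Ω)
    (hne : Ω.Nonempty) {X : Rn n → Rn n} (hX : ContDiff ℝ 1 X) (hXc : HasCompactSupport X)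
    (hnormal : ∀ y ∈ frontier U, IsNormal U y (-X y)) (α β γ : ℝ) (q h : L2 Ω) (g u : H1 Ω) :
    IsTwoSidedSolution Ω U α β γ q h g u ↔ ∀ v : H1 Ω,
      energy Ω (fun x => α + (1 - α) * U.indicator (fun _ => 1) x)
        (fun x => β + (γ - β) * U.indicator (fun _ => 1) x) u v =
      ⟪loadFn Ω X (U.indicator fun _ => 1) (fun _ => 0) q h g, v.fn⟫ +
        ⟪loadVec Ω X (U.indicator fun _ => 1) g, v.grad⟫ := by
  have hχ : MemLp (U.indicator fun _ => (1 : ℝ)) ⊤ (volume.restrict Ω) :=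
    memLp_top_indicator_one hU.measurableSet
  -- On the interface itself D₀, c₀ and f₀ vanish while the affine expressions in the indicator take
  -- the outer values; the interface is a null set.
  have hcases : ∀ᵐ x ∂(volume.restrict Ω), x ∈ U ∨ (x ∉ U ∧ x ∈ Ω \ closure U) := by
    have h0 : ∀ᵐ x ∂(volume.restrict Ω), x ∉ frontier U :=
      ae_restrict_of_ae (measure_eq_zero_iff_ae_notMem.1 (volume_frontier_eq_zero hn))
    filter_upwards [h0, ae_restrict_mem hΩ.measurableSet] with x hx hxΩ
    by_cases hxU : x ∈ U
    · exact Or.inl hxU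
    · refine Or.inr ⟨hxU, hxΩ, fun hc => hx ?_⟩
      rw [hU.frontier_eq]
      exact ⟨hc, hxU⟩
  have hU2 : ∀ x ∈ U, x ∉ Ω \ closure U := fun x hx h => h.2 (subset_closure hx)
  refine forall_congr' fun v => ?_
  rw [integral_trace_mul_trace hU hUΩ hΩ hconv hb hne hX hXc hnormal, inner_load,
    energy_eq_integral (memLp_top_affine hχ α (1 - α)) (memLp_top_affine hχ β (γ - β)),
    inner_add_mulMap_sub hχ, inner_mulMap (memLp_top_const 0)]
  have e1 : ∫ x in Ω, (D₀ Ω U α x * ⟪u.grad x, v.grad x⟫ + c₀ Ω U β γ x * u.fn x * v.fn x) =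
      ∫ x in Ω, ((α + (1 - α) * U.indicator (fun _ => 1) x) * ⟪u.grad x, v.grad x⟫ +
        (β + (γ - β) * U.indicator (fun _ => 1) x) * u.fn x * v.fn x) := by
    refine integral_congr_ae ?_
    filter_upwards [hcases] with x hx
    rcases hx with hx | ⟨hx, hx'⟩
    · simp [D₀, c₀, hx, hU2 x hx]
    · simp only [D₀, c₀, indicator_of_notMem hx, indicator_of_mem hx']
      ring
  have e2 : ∫ x in Ω, f₀ Ω U q h x * v.fn x =
      ∫ x in Ω, (h x + (q x - h x) * U.indicator (fun _ => 1) x) * v.fn x := by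
    refine integral_congr_ae ?_
    filter_upwards [hcases] with x hx
    rcases hx with hx | ⟨hx, hx'⟩
    · simp [f₀, hx, hU2 x hx]
    · simp only [f₀, indicator_of_notMem hx, indicator_of_mem hx']
      ring
  rw [e1, e2]
  simp only [zero_mul, integral_zero, sub_zero]
  constructor <;> intro H <;> linarith

theorem memLp_top_phaseField (hU : IsOpen U) {ε : ℝ} (hε : 0 < ε) :
    MemLp (phaseField U ε) ⊤ (volume.restrict Ω) :=
  memLp_top_of_bound (lipschitzWith_phaseField hU hε).continuous.aestronglyMeasurable 1
    (Eventually.of_forall fun x => by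
      rw [Real.norm_of_nonneg (phaseField_mem_Icc x).1]
      exact (phaseField_mem_Icc x).2)

theorem memLp_top_gradient_phaseField (hU : IsOpen U) {ε : ℝ} (hε : 0 < ε) :
    MemLp (gradient (phaseField U ε)) ⊤ (volume.restrict Ω) :=
  memLp_top_of_bound (measurable_gradient _).aestronglyMeasurable (1 / (2 * ε))
    (Eventually.of_forall fun x => norm_gradient_phaseField_le hU hε x)

theorem memLp_top_inner_gradient_phaseField (hU : IsOpen U) {ε : ℝ} (hε : 0 < ε)
    {X : Rn n → Rn n} (hX : Continuous X) (hXc : HasCompactSupport X) :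
    MemLp (fun x => ⟪gradient (phaseField U ε) x, X x⟫) ⊤ (volume.restrict Ω) :=
  (innerForm (Rn n)).memLp_of_bilin ⊤ (memLp_top_gradient_phaseField hU hε)
    (hX.memLp_top_of_hasCompactSupport hXc _)

/-- The defect between the diffuse surface density and its representation by the field `X`. -/
def densityDefect (U : Set (Rn n)) (X : Rn n → Rn n) (ε : ℝ) (x : Rn n) : ℝ :=
  ‖gradient (phaseField U ε) x‖ - ⟪gradient (phaseField U ε) x, X x⟫

theorem memLp_top_densityDefect (hU : IsOpen U) {ε : ℝ} (hε : 0 < ε)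
    {X : Rn n → Rn n} (hX : Continuous X) (hXc : HasCompactSupport X) :
    MemLp (densityDefect U X ε) ⊤ (volume.restrict Ω) :=
  (memLp_top_gradient_phaseField hU hε).norm.sub
    (memLp_top_inner_gradient_phaseField hU hε hX hXc)

theorem isDiffuseSolution_iff (hU : IsOpen U) (hΩ : IsOpen Ω) (hconv : Convex ℝ Ω)
    (hb : Bornology.IsBounded Ω) (hne : Ω.Nonempty) {X : Rn n → Rn n} (hX : ContDiff ℝ 1 X)
    (hXc : HasCompactSupport X) (hXΩ : tsupport X ⊆ Ω) {ε : ℝ} (hε : 0 < ε) (α β γ : ℝ)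
    (q h : L2 Ω) (g u : H1 Ω) :
    IsDiffuseSolution Ω U α β γ q h g ε u ↔ ∀ v : H1 Ω,
      energy Ω (Dε U α ε) (cε U β γ ε) u v =
      ⟪loadFn Ω X (phaseField U ε) (densityDefect U X ε) q h g, v.fn⟫ +
        ⟪loadVec Ω X (phaseField U ε) g, v.grad⟫ := by
  have hφ : MemLp (phaseField U ε) ⊤ (volume.restrict Ω) := memLp_top_phaseField hU hε
  have hD : MemLp (Dε U α ε) ⊤ (volume.restrict Ω) := memLp_top_affine hφ α (1 - α)
  have hc : MemLp (cε U β γ ε) ⊤ (volume.restrict Ω) := memLp_top_affine hφ β (γ - β)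
  have hg : MemLp (fun x => ‖gradient (phaseField U ε) x‖) ⊤ (volume.restrict Ω) :=
    (memLp_top_gradient_phaseField hU hε).norm
  have hi : MemLp (fun x => ⟪gradient (phaseField U ε) x, X x⟫) ⊤ (volume.restrict Ω) :=
    memLp_top_inner_gradient_phaseField hU hε hX.continuous hXc
  have hm : MemLp (densityDefect U X ε) ⊤ (volume.restrict Ω) :=
    memLp_top_densityDefect hU hε hX.continuous hXc
  refine forall_congr' fun v => ?_
  have hflux := inner_mulMap_inner_gradient hΩ hconv hb hne hX hXc hXΩ
    (lipschitzWith_phaseField hU hε) hφ hi g v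
  -- The density |∇φ_ε| itself blows up as ε → 0; its singular part ∇φ_ε·X is traded for the bounded
  -- weight φ_ε by parts.
  have hsplit : ⟪mulMap Ω (fun x => ‖gradient (phaseField U ε) x‖) g.fn, v.fn⟫ =
      ⟪mulMap Ω (densityDefect U X ε) g.fn, v.fn⟫ +
        ⟪mulMap Ω (fun x => ⟪gradient (phaseField U ε) x, X x⟫) g.fn, v.fn⟫ := by
    rw [inner_mulMap hg, inner_mulMap hm, inner_mulMap hi,
      ← integral_add (integrable_mul_inner hm _ _) (integrable_mul_inner hi _ _)]
    refine integral_congr_ae (Eventually.of_forall fun x => ?_)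
    simp only [densityDefect]
    ring
  have e : ∫ x in Ω, (Dε U α ε x * ⟪u.grad x, v.grad x⟫ + cε U β γ ε x * u.fn x * v.fn x +
      g.fn x * ‖gradient (phaseField U ε) x‖ * v.fn x) = energy Ω (Dε U α ε) (cε U β γ ε) u v +
      ⟪mulMap Ω (fun x => ‖gradient (phaseField U ε) x‖) g.fn, v.fn⟫ := by
    have hc' : ∀ x, cε U β γ ε x * u.fn x * v.fn x = cε U β γ ε x * ⟪u.fn x, v.fn x⟫ :=
      fun x => by
        simp only [RCLike.inner_apply, conj_trivial]
        ring
    have hg' : ∀ x, g.fn x * ‖gradient (phaseField U ε) x‖ * v.fn x =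
        ‖gradient (phaseField U ε) x‖ * ⟪g.fn x, v.fn x⟫ := fun x => by
      simp only [RCLike.inner_apply, conj_trivial]
      ring
    simp_rw [hc', hg']
    have h12 : Integrable (fun x => Dε U α ε x * ⟪u.grad x, v.grad x⟫ +
        cε U β γ ε x * ⟪u.fn x, v.fn x⟫) (volume.restrict Ω) :=
      (integrable_mul_inner hD _ _).add (integrable_mul_inner hc _ _)
    rw [integral_add h12 (integrable_mul_inner hg _ _), integral_add (integrable_mul_inner hD _ _)
      (integrable_mul_inner hc _ _), energy_apply, inner_mulMap hD, inner_mulMap hc,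
      inner_mulMap hg]
  rw [e, hsplit, hflux, inner_load, inner_add_mulMap_sub hφ]
  unfold fε
  constructor <;> intro H <;> linarith

end

/-! ### Convergence of coefficients and data -/

section

variable {n : ℕ} {Ω U : Set (Rn n)}

theorem le_add_sub_mul {κ s t p : ℝ} (hs : κ ≤ s) (ht : κ ≤ t) (hp : p ∈ Icc (0 : ℝ) 1) :
    κ ≤ s + (t - s) * p := by
  nlinarith [mul_nonneg (sub_nonneg.2 hs) (sub_nonneg.2 hp.2), mul_nonneg (sub_nonneg.2 ht) hp.1]

theorem add_sub_mul_le {C s t p : ℝ} (hs : s ≤ C) (ht : t ≤ C) (hp : p ∈ Icc (0 : ℝ) 1) :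
    s + (t - s) * p ≤ C := by
  nlinarith [mul_nonneg (sub_nonneg.2 hs) (sub_nonneg.2 hp.2), mul_nonneg (sub_nonneg.2 ht) hp.1]

theorem norm_add_sub_mul_le {C s t p : ℝ} (hs0 : 0 ≤ s) (ht0 : 0 ≤ t) (hs : s ≤ C) (ht : t ≤ C)
    (hp : p ∈ Icc (0 : ℝ) 1) : ‖s + (t - s) * p‖ ≤ C := by
  rw [Real.norm_of_nonneg (le_add_sub_mul hs0 ht0 hp)]
  exact add_sub_mul_le hs ht hp

theorem indicator_one_mem_Icc (U : Set (Rn n)) (x : Rn n) :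
    U.indicator (fun _ => (1 : ℝ)) x ∈ Icc (0 : ℝ) 1 := by
  by_cases hx : x ∈ U <;> simp [hx]

section Convergence

variable {ε : ℕ → ℝ}

theorem tendsto_phaseField (hne : (frontier U).Nonempty) (hε : ∀ k, 0 < ε k)
    (hlim : Tendsto ε atTop (𝓝 0)) {x : Rn n} (hx : x ∉ frontier U) :
    Tendsto (fun k => phaseField U (ε k) x) atTop (𝓝 (U.indicator (fun _ => 1) x)) := by
  have hd : 0 < Metric.infDist x (frontier U) :=
    (isClosed_frontier.notMem_iff_infDist_pos hne).1 hx
  rw [tendsto_iff_norm_sub_tendsto_zero]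
  have h0 := hlim.div_const (Metric.infDist x (frontier U))
  rw [zero_div] at h0
  refine squeeze_zero (fun _ => norm_nonneg _) (fun k => ?_) h0
  refine (abs_phaseField_sub_indicator_le (hε k) x).trans
    ((one_div_one_add_sq_le_inv (div_pos hd (hε k))).trans_eq ?_)
  rw [one_div_div]

/-- The bound s/(1+s²) ≤ 1 makes this uniform in δ, which is the domination required below. -/
theorem abs_densityDefect_le (hU : IsOpen U) (hne : (frontier U).Nonempty) {X : Rn n → Rn n}
    {L : NNReal} (hX : LipschitzWith L X) (hnormal : ∀ y ∈ frontier U, IsNormal U y (-X y))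
    {δ : ℝ} (hδ : 0 < δ) {x : Rn n} (hx : x ∉ frontier U)
    (hd : DifferentiableAt ℝ (signedDist U) x) : ‖densityDefect U X δ x‖ ≤ L :=
  (abs_norm_gradient_phaseField_sub_inner_le hU hne hδ hX hnormal hx hd).trans
    (mul_le_of_le_one_right L.coe_nonneg (div_one_add_sq_le_one _))

theorem tendsto_densityDefect (hU : IsOpen U) (hne : (frontier U).Nonempty) {X : Rn n → Rn n}
    {L : NNReal} (hX : LipschitzWith L X) (hnormal : ∀ y ∈ frontier U, IsNormal U y (-X y))
    (hε : ∀ k, 0 < ε k) (hlim : Tendsto ε atTop (𝓝 0)) {x : Rn n} (hx : x ∉ frontier U)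
    (hd : DifferentiableAt ℝ (signedDist U) x) :
    Tendsto (fun k => densityDefect U X (ε k) x) atTop (𝓝 0) := by
  have hpos : 0 < Metric.infDist x (frontier U) :=
    (isClosed_frontier.notMem_iff_infDist_pos hne).1 hx
  have h0 := (hlim.div_const (Metric.infDist x (frontier U))).const_mul (L : ℝ)
  rw [zero_div, mul_zero] at h0
  refine squeeze_zero_norm (fun k => ?_) h0
  refine (abs_norm_gradient_phaseField_sub_inner_le hU hne (hε k) hX hnormal hx hd).trans ?_
  refine mul_le_mul_of_nonneg_left ?_ L.coe_nonneg
  refine (div_one_add_sq_le_inv (div_pos hpos (hε k))).trans_eq ?_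
  rw [one_div_div]

/-- Convergence of the data of the diffuse problems. -/
theorem tendsto_load [IsFiniteMeasure (surfaceMeasure U)] (hn : 1 ≤ n) (hU : IsOpen U)
    (hne : (frontier U).Nonempty) {X : Rn n → Rn n} (hX : ContDiff ℝ 1 X)
    (hXc : HasCompactSupport X) (hnormal : ∀ y ∈ frontier U, IsNormal U y (-X y))
    (hε : ∀ k, 0 < ε k) (hlim : Tendsto ε atTop (𝓝 0)) (q h : L2 Ω) (g : H1 Ω) :
    Tendsto (fun k => loadFn Ω X (phaseField U (ε k)) (densityDefect U X (ε k)) q h g) atTop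
        (𝓝 (loadFn Ω X (U.indicator fun _ => 1) (fun _ => 0) q h g)) ∧
      Tendsto (fun k => loadVec Ω X (phaseField U (ε k)) g) atTop
        (𝓝 (loadVec Ω X (U.indicator fun _ => 1) g)) := by
  obtain ⟨L, hL⟩ := ContDiff.lipschitzWith_of_hasCompactSupport hXc hX one_ne_zero
  obtain ⟨A, hA⟩ := hX.continuous.bounded_above_of_compact_support hXc
  obtain ⟨B, hB⟩ := (continuous_divergence hX).bounded_above_of_compact_support
    (hasCompactSupport_divergence hXc)
  have hfr : ∀ᵐ x ∂(volume.restrict Ω), x ∉ frontier U :=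
    ae_restrict_of_ae (measure_eq_zero_iff_ae_notMem.1 (volume_frontier_eq_zero hn))
  have hdiff : ∀ᵐ x ∂(volume.restrict Ω), DifferentiableAt ℝ (signedDist U) x :=
    ae_restrict_of_ae (lipschitzWith_signedDist hU).ae_differentiableAt
  have hφm : ∀ k, AEStronglyMeasurable (phaseField U (ε k)) (volume.restrict Ω) := fun k =>
    (memLp_top_phaseField hU (hε k)).1
  have hχm : AEStronglyMeasurable (U.indicator fun _ => (1 : ℝ)) (volume.restrict Ω) :=
    (memLp_top_indicator_one hU.measurableSet).1
  have hnorm : ∀ {p : ℝ}, p ∈ Icc (0 : ℝ) 1 → ‖p‖ ≤ 1 := fun hp => by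
    rw [Real.norm_of_nonneg hp.1]
    exact hp.2
  have hφlim : ∀ᵐ x ∂(volume.restrict Ω), Tendsto (fun k => phaseField U (ε k) x) atTop
      (𝓝 (U.indicator (fun _ => 1) x)) := by
    filter_upwards [hfr] with x hx using tendsto_phaseField hne hε hlim hx
  -- The weight φX acts once by inner product on ∇g and once by scaling with g, so the limit is
  -- proved for a general bilinear map M.
  have hφX : ∀ {F : Type} [NormedAddCommGroup F] [NormedSpace ℝ F] {E : Type}
      [NormedAddCommGroup E] [NormedSpace ℝ E] (M : Rn n →L[ℝ] E →L[ℝ] F)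
      (f : Lp E 2 ((volume : Measure (Rn n)).restrict Ω)),
      Tendsto (fun k => weightedMap (volume.restrict Ω) M (fun x => phaseField U (ε k) x • X x) f)
        atTop (𝓝 (weightedMap (volume.restrict Ω) M
          (fun x => U.indicator (fun _ => (1 : ℝ)) x • X x) f)) := by
    intro F _ _ E _ _ M f
    have hb : ∀ {p : ℝ} (x : Rn n), p ∈ Icc (0 : ℝ) 1 → ‖p • X x‖ ≤ A := fun x hp => by
      rw [norm_smul]
      exact (mul_le_of_le_one_left (norm_nonneg _) (hnorm hp)).trans (hA x)
    refine tendsto_weightedMap M (fun k => (hφm k).smul hX.continuous.aestronglyMeasurable)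
      (hχm.smul hX.continuous.aestronglyMeasurable) (C := A)
      (fun k => Eventually.of_forall fun x => hb x (phaseField_mem_Icc x))
      (Eventually.of_forall fun x => hb x (indicator_one_mem_Icc U x)) ?_ f
    filter_upwards [hφlim] with x hx using hx.smul_const (X x)
  refine ⟨((tendsto_const_nhds.add ?_).sub ?_).add (Tendsto.add ?_ (hφX _ _)), hφX _ _⟩
  · exact tendsto_weightedMap _ hφm hχm
      (fun k => Eventually.of_forall fun x => hnorm (phaseField_mem_Icc x))
      (Eventually.of_forall fun x => hnorm (indicator_one_mem_Icc U x)) hφlim _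
  · refine tendsto_weightedMap _ (fun k => (memLp_top_densityDefect hU (hε k) hX.continuous hXc).1)
      aestronglyMeasurable_const (C := L) (fun k => ?_)
      (Eventually.of_forall fun x => by simp) ?_ _
    · filter_upwards [hfr, hdiff] with x hx hx'
        using abs_densityDefect_le hU hne hL hnormal (hε k) hx hx'
    · filter_upwards [hfr, hdiff] with x hx hx'
        using tendsto_densityDefect hU hne hL hnormal hε hlim hx hx'
  · have hb : ∀ {p : ℝ} (x : Rn n), p ∈ Icc (0 : ℝ) 1 → ‖p * divergence X x‖ ≤ B := fun x hp => by
      rw [norm_mul]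
      exact (mul_le_of_le_one_left (norm_nonneg _) (hnorm hp)).trans (hB x)
    have hdm : AEStronglyMeasurable (divergence X) (volume.restrict Ω) :=
      (continuous_divergence hX).aestronglyMeasurable
    refine tendsto_weightedMap _ (fun k => (hφm k).mul hdm) (hχm.mul hdm) (C := B)
      (fun k => Eventually.of_forall fun x => hb x (phaseField_mem_Icc x))
      (Eventually.of_forall fun x => hb x (indicator_one_mem_Icc U x)) ?_ _
    filter_upwards [hφlim] with x hx using hx.mul_const (divergence X x)

end Convergence

end

end DiffuseDomain

end

/-! ### The theorem -/

open DiffuseDomain in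
theorem theorem2 {n : ℕ} (hn : 1 ≤ n) (a b : Fin n → ℝ) (Ω₁ : Set (DiffuseDomain.Rn n))
    (hopen : IsOpen Ω₁) (hne : Ω₁.Nonempty) (hC3 : DiffuseDomain.HasC3Boundary Ω₁)
    (hsub : closure Ω₁ ⊆ DiffuseDomain.cuboid a b)
    (α β γ : ℝ) (hα : 0 < α) (hβ : 0 < β) (hγ : 0 < γ)
    (q h : DiffuseDomain.L2 (DiffuseDomain.cuboid a b))
    (g : DiffuseDomain.H1 (DiffuseDomain.cuboid a b)) :
    (∃! u₀, DiffuseDomain.IsTwoSidedSolution (DiffuseDomain.cuboid a b) Ω₁ α β γ q h g u₀) ∧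
    (∀ ε ∈ Set.Ioo (0 : ℝ) 1,
      ∃! u, DiffuseDomain.IsDiffuseSolution (DiffuseDomain.cuboid a b) Ω₁ α β γ q h g ε u) ∧
    ∀ (u₀ : DiffuseDomain.H1 (DiffuseDomain.cuboid a b))
      (u : ℝ → DiffuseDomain.H1 (DiffuseDomain.cuboid a b)),
      DiffuseDomain.IsTwoSidedSolution (DiffuseDomain.cuboid a b) Ω₁ α β γ q h g u₀ →
      (∀ ε ∈ Set.Ioo (0 : ℝ) 1,
        DiffuseDomain.IsDiffuseSolution (DiffuseDomain.cuboid a b) Ω₁ α β γ q h g ε (u ε)) →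
      ∀ ε : ℕ → ℝ, (∀ k, ε k ∈ Set.Ioo (0 : ℝ) 1) →
        Filter.Tendsto ε Filter.atTop (nhds 0) →
        ∃ j : ℕ → ℕ, StrictMono j ∧
          Filter.Tendsto (fun k => u (ε (j k))) Filter.atTop (nhds u₀) := by
  have hΩ := isOpen_cuboid a b
  have hconv := convex_cuboid a b
  have hb := isBounded_cuboid a b
  have hUΩ : Ω₁ ⊆ cuboid a b := subset_closure.trans hsub
  have hUb := hb.subset hUΩ
  have hΩne : (cuboid a b).Nonempty := hne.mono hUΩ
  have hfne := frontier_nonempty hn hne hUb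
  obtain ⟨X, hX, hXc, hXΩ, hnormal⟩ := exists_normal_field hUb hC3 hΩ hb
    (frontier_subset_closure.trans hsub)
  have hfin : IsFiniteMeasure (surfaceMeasure Ω₁) :=
    isFiniteMeasure_surfaceMeasure hopen hUb fun y hy => ⟨_, hnormal y hy⟩
  -- All coefficients are convex combinations of 1 and α, or of γ and β, so κ is an ellipticity
  -- constant independent of ε.
  obtain ⟨κ, hκ, hκ1, hκα, hκβ, hκγ⟩ : ∃ κ : ℝ, 0 < κ ∧ κ ≤ 1 ∧ κ ≤ α ∧ κ ≤ β ∧ κ ≤ γ :=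
    ⟨min (min 1 α) (min β γ), by positivity, by simp, by simp, by simp, by simp⟩
  have hsharp := isTwoSidedSolution_iff hn hopen hUΩ hΩ hconv hb hΩne hX hXc hnormal α β γ q h g
  have hdiffuse : ∀ ε ∈ Set.Ioo (0 : ℝ) 1, ∀ u, _ := fun ε hε =>
    isDiffuseSolution_iff hopen hΩ hconv hb hΩne hX hXc hXΩ hε.1 α β γ q h g
  have hχ : MemLp (Ω₁.indicator fun _ => (1 : ℝ)) ⊤ (volume.restrict (cuboid a b)) :=
    memLp_top_indicator_one hopen.measurableSet
  have hφ : ∀ ε ∈ Set.Ioo (0 : ℝ) 1, MemLp (phaseField Ω₁ ε) ⊤ (volume.restrict (cuboid a b)) :=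
    fun ε hε => memLp_top_phaseField hopen hε.1
  refine ⟨(existsUnique_congr fun u => hsharp u).2 ?_, fun ε hε =>
    (existsUnique_congr fun u => hdiffuse ε hε u).2 ?_, fun u₀ u hu₀ hu ε hε hlim =>
    -- The whole sequence converges, so the subsequence is the sequence itself.
    ⟨id, strictMono_id, ?_⟩⟩
  · exact existsUnique_energy_eq (memLp_top_affine hχ _ _) (memLp_top_affine hχ _ _) hκ
      (Eventually.of_forall fun x => le_add_sub_mul hκα hκ1 (indicator_one_mem_Icc Ω₁ x))
      (Eventually.of_forall fun x => le_add_sub_mul hκβ hκγ (indicator_one_mem_Icc Ω₁ x)) _ _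
  · exact existsUnique_energy_eq (memLp_top_affine (hφ ε hε) _ _)
      (memLp_top_affine (hφ ε hε) _ _) hκ
      (Eventually.of_forall fun x => le_add_sub_mul hκα hκ1 (phaseField_mem_Icc x))
      (Eventually.of_forall fun x => le_add_sub_mul hκβ hκγ (phaseField_mem_Icc x)) _ _
  · have hload := tendsto_load hn hopen hfne hX hXc hnormal (fun k => (hε k).1) hlim q h g
    have hφlim : ∀ᵐ x ∂(volume.restrict (cuboid a b)),
        Tendsto (fun k => phaseField Ω₁ (ε k) x) atTop (𝓝 (Ω₁.indicator (fun _ => 1) x)) := by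
      filter_upwards [ae_restrict_of_ae
        (measure_eq_zero_iff_ae_notMem.1 (volume_frontier_eq_zero hn (U := Ω₁)))] with x hx
      exact tendsto_phaseField hfne (fun k => (hε k).1) hlim hx
    obtain ⟨C, hC1, hCα, hCβ, hCγ⟩ : ∃ C : ℝ, 1 ≤ C ∧ α ≤ C ∧ β ≤ C ∧ γ ≤ C :=
      ⟨max (max 1 α) (max β γ), by simp, by simp, by simp, by simp⟩
    refine tendsto_of_energy_eq (C := C) hκ
      (fun k => (memLp_top_affine (hφ _ (hε k)) α (1 - α)).1)
      (fun k => (memLp_top_affine (hφ _ (hε k)) β (γ - β)).1)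
      (memLp_top_affine hχ α (1 - α)).1 (memLp_top_affine hχ β (γ - β)).1
      (fun k x => norm_add_sub_mul_le hα.le zero_le_one hCα hC1 (phaseField_mem_Icc x))
      (fun k x => norm_add_sub_mul_le hβ.le hγ.le hCβ hCγ (phaseField_mem_Icc x))
      (fun x => norm_add_sub_mul_le hα.le zero_le_one hCα hC1 (indicator_one_mem_Icc Ω₁ x))
      (fun x => norm_add_sub_mul_le hβ.le hγ.le hCβ hCγ (indicator_one_mem_Icc Ω₁ x))
      (fun k x => le_add_sub_mul hκα hκ1 (phaseField_mem_Icc x))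
      (fun k x => le_add_sub_mul hκβ hκγ (phaseField_mem_Icc x)) ?_ ?_ hload.1 hload.2
      (fun k => (hdiffuse _ (hε k) _).1 (hu _ (hε k))) ((hsharp u₀).1 hu₀)
    · filter_upwards [hφlim] with x hx using (hx.const_mul _).const_add _
    · filter_upwards [hφlim] with x hx using (hx.const_mul _).const_add _
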